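/- **Conventions.** Fix one-qubit unitaries $U_1,\dots,U_g$ and $\delta\in\mathbb R$. A quantum circuit is built from the gates $U_i$, CNOT, generalised Toffoli gates and classical fanout gates (the targets of a fanout gate are ancillas in state $|0\rangle$ not acted on before, and are used only as controls afterwards); its *weft* is the largest number of generalised Toffoli gates on a path from an input qubit to the output qubit. A weight-preserving circuit is built from the gates $\hat U_i=1\oplus U_i\oplus 1$ (in the basis $|00\rangle,(|01\rangle,|10\rangle),|11\rangle$), Fredkin gates and $E=\mathrm{diag}(1,e^{i\delta})$; its unitary maps every basis state of Hamming weight $k$ into the span of the basis states of weight $k$. A circuit accepts if its output qubit is measured as $1$. A state has weight $k$ if only basis states of Hamming weight $k$ have non-zero amplitude. Instances are encoded as binary strings (numbers in unary). Let $c,s:\mathbb N\to[0,1]$. * **$\text{Mini-QCSAT}_t(c,s)$.** Instance: $k,n$ in unary and a circuit of weft at most $t$ with at most $k\log_2 n$ qubits (witness qubits and ancillas in state $|0\rangle$) and at most $k\log_2 n$ gates. Parameter: $k$. Yes: some state of the witness qubits is accepted with probability at least $c(n)$. No: every state of the witness qubits is accepted with probability at most $s(n)$. * **Weight-$k$ Weight-Preserving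 Quantum Circuit Satisfiability$(c,s)$**, for a polynomial $p$ and a computable $f$. Instance: $k$ and a weight-preserving circuit on $n$ witness qubits and at most $p(n)$ ancillas, with at most $p(n)$ gates, the ancillas starting in a given basis state of Hamming weight at most $f(k)$. Parameter: $k$. Yes: some $n$-qubit witness state of weight $k$ is accepted with probability at least $c(n)$. No: every $n$-qubit witness state of weight $k$ is accepted with probability at most $s(n)$. * **Reductions.** An FPQT reduction from a parameterized (promise) problem with parameter $\kappa$ to one with parameter $\kappa'$ is a map $R$ on strings that sends yes-instances to yes-instances and no-instances to no-instances, satisfies $\kappa'(R(x))\le h(\kappa(x))$ for some computable $h$, and can be computed with success probability at least $2/3$ by a quantum algorithm in time $F(\kappa(x))\,|x|^{O(1)}$ with $F$ computable. The class $\mathsf{QM}_{c,s}[t]$ consists of the parameterized problems that are FPQT-reducible to $\text{Mini-QCSAT}_t(c,s)$. **Lemma.** There are a polynomial $p$ and a computable function $f$ such that, for all $U_1,\dots,U_g$ and $\delta$ as above, all non-increasing $c:\mathbb N\to[0,1]$ and all non-decreasing $s:\mathbb N\to[0,1]$ (for example constants), Weight-$k$ Weight-Preserving Quantum Circuit Satisfiability$(c,s)$,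 with the bounds $p$ and $f$, is $\mathsf{QM}_{c,s}[1]$-hard: every problem in $\mathsf{QM}_{c,s}[1]$ is FPQT-reducible to it. -/

import Mathlib

open scoped BigOperators

noncomputable section

namespace WPQ

/-! ### Classical algorithms

Structured programs over finitely many stacks of bits (the stacks of a program are among
countably many registers).  A step reads or writes one symbol, so running times agree, up to a
polynomial, with those of multi-tape Turing machines. -/

/-- The contents of the registers; the head of a list is the top of the stack. -/
abbrev Store : Type := ℕ → List Bool

/-- Programs.  `branch r e f t` branches on the top symbol of register `r` (empty, `false`,
`true`); `loop r p` repeats `p` while register `r` is not empty. -/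
inductive Prog : Type
  | skip : Prog
  | push : ℕ → Bool → Prog
  | pop : ℕ → Prog
  | seq : Prog → Prog → Prog
  | branch : ℕ → Prog → Prog → Prog → Prog
  | loop : ℕ → Prog → Prog

/-- `Run P σ t τ`: started in store `σ`, the program `P` halts after `t` steps in store `τ`. -/
inductive Run : Prog → Store → ℕ → Store → Prop
  | skip (σ : Store) : Run Prog.skip σ 1 σ
  | push (r : ℕ) (b : Bool) (σ : Store) :
      Run (Prog.push r b) σ 1 (Function.update σ r (b :: σ r))
  | pop (r : ℕ) (σ : Store) :
      Run (Prog.pop r) σ 1 (Function.update σ r (σ r).tail)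
  | seq {P Q : Prog} {σ τ ρ : Store} {t u : ℕ} :
      Run P σ t τ → Run Q τ u ρ → Run (Prog.seq P Q) σ (t + u) ρ
  | branchNil {r : ℕ} {P Q R : Prog} {σ τ : Store} {t : ℕ} :
      σ r = [] → Run P σ t τ → Run (Prog.branch r P Q R) σ (t + 1) τ
  | branchFalse {r : ℕ} {P Q R : Prog} {σ τ : Store} {t : ℕ} :
      (σ r).head? = some false → Run Q σ t τ → Run (Prog.branch r P Q R) σ (t + 1) τ
  | branchTrue {r : ℕ} {P Q R : Prog} {σ τ : Store} {t : ℕ} :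
      (σ r).head? = some true → Run R σ t τ → Run (Prog.branch r P Q R) σ (t + 1) τ
  | loopNil {r : ℕ} {P : Prog} {σ : Store} :
      σ r = [] → Run (Prog.loop r P) σ 1 σ
  | loopCons {r : ℕ} {P : Prog} {σ τ ρ : Store} {t u : ℕ} :
      σ r ≠ [] → Run P σ t τ → Run (Prog.loop r P) τ u ρ →
        Run (Prog.loop r P) σ (t + u + 1) ρ

/-- The initial store: the inputs in registers `0, 1, …`, all other registers empty. -/
def inputStore (xs : List (List Bool)) : Store := fun r => xs.getD r []

/-- On the inputs `xs`, the program `P` halts after at most `T` steps with output `y` (the final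
content of register `0`). -/
def Outputs (P : Prog) (xs : List (List Bool)) (T : ℕ) (y : List Bool) : Prop :=
  ∃ (t : ℕ) (τ : Store), t ≤ T ∧ Run P (inputStore xs) t τ ∧ τ 0 = y

/-- Binary strings for finite sequences of numbers: `a` is written as `a` ones and a zero. -/
def encodeNats (l : List ℕ) : List Bool :=
  l.flatMap fun a => List.replicate a true ++ [false]

/-! ### States and operators of `N` qubits -/

/-- Labels of the computational basis of `N` qubits. -/
abbrev Bits (N : ℕ) : Type := Fin N → Bool

/-- Vectors of `N` qubits, by their amplitudes. -/
abbrev QVec (N : ℕ) : Type := Bits N → ℂ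

/-- Operators on `N` qubits, by their matrices in the computational basis. -/
abbrev QOp (N : ℕ) : Type := Matrix (Bits N) (Bits N) ℂ

/-- Unit vectors. -/
def IsState {N : ℕ} (ψ : QVec N) : Prop := ∑ x, ‖ψ x‖ ^ 2 = 1

/-- Hamming weight. -/
def weight {N : ℕ} (x : Bits N) : ℕ := (Finset.univ.filter fun i => x i = true).card

/-- `ψ` has weight `k`: only basis states of Hamming weight `k` have a non-zero amplitude. -/
def HasWeight {N : ℕ} (k : ℕ) (ψ : QVec N) : Prop := ∀ x, weight x ≠ k → ψ x = 0

/-- Weight-preserving operators: basis states of weight `k` go to vectors of weight `k`. -/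
def WeightPreserving {N : ℕ} (O : QOp N) : Prop :=
  ∀ (k : ℕ) (x : Bits N), weight x = k → HasWeight k (O.mulVec (Pi.single x 1))

/-- The operator that maps the basis state `y` to the basis state `φ y`. -/
def basisMap {N : ℕ} (φ : Bits N → Bits N) : QOp N := fun x y => if x = φ y then 1 else 0

/-- The one-qubit operator `V` on qubit `q` (`false` is `|0⟩`, `true` is `|1⟩`). -/
def oneQubit {N : ℕ} (V : Matrix Bool Bool ℂ) (q : Fin N) : QOp N := fun x y =>
  if ∀ j, j ≠ q → x j = y j then V (x q) (y q) else 0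

/-- The two-qubit matrix `1 ⊕ V ⊕ 1` in the basis `|00⟩, (|01⟩, |10⟩), |11⟩`. -/
def hatMatrix (V : Matrix Bool Bool ℂ) : Matrix (Bool × Bool) (Bool × Bool) ℂ := fun x y =>
  if x.1 ≠ x.2 ∧ y.1 ≠ y.2 then V x.1 y.1 else if x = y then 1 else 0

/-- The gate `1 ⊕ V ⊕ 1` on the pair of qubits `(p, q)`. -/
def hatOp {N : ℕ} (V : Matrix Bool Bool ℂ) (p q : Fin N) : QOp N := fun x y =>
  if ∀ j, j ≠ p → j ≠ q → x j = y j then hatMatrix V (x p, x q) (y p, y q) else 0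

/-- The phase gate `diag(1, e^{iδ})`. -/
def phaseMatrix (δ : ℝ) : Matrix Bool Bool ℂ :=
  Matrix.diagonal fun b => if b then Complex.exp (δ * Complex.I) else 1

/-- The Hadamard gate. -/
def hadamardMatrix : Matrix Bool Bool ℂ := fun x y =>
  (if x && y then -1 else 1) / (Real.sqrt 2 : ℂ)

/-- The initial vector: `m` witness qubits in state `ψ`, followed by `a` ancilla qubits in the
basis state `z`. -/
def withAncillas {m a : ℕ} (ψ : QVec m) (z : Bits a) : QVec (m + a) := fun x =>
  if (fun j => x (Fin.natAdd m j)) = z then ψ (fun i => x (Fin.castAdd a i)) else 0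

/-- The probability that measuring qubit `q` of `ψ` gives `1`. -/
def probOne {N : ℕ} (ψ : QVec N) (q : Fin N) : ℝ :=
  ∑ x ∈ Finset.univ.filter (fun x : Bits N => x q = true), ‖ψ x‖ ^ 2

/-! ### Quantum circuits with generalised Toffoli and fanout gates -/

/-- Gates on `N` qubits over `g` one-qubit gates: one-qubit gate `i` on a qubit; CNOT (control,
target); generalised Toffoli (controls, target); fanout (source, targets). -/
inductive Gate (g N : ℕ) : Type
  | one : Fin g → Fin N → Gate g N
  | cnot : Fin N → Fin N → Gate g N
  | toffoli : List (Fin N) → Fin N → Gate g N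
  | fanout : Fin N → List (Fin N) → Gate g N

namespace Gate

variable {g N : ℕ}

/-- The qubits on which the gate acts otherwise than as a control. -/
def targets : Gate g N → List (Fin N)
  | one _ q => [q]
  | cnot _ t => [t]
  | toffoli _ t => [t]
  | fanout _ ts => ts

/-- The qubits used as controls. -/
def controls : Gate g N → List (Fin N)
  | one _ _ => []
  | cnot s _ => [s]
  | toffoli cs _ => cs
  | fanout s _ => [s]

/-- All qubits of the gate. -/
def wires (G : Gate g N) : List (Fin N) := G.controls ++ G.targets

/-- The qubits of the gate are pairwise distinct. -/
def WF (G : Gate g N) : Prop := G.wires.Nodup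

/-- `1` for a generalised Toffoli gate, `0` otherwise. -/
def toffoliCount : Gate g N → ℕ
  | toffoli _ _ => 1
  | _ => 0

/-- The operator of a gate, for the one-qubit gates `U`. -/
def op (U : Fin g → Matrix Bool Bool ℂ) : Gate g N → QOp N
  | one i q => oneQubit (U i) q
  | cnot s t => basisMap fun x => Function.update x t (xor (x t) (x s))
  | toffoli cs t => basisMap fun x => Function.update x t (xor (x t) (cs.all x))
  | fanout s ts => basisMap fun x j => xor (x j) (decide (j ∈ ts) && x s)

/-- Description of a gate. -/
def code : Gate g N → List ℕ
  | one i q => [0, i, q]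
  | cnot s t => [1, s, t]
  | toffoli cs t => 2 :: cs.length :: t.val :: cs.map Fin.val
  | fanout s ts => 3 :: ts.length :: s.val :: ts.map Fin.val

end Gate

/-- The operator of a circuit; the first gate of the list acts first. -/
def circuitOp {g N : ℕ} (U : Fin g → Matrix Bool Bool ℂ) : List (Gate g N) → QOp N
  | [] => 1
  | G :: C => circuitOp U C * G.op U

/-- For a circuit given in reversed order (last gate first), the largest number of generalised
Toffoli gates on a path from the beginning of some wire to the end of wire `q`. -/
def toffoliDepth {g N : ℕ} : List (Gate g N) → Fin N → ℕ
  | [], _ => 0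
  | G :: C, q =>
      if q ∈ G.wires then G.toffoliCount + G.wires.toFinset.sup (toffoliDepth C)
      else toffoliDepth C q

/-- The weft of a circuit with output qubit `out`. -/
def weft {g N : ℕ} (C : List (Gate g N)) (out : Fin N) : ℕ := toffoliDepth C.reverse out

/-- All fanout gates are classical, where the qubits `m, m + 1, …` are ancillas that start in
`|0⟩`: the targets of a fanout gate are ancillas, no earlier gate acts on them, and later gates
use them as controls only. -/
def ClassicalFanout {g N : ℕ} (m : ℕ) (C : List (Gate g N)) : Prop :=
  ∀ (L R : List (Gate g N)) (s : Fin N) (ts : List (Fin N)),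
    C = L ++ Gate.fanout s ts :: R →
      ∀ q ∈ ts, m ≤ q.val ∧ (∀ G ∈ L, q ∉ G.wires) ∧ (∀ G ∈ R, q ∉ G.targets)

/-! ### Parameterized problems and fixed-parameter quantum reductions -/

/-- A parameterized promise problem over the binary alphabet.  A parameterized language `L` has
`yes = L` and `no = Lᶜ`. -/
structure ParamProblem : Type where
  /-- The yes-instances. -/
  yes : Set (List Bool)
  /-- The no-instances. -/
  no : Set (List Bool)
  /-- The parameter of an instance. -/
  param : List Bool → ℕ

/-- `κ` is computable in polynomial time (with binary output). -/
def PolyTimeParam (κ : List Bool → ℕ) : Prop :=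
  ∃ (P : Prog) (p : Polynomial ℕ), ∀ x, Outputs P [x] (p.eval x.length) (Nat.bits (κ x))

/-- The one-qubit gates of quantum algorithms: `H` and `T`. -/
def cliffordT : Fin 2 → Matrix Bool Bool ℂ := ![hadamardMatrix, phaseMatrix (Real.pi / 4)]

/-- The probability of the measurement outcome `z` when a circuit over `H`, `T`, CNOT (and
Toffoli and fanout gates) is run on `|0…0⟩` and all qubits are measured. -/
def outcomeProb {w : ℕ} (C : List (Gate 2 w)) (z : Bits w) : ℝ :=
  ‖(circuitOp cliffordT C).mulVec (Pi.single (fun _ => false) 1) z‖ ^ 2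

/-- `R` is computable by a bounded-error fixed-parameter quantum algorithm with respect to the
parameterization `κ`: on input `x`, a classical program writes down a quantum circuit `C` on `w`
qubits, the circuit is run on `|0…0⟩` and measured, and a second classical program turns `x` and
the outcome into the output, which is `R x` with probability at least `2/3`.  Everything takes
time `f (κ x) * p |x|` with `f` computable and `p` a polynomial. -/
def FPQTComputable (κ : List Bool → ℕ) (R : List Bool → List Bool) : Prop :=
  ∃ (gen post : Prog) (f : ℕ → ℕ) (p : Polynomial ℕ), Computable f ∧
    ∀ x : List Bool, ∃ (w : ℕ) (C : List (Gate 2 w)) (out : Bits w → List Bool),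
      (∀ G ∈ C, G.WF) ∧
      Outputs gen [x] (f (κ x) * p.eval x.length) (encodeNats (w :: C.flatMap Gate.code)) ∧
      (∀ z, Outputs post [x, List.ofFn z] (f (κ x) * p.eval x.length) (out z)) ∧
      2 / 3 ≤ ∑ z ∈ Finset.univ.filter (fun z => out z = R x), outcomeProb C z

/-- FPQT (many-one) reducibility. -/
def FPQTReducible (A B : ParamProblem) : Prop :=
  ∃ R : List Bool → List Bool,
    (∀ x ∈ A.yes, R x ∈ B.yes) ∧ (∀ x ∈ A.no, R x ∈ B.no) ∧
    FPQTComputable A.param R ∧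
    ∃ h : ℕ → ℕ, Computable h ∧ ∀ x, B.param (R x) ≤ h (A.param x)

/-- The number of leading ones of a string: the first number of an encoded sequence. -/
def firstNat (x : List Bool) : ℕ := (x.takeWhile id).length

/-! ### The miniaturized quantum circuit satisfiability problem -/

/-- The numbers `k` and `n`, and a circuit on `m` witness qubits and `a` ancillas with an output
qubit. -/
structure MiniInstance (g : ℕ) : Type where
  k : ℕ
  n : ℕ
  m : ℕ
  a : ℕ
  out : Fin (m + a)
  circuit : List (Gate g (m + a))

namespace MiniInstance

variable {g : ℕ}

/-- Legal instances: a weft-`t` circuit with at most `k log₂ n` qubits (ancillas included) and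
at most `k log₂ n` gates. -/
def Valid (t : ℕ) (I : MiniInstance g) : Prop :=
  (∀ G ∈ I.circuit, G.WF) ∧ ClassicalFanout I.m I.circuit ∧
  weft I.circuit I.out ≤ t ∧
  ((I.m + I.a : ℕ) : ℝ) ≤ I.k * Real.logb 2 I.n ∧
  (I.circuit.length : ℝ) ≤ I.k * Real.logb 2 I.n

/-- The acceptance probability on the witness `ψ`: the ancillas start in `|0⟩`, and the circuit
accepts if the output qubit is measured as `1`. -/
def acceptProb (U : Fin g → Matrix Bool Bool ℂ) (I : MiniInstance g) (ψ : QVec I.m) : ℝ :=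
  probOne ((circuitOp U I.circuit).mulVec (withAncillas ψ fun _ => false)) I.out

/-- The instance as a string; `k` and `n` are written in unary. -/
def code (I : MiniInstance g) : List Bool :=
  encodeNats ([I.k, I.n, I.m, I.a, I.out.val] ++ I.circuit.flatMap Gate.code)

end MiniInstance

/-- Mini-QCSAT with weft `t`, completeness `c` and soundness `s`. -/
def MiniQCSAT {g : ℕ} (U : Fin g → Matrix Bool Bool ℂ) (t : ℕ) (c s : ℕ → unitInterval) :
    ParamProblem where
  yes := {x | ∃ I : MiniInstance g, I.code = x ∧ I.Valid t ∧
    ∃ ψ, IsState ψ ∧ (c I.n : ℝ) ≤ I.acceptProb U ψ}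
  no := {x | ∃ I : MiniInstance g, I.code = x ∧ I.Valid t ∧
    ∀ ψ, IsState ψ → I.acceptProb U ψ ≤ (s I.n : ℝ)}
  param := firstNat

/-- The class `QM_{c,s}[t]`. -/
def QM {g : ℕ} (U : Fin g → Matrix Bool Bool ℂ) (t : ℕ) (c s : ℕ → unitInterval) :
    Set ParamProblem :=
  {A | PolyTimeParam A.param ∧ FPQTReducible A (MiniQCSAT U t c s)}

/-- `B` is hard for `QM_{c,s}[t]` under FPQT reductions. -/
def QMHard {g : ℕ} (U : Fin g → Matrix Bool Bool ℂ) (t : ℕ) (c s : ℕ → unitInterval)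
    (B : ParamProblem) : Prop :=
  ∀ A ∈ QM U t c s, FPQTReducible A B

/-! ### Weight-preserving quantum circuit satisfiability -/

/-- The gates of weight-preserving circuits over `g` one-qubit gates: the gate `1 ⊕ U_i ⊕ 1` on a
pair of qubits; the Fredkin gate (control, and the two qubits to be swapped); the phase gate. -/
inductive WPGate (g N : ℕ) : Type
  | hat : Fin g → Fin N → Fin N → WPGate g N
  | fredkin : Fin N → Fin N → Fin N → WPGate g N
  | phase : Fin N → WPGate g N

namespace WPGate

variable {g N : ℕ}

/-- The qubits of the gate. -/
def wires : WPGate g N → List (Fin N)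
  | hat _ p q => [p, q]
  | fredkin s p q => [s, p, q]
  | phase q => [q]

/-- The qubits of the gate are pairwise distinct. -/
def WF (G : WPGate g N) : Prop := G.wires.Nodup

/-- The operator of a gate. -/
def op (U : Fin g → Matrix Bool Bool ℂ) (δ : ℝ) : WPGate g N → QOp N
  | hat i p q => hatOp (U i) p q
  | fredkin s p q => basisMap fun x => if x s then x ∘ Equiv.swap p q else x
  | phase q => oneQubit (phaseMatrix δ) q

/-- Description of a gate. -/
def code : WPGate g N → List ℕ
  | hat i p q => [0, i, p, q]
  | fredkin s p q => [1, s, p, q]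
  | phase q => [2, q]

end WPGate

/-- The operator of a circuit; the first gate of the list acts first. -/
def wpCircuitOp {g N : ℕ} (U : Fin g → Matrix Bool Bool ℂ) (δ : ℝ) : List (WPGate g N) → QOp N
  | [] => 1
  | G :: C => wpCircuitOp U δ C * G.op U δ

/-- A weight `k` and a circuit on `n` witness qubits and `a` ancillas with initial values `anc`,
and with an output qubit. -/
structure WPInstance (g : ℕ) : Type where
  k : ℕ
  n : ℕ
  a : ℕ
  out : Fin (n + a)
  anc : Bits a
  circuit : List (WPGate g (n + a))

namespace WPInstance

variable {g : ℕ}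

/-- Legal instances: the unitary of the circuit is weight-preserving, there are at most `p n`
ancillas and at most `p n` gates, and at most `f k` ancillas start in `|1⟩`. -/
def Valid (U : Fin g → Matrix Bool Bool ℂ) (δ : ℝ) (p : Polynomial ℕ) (f : ℕ → ℕ)
    (I : WPInstance g) : Prop :=
  (∀ G ∈ I.circuit, G.WF) ∧ WeightPreserving (wpCircuitOp U δ I.circuit) ∧
  I.a ≤ p.eval I.n ∧ I.circuit.length ≤ p.eval I.n ∧ weight I.anc ≤ f I.k

/-- The probability that the output qubit is measured as `1` on the witness `ψ`. -/
def acceptProb (U : Fin g → Matrix Bool Bool ℂ) (δ : ℝ) (I : WPInstance g) (ψ : QVec I.n) : ℝ :=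
  probOne ((wpCircuitOp U δ I.circuit).mulVec (withAncillas ψ I.anc)) I.out

/-- The instance as a string. -/
def code (I : WPInstance g) : List Bool :=
  encodeNats ([I.k, I.n, I.a, I.out.val] ++ (List.ofFn I.anc).map Bool.toNat ++
    I.circuit.flatMap WPGate.code)

end WPInstance

/-- Weight-`k` Weight-Preserving Quantum Circuit Satisfiability with completeness `c` and
soundness `s`, where `p` bounds the numbers of ancillas and gates, and `f` bounds the number of
ancillas that start in `|1⟩`. -/
def WPQCSAT {g : ℕ} (U : Fin g → Matrix Bool Bool ℂ) (δ : ℝ) (p : Polynomial ℕ) (f : ℕ → ℕ)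
    (c s : ℕ → unitInterval) : ParamProblem where
  yes := {x | ∃ I : WPInstance g, I.code = x ∧ I.Valid U δ p f ∧
    ∃ ψ, IsState ψ ∧ HasWeight I.k ψ ∧ (c I.n : ℝ) ≤ I.acceptProb U δ ψ}
  no := {x | ∃ I : WPInstance g, I.code = x ∧ I.Valid U δ p f ∧
    ∀ ψ, IsState ψ → HasWeight I.k ψ → I.acceptProb U δ ψ ≤ (s I.n : ℝ)}
  param := firstNat

end WPQ

end

namespace WPQ

/-! ### Running times -/

/-! The given circuit has N ≤ k log₂ n qubits. Deal them out to k blocks, qubit q becoming bit q / k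
of block q % k. A block has at most ⌈N/k⌉ bits, hence at most 2^⌈N/k⌉ ≤ 2n values
(`MiniInstance.Valid.fits`), and is written in one-hot form on 2n qubits, exactly one of which is 1.
Basis states of N qubits become basis states of weight k on k · 2n qubits (`Fits.weight_oneHot`).

In this representation every gate has a weight-preserving substitute. Changing a bit of a block
moves its single 1 between two positions v and v + 2^j. A one-qubit gate V therefore becomes the
gates 1 ⊕ V ⊕ 1 on all such pairs; only one pair is not in state 00, and there the gate acts as V
(`Fits.rotateGates_mulVec`). "Bit q is 1" means that one of certain positions holds the 1, so
Fredkin gates controlled by all these positions perform a swap exactly in this case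
(`Fits.transferGates_mulVec`). A generalised Toffoli gate becomes a ladder: a token ancilla advances
one rung for each satisfied control, the last rung controls the flip of the target, and the token is
then led back (`Fits.ladderGates_mulVec`). Fanout is a sequence of CNOTs. Altogether the new circuit
intertwines with the old one through the encoding (`Fits.blockGates_circuit_embed`).

A witness of weight k need not be an encoding. A second token passes block b only if an odd number
of the positions allowed for b are 1, where "allowed" also forces the original ancillas to be 0. If
the token passes all k blocks, each contains a 1 in an allowed position; as the weight is k, there
are no others, and the witness is legal (`Fits.exists_eq_oneHot_pad`). Otherwise the token is stuck.
At the end it moves on to the output qubit if the original output bit is 1, so illegal basis states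
contribute nothing to acceptance. Hence the acceptance probability of a weight-k witness is that of
its legal part in the original circuit (`Fits.probOne_blockCircuit`). Completeness and soundness
follow; for soundness the legal part may have norm below 1 (`MiniInstance.acceptProb_le`). Since the
new witness length is at least n, monotonicity of c and s takes care of the thresholds.

It remains to compute the transformation of instances in polynomial time. A small calculus of
expressions (`Evaluable`) and statements (`Realizable`) produces stack programs together with time
bounds, `realizable_mainStm` applies it to the transformation, and `FPQTComputable.stmMap` appends
the resulting program to the classical post-processing of a given reduction. -/

theorem eval_le_eval (q : Polynomial ℕ) {a b : ℕ} (h : a ≤ b) : q.eval a ≤ q.eval b := by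
  induction q using Polynomial.induction_on' with
  | add p q hp hq => simp only [Polynomial.eval_add]; omega
  | monomial n c =>
    simp only [Polynomial.eval_monomial]
    exact Nat.mul_le_mul_left _ (Nat.pow_le_pow_left h n)

/-- The program `P` leads from `σ` to `τ` in at most `T` steps. -/
def RunsIn (P : Prog) (σ : Store) (T : ℕ) (τ : Store) : Prop := ∃ t, t ≤ T ∧ Run P σ t τ

theorem RunsIn.mono {P : Prog} {σ τ : Store} {T U : ℕ} (h : RunsIn P σ T τ) (hTU : T ≤ U) :
    RunsIn P σ U τ := by
  obtain ⟨t, ht, hr⟩ := h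
  exact ⟨t, ht.trans hTU, hr⟩

theorem RunsIn.congr {P : Prog} {σ τ τ' : Store} {T U : ℕ} (h : RunsIn P σ T τ) (hTU : T ≤ U)
    (hτ : τ = τ') : RunsIn P σ U τ' := hτ ▸ h.mono hTU

theorem RunsIn.seq {P Q : Prog} {σ τ ρ : Store} {T U : ℕ} (h : RunsIn P σ T τ)
    (h' : RunsIn Q τ U ρ) : RunsIn (Prog.seq P Q) σ (T + U) ρ := by
  obtain ⟨t, ht, hr⟩ := h
  obtain ⟨u, hu, hr'⟩ := h'
  exact ⟨t + u, by omega, Run.seq hr hr'⟩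

theorem RunsIn.branchNil {r : ℕ} {P Q S : Prog} {σ τ : Store} {T : ℕ} (hr : σ r = [])
    (h : RunsIn P σ T τ) : RunsIn (Prog.branch r P Q S) σ (T + 1) τ := by
  obtain ⟨t, ht, h⟩ := h
  exact ⟨t + 1, by omega, Run.branchNil hr h⟩

theorem RunsIn.branchFalse {r : ℕ} {P Q S : Prog} {σ τ : Store} {T : ℕ}
    (hr : (σ r).head? = some false) (h : RunsIn Q σ T τ) :
    RunsIn (Prog.branch r P Q S) σ (T + 1) τ := by
  obtain ⟨t, ht, h⟩ := h
  exact ⟨t + 1, by omega, Run.branchFalse hr h⟩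

theorem RunsIn.branchTrue {r : ℕ} {P Q S : Prog} {σ τ : Store} {T : ℕ}
    (hr : (σ r).head? = some true) (h : RunsIn S σ T τ) :
    RunsIn (Prog.branch r P Q S) σ (T + 1) τ := by
  obtain ⟨t, ht, h⟩ := h
  exact ⟨t + 1, by omega, Run.branchTrue hr h⟩

theorem RunsIn.skip (σ : Store) : RunsIn Prog.skip σ 1 σ := ⟨1, le_rfl, Run.skip σ⟩

theorem RunsIn.push (r : ℕ) (b : Bool) (σ : Store) :
    RunsIn (Prog.push r b) σ 1 (Function.update σ r (b :: σ r)) := ⟨1, le_rfl, Run.push r b σ⟩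

theorem RunsIn.pop (r : ℕ) (σ : Store) :
    RunsIn (Prog.pop r) σ 1 (Function.update σ r (σ r).tail) := ⟨1, le_rfl, Run.pop r σ⟩

/-- The loop invariant is a sequence of stores, one for each number of completed rounds. The extra
step per round, and the final one, are the tests of the loop register. -/
theorem RunsIn.loop {P : Prog} {r c : ℕ} (n : ℕ) (s : ℕ → Store) (hne : ∀ j < n, s j r ≠ [])
    (hnil : s n r = []) (h : ∀ j < n, RunsIn P (s j) c (s (j + 1))) :
    RunsIn (Prog.loop r P) (s 0) (n * (c + 1) + 1) (s n) := by
  induction n generalizing s with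
  | zero => exact ⟨1, by omega, Run.loopNil hnil⟩
  | succ n ih =>
    obtain ⟨t, ht, hr⟩ := h 0 (Nat.succ_pos n)
    obtain ⟨u, hu, hr'⟩ := ih (fun j => s (j + 1)) (fun j hj => hne (j + 1) (by omega)) hnil
      (fun j hj => h (j + 1) (by omega))
    refine ⟨t + u + 1, ?_, Run.loopCons (hne 0 (Nat.succ_pos n)) hr hr'⟩
    rw [Nat.succ_mul]
    omega

theorem RunsIn.loopNil {P : Prog} {r : ℕ} {σ : Store} (h : σ r = []) :
    RunsIn (Prog.loop r P) σ 1 σ := ⟨1, le_rfl, Run.loopNil h⟩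

theorem RunsIn.loopCons {P : Prog} {r T U : ℕ} {σ τ ρ : Store} (h : σ r ≠ [])
    (h1 : RunsIn P σ T τ) (h2 : RunsIn (Prog.loop r P) τ U ρ) :
    RunsIn (Prog.loop r P) σ (T + U + 1) ρ := by
  obtain ⟨t, ht, h1⟩ := h1
  obtain ⟨u, hu, h2⟩ := h2
  exact ⟨t + u + 1, by omega, Run.loopCons h h1 h2⟩

/-- Move the bits of register `a` to register `b`, in reverse order. -/
def moveBits (a b : ℕ) : Prog :=
  Prog.loop a (Prog.branch a Prog.skip
    (Prog.seq (Prog.pop a) (Prog.push b false)) (Prog.seq (Prog.pop a) (Prog.push b true)))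

/-- Four steps per bit: loop test, branch, pop and push. -/
theorem runsIn_moveBits {a b : ℕ} (hab : a ≠ b) (σ : Store) :
    RunsIn (moveBits a b) σ ((σ a).length * 4 + 1)
      (Function.update (Function.update σ a []) b ((σ a).reverse ++ σ b)) := by
  unfold moveBits
  generalize hl : σ a = l
  induction l generalizing σ with
  | nil =>
    refine (RunsIn.loopNil hl).congr (by simp) ?_
    funext r
    simp only [Function.update_apply]
    split_ifs <;> simp_all
  | cons c l ih =>
    have h := ih (Function.update (Function.update σ a l) b (c :: σ b))
      (by rw [Function.update_of_ne hab, Function.update_self])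
    have e : Function.update (Function.update σ a (σ a).tail) b
        (c :: Function.update σ a (σ a).tail b) =
        Function.update (Function.update σ a l) b (c :: σ b) := by
      rw [hl, Function.update_of_ne hab.symm, List.tail_cons]
    have h1 := fun c => (RunsIn.pop a σ).seq (RunsIn.push b c _)
    have hne : σ a ≠ [] := by simp [hl]
    have e' : Function.update (Function.update (Function.update (Function.update σ a l) b
        (c :: σ b)) a []) b (l.reverse ++ Function.update (Function.update σ a l) b (c :: σ b) b) =
        Function.update (Function.update σ a []) b ((c :: l).reverse ++ σ b) := by
      funext r
      simp only [Function.update_apply]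
      split_ifs <;> simp_all
    cases c with
    | false =>
      exact (RunsIn.loopCons hne (RunsIn.branchFalse (by simp [hl])
        ((h1 false).congr le_rfl e)) h).congr (by simp; omega) e'
    | true =>
      exact (RunsIn.loopCons hne (RunsIn.branchTrue (by simp [hl])
        ((h1 true).congr le_rfl e)) h).congr (by simp; omega) e'

/-! ### The layout of the registers -/

/-- A store whose registers from `R` on hold the input, the output, a buffer, and numbers in
unary. -/
def layout (R : ℕ) (σ : Store) (inp tmp out : List Bool) (x : ℕ → ℕ) : Store := fun r =>
  if r < R then σ r else if r = R then inp else if r = R + 1 then out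
  else if r = R + 2 then tmp else List.replicate (x (r - (R + 3))) true

section layout

variable (R : ℕ) (σ : Store) (inp tmp out : List Bool) (x : ℕ → ℕ)

@[simp] theorem layout_inp : layout R σ inp tmp out x R = inp := by simp [layout]

@[simp] theorem layout_out : layout R σ inp tmp out x (R + 1) = out := by simp [layout]

@[simp] theorem layout_tmp : layout R σ inp tmp out x (R + 2) = tmp := by simp [layout]

@[simp] theorem layout_var (i : ℕ) :
    layout R σ inp tmp out x (R + 3 + i) = List.replicate (x i) true := by
  have h1 : ¬ R + 3 + i < R := by omega
  have h2 : ¬ R + 3 + i = R := by omega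
  have h3 : ¬ R + 3 + i = R + 1 := by omega
  have h4 : ¬ R + 3 + i = R + 2 := by omega
  simp only [layout, h1, h2, h3, h4, if_false, Nat.add_sub_cancel_left]

-- Layouts are closed under the updates that programs make, so runs can be followed on the
-- parameters of `layout` instead of on stores.
@[simp] theorem update_layout_inp (l : List Bool) :
    Function.update (layout R σ inp tmp out x) R l = layout R σ l tmp out x := by
  funext r
  by_cases h : r = R
  · subst h; simp
  · simp [layout, h]

@[simp] theorem update_layout_out (l : List Bool) :
    Function.update (layout R σ inp tmp out x) (R + 1) l = layout R σ inp tmp l x := by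
  funext r
  by_cases h : r = R + 1
  · subst h; simp
  · simp [layout, h]

@[simp] theorem update_layout_tmp (l : List Bool) :
    Function.update (layout R σ inp tmp out x) (R + 2) l = layout R σ inp l out x := by
  funext r
  by_cases h : r = R + 2
  · subst h; simp
  · simp [layout, h]

theorem update_layout_var (i v : ℕ) :
    Function.update (layout R σ inp tmp out x) (R + 3 + i) (List.replicate v true) =
      layout R σ inp tmp out (Function.update x i v) := by
  funext r
  by_cases h : r = R + 3 + i
  · subst h; simp
  · rw [Function.update_of_ne h]
    simp only [layout]
    split_ifs
    · rfl
    · rfl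
    · rfl
    · rfl
    · rw [Function.update_of_ne (by omega)]

theorem runsIn_push_var (i : ℕ) :
    RunsIn (Prog.push (R + 3 + i) true) (layout R σ inp tmp out x) 1
      (layout R σ inp tmp out (Function.update x i (x i + 1))) := by
  have h := RunsIn.push (R + 3 + i) true (layout R σ inp tmp out x)
  rwa [layout_var, ← List.replicate_succ, update_layout_var] at h

theorem runsIn_pop_var (i : ℕ) :
    RunsIn (Prog.pop (R + 3 + i)) (layout R σ inp tmp out x) 1
      (layout R σ inp tmp out (Function.update x i (x i - 1))) := by
  have h := RunsIn.pop (R + 3 + i) (layout R σ inp tmp out x)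
  rwa [layout_var, List.tail_replicate, update_layout_var] at h

theorem runsIn_push_out (b : Bool) :
    RunsIn (Prog.push (R + 1) b) (layout R σ inp tmp out x) 1
      (layout R σ inp tmp (b :: out) x) := by
  simpa using RunsIn.push (R + 1) b (layout R σ inp tmp out x)

theorem runsIn_push_tmp (b : Bool) :
    RunsIn (Prog.push (R + 2) b) (layout R σ inp tmp out x) 1
      (layout R σ inp (b :: tmp) out x) := by
  simpa using RunsIn.push (R + 2) b (layout R σ inp tmp out x)

theorem runsIn_pop_inp :
    RunsIn (Prog.pop R) (layout R σ inp tmp out x) 1 (layout R σ inp.tail tmp out x) := by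
  simpa using RunsIn.pop R (layout R σ inp tmp out x)

theorem runsIn_pop_tmp :
    RunsIn (Prog.pop (R + 2)) (layout R σ inp tmp out x) 1
      (layout R σ inp tmp.tail out x) := by
  simpa using RunsIn.pop (R + 2) (layout R σ inp tmp out x)

theorem runsIn_clear (a : ℕ) :
    RunsIn (Prog.loop (R + 3 + a) (Prog.pop (R + 3 + a))) (layout R σ inp tmp out x)
      (x a * 2 + 1) (layout R σ inp tmp out (Function.update x a 0)) := by
  have h := RunsIn.loop (r := R + 3 + a) (P := Prog.pop (R + 3 + a)) (c := 1) (x a)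
    (fun j => layout R σ inp tmp out (Function.update x a (x a - j)))
    (by intro j hj; simp; omega) (by simp) (by
      intro j hj
      have := runsIn_pop_var R σ inp tmp out (Function.update x a (x a - j)) a
      simpa [Nat.sub_sub] using this)
  simpa using h

theorem runsIn_move {a b : ℕ} (hab : a ≠ b) :
    RunsIn (Prog.loop (R + 3 + a) (Prog.seq (Prog.pop (R + 3 + a)) (Prog.push (R + 3 + b) true)))
      (layout R σ inp tmp out x) (x a * 3 + 1)
      (layout R σ inp tmp out (Function.update (Function.update x a 0) b (x b + x a))) := by
  have h := RunsIn.loop (r := R + 3 + a)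
    (P := Prog.seq (Prog.pop (R + 3 + a)) (Prog.push (R + 3 + b) true)) (c := 2) (x a)
    (fun j => layout R σ inp tmp out
      (Function.update (Function.update x a (x a - j)) b (x b + j)))
    (by intro j hj; simp [Function.update_of_ne hab]; omega)
    (by simp [Function.update_of_ne hab]) (by
      intro j hj
      have h1 := runsIn_pop_var R σ inp tmp out
        (Function.update (Function.update x a (x a - j)) b (x b + j)) a
      refine (h1.seq (runsIn_push_var R σ inp tmp out _ b)).congr le_rfl ?_
      congr 1
      funext r
      simp only [Function.update_apply]
      split_ifs <;> simp_all <;> omega)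
  simpa using h

/-- Reading a stack destroys it. So register `i` is drained into both `D` and `D + 1`, and then
refilled from `D + 1`. -/
theorem exists_runsIn_copy (i D : ℕ) (hi : i < D) :
    ∃ P, ∀ (σ : Store) (inp tmp out : List Bool) (x : ℕ → ℕ), x D = 0 → x (D + 1) = 0 →
      RunsIn P (layout R σ inp tmp out x) (x i * 7 + 2)
        (layout R σ inp tmp out (Function.update x D (x i))) := by
  refine ⟨Prog.seq (Prog.loop (R + 3 + i) (Prog.seq (Prog.pop (R + 3 + i))
    (Prog.seq (Prog.push (R + 3 + D) true) (Prog.push (R + 3 + (D + 1)) true))))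
    (Prog.loop (R + 3 + (D + 1)) (Prog.seq (Prog.pop (R + 3 + (D + 1)))
      (Prog.push (R + 3 + i) true))), ?_⟩
  intro σ inp tmp out x hD hD1
  have n1 : i ≠ D := by omega
  have n2 : i ≠ D + 1 := by omega
  have n3 : D + 1 ≠ D := by omega
  have h := RunsIn.loop (r := R + 3 + i)
    (P := Prog.seq (Prog.pop (R + 3 + i))
      (Prog.seq (Prog.push (R + 3 + D) true) (Prog.push (R + 3 + (D + 1)) true))) (c := 3) (x i)
    (fun j => layout R σ inp tmp out (Function.update (Function.update
      (Function.update x i (x i - j)) D j) (D + 1) j))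
    (by intro j hj; simp [Function.update_of_ne n1, Function.update_of_ne n2]; omega)
    (by simp [Function.update_of_ne n1, Function.update_of_ne n2]) (by
      intro j hj
      have h1 := runsIn_pop_var R σ inp tmp out (Function.update (Function.update
        (Function.update x i (x i - j)) D j) (D + 1) j) i
      refine (h1.seq ((runsIn_push_var R σ inp tmp out _ D).seq
        (runsIn_push_var R σ inp tmp out _ (D + 1)))).congr le_rfl ?_
      congr 1
      funext r
      simp only [Function.update_apply]
      split_ifs <;> omega)
  have h' := runsIn_move R σ inp tmp out (Function.update (Function.update
      (Function.update x i 0) D (x i)) (D + 1) (x i)) n2.symm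
  have e0 : Function.update (Function.update (Function.update x i (x i)) D 0) (D + 1) 0 = x := by
    funext r
    simp only [Function.update_apply]
    split_ifs <;> simp_all
  simp only [Nat.sub_zero, e0, Nat.sub_self] at h
  refine (h.seq h').congr ?_ ?_
  · simp; omega
  congr 1
  funext r
  simp only [Function.update_apply]
  split_ifs <;> simp_all

end layout

/-! ### Registers that a program does not use -/

/-- A strict bound on the registers of a program. -/
def Prog.bound : Prog → ℕ
  | .skip => 0
  | .push r _ => r + 1
  | .pop r => r + 1
  | .seq P Q => max P.bound Q.bound
  | .branch r P Q S => max (r + 1) (max P.bound (max Q.bound S.bound))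
  | .loop r P => max (r + 1) P.bound

/-- This provides fresh work space when a program is appended to an arbitrary one: registers above
the bound are still as they were at the start. -/
theorem Run.eq_of_bound_le {P : Prog} {σ τ : Store} {t : ℕ} (h : Run P σ t τ) {r : ℕ}
    (hr : P.bound ≤ r) : τ r = σ r := by
  induction h with
  | skip σ => rfl
  | push q b σ => simp only [Prog.bound] at hr; rw [Function.update_of_ne (by omega)]
  | pop q σ => simp only [Prog.bound] at hr; rw [Function.update_of_ne (by omega)]
  | seq _ _ ih1 ih2 =>
    simp only [Prog.bound] at hr
    rw [ih2 (by omega), ih1 (by omega)]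
  | branchNil _ _ ih => simp only [Prog.bound] at hr; exact ih (by omega)
  | branchFalse _ _ ih => simp only [Prog.bound] at hr; exact ih (by omega)
  | branchTrue _ _ ih => simp only [Prog.bound] at hr; exact ih (by omega)
  | loopNil _ => rfl
  | loopCons _ _ _ ih1 ih2 =>
    have hr' := hr
    simp only [Prog.bound] at hr'
    rw [ih2 hr, ih1 (by omega)]

/-- A step pushes at most one symbol. This bounds the size of an intermediate result by the time
spent on it. -/
theorem Run.length_le {P : Prog} {σ τ : Store} {t : ℕ} (h : Run P σ t τ) (r : ℕ) :
    (τ r).length ≤ (σ r).length + t := by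
  induction h with
  | skip σ => omega
  | push q b σ =>
    rcases eq_or_ne r q with rfl | h
    · simp
    · simp [Function.update_of_ne h]
  | pop q σ =>
    rcases eq_or_ne r q with rfl | h
    · simp; omega
    · simp [Function.update_of_ne h]
  | seq _ _ ih1 ih2 => omega
  | branchNil _ _ ih => omega
  | branchFalse _ _ ih => omega
  | branchTrue _ _ ih => omega
  | loopNil _ => omega
  | loopCons _ _ _ ih1 ih2 => omega

end WPQ

namespace WPQ

/-! ### Expressions that can be evaluated in polynomial time -/

section Evaluable

variable {Γ : Type}

/-- The expression `e` is bounded by a polynomial in the values of the variables. -/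
def PolyBounded (vars : List (Γ → ℕ)) (e : Γ → ℕ) : Prop :=
  ∃ q : Polynomial ℕ, ∀ B γ, (∀ v ∈ vars, v γ ≤ B) → e γ ≤ q.eval B

/-- The expression `e` is polynomially bounded and, whenever the variables are held in registers
below `D`, can be evaluated into register `D` in polynomial time, with the registers from `D` on
as work space. -/
def Evaluable (vars : List (Γ → ℕ)) (e : Γ → ℕ) : Prop :=
  PolyBounded vars e ∧ ∀ (R D : ℕ) (l : List (ℕ × (Γ → ℕ))), l.map Prod.snd = vars →
    (∀ p ∈ l, p.1 < D) → ∃ (P : Prog) (q : Polynomial ℕ),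
      ∀ (B : ℕ) (γ : Γ) (σ : Store) (inp tmp out : List Bool) (x : ℕ → ℕ),
        (∀ v ∈ vars, v γ ≤ B) → (∀ p ∈ l, x p.1 = p.2 γ) → (∀ i, D ≤ i → x i = 0) →
        RunsIn P (layout R σ inp tmp out x) (q.eval B)
          (layout R σ inp tmp out (Function.update x D (e γ)))

/-- The variables in a context with one more variable. -/
def extend (vars : List (Γ → ℕ)) : List (Γ × ℕ → ℕ) :=
  Prod.snd :: vars.map fun v p => v p.1

theorem PolyBounded.add {vars : List (Γ → ℕ)} {e e' : Γ → ℕ} (h : PolyBounded vars e)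
    (h' : PolyBounded vars e') : PolyBounded vars fun γ => e γ + e' γ := by
  obtain ⟨q, hq⟩ := h
  obtain ⟨q', hq'⟩ := h'
  exact ⟨q + q', fun B γ hB => by
    rw [Polynomial.eval_add]; exact Nat.add_le_add (hq B γ hB) (hq' B γ hB)⟩

theorem PolyBounded.mul {vars : List (Γ → ℕ)} {e e' : Γ → ℕ} (h : PolyBounded vars e)
    (h' : PolyBounded vars e') : PolyBounded vars fun γ => e γ * e' γ := by
  obtain ⟨q, hq⟩ := h
  obtain ⟨q', hq'⟩ := h'
  exact ⟨q * q', fun B γ hB => by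
    rw [Polynomial.eval_mul]; exact Nat.mul_le_mul (hq B γ hB) (hq' B γ hB)⟩

theorem Evaluable.var {vars : List (Γ → ℕ)} {v : Γ → ℕ} (hv : v ∈ vars) : Evaluable vars v := by
  refine ⟨⟨Polynomial.X, fun B γ h => by simpa using h v hv⟩, ?_⟩
  intro R D l hl hD
  subst hl
  obtain ⟨p, hp, rfl⟩ := List.mem_map.1 hv
  obtain ⟨P, hP⟩ := exists_runsIn_copy R p.1 D (hD p hp)
  refine ⟨P, 7 * Polynomial.X + 2, fun B γ σ inp tmp out x hB hx h0 => ?_⟩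
  have h := hP σ inp tmp out x (h0 D le_rfl) (h0 (D + 1) (by omega))
  refine h.congr ?_ (by rw [hx p hp])
  have := hB _ hv
  rw [hx p hp]
  simp
  omega

theorem Evaluable.zero (vars : List (Γ → ℕ)) : Evaluable vars fun _ => 0 := by
  refine ⟨⟨0, fun B γ h => by simp⟩, fun R D l hl hD => ⟨Prog.skip, 1, ?_⟩⟩
  intro B γ σ inp tmp out x hB hx h0
  refine (RunsIn.skip _).congr (by simp) ?_
  rw [← h0 D le_rfl, Function.update_eq_self]

theorem Evaluable.succ {vars : List (Γ → ℕ)} {e : Γ → ℕ} (h : Evaluable vars e) :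
    Evaluable vars fun γ => e γ + 1 := by
  obtain ⟨⟨p, hp⟩, h⟩ := h
  refine ⟨⟨p + 1, fun B γ h => by simpa using hp B γ h⟩, fun R D l hl hD => ?_⟩
  obtain ⟨P, q, hP⟩ := h R D l hl hD
  refine ⟨Prog.seq P (Prog.push (R + 3 + D) true), q + 1, ?_⟩
  intro B γ σ inp tmp out x hB hx h0
  refine ((hP B γ σ inp tmp out x hB hx h0).seq (runsIn_push_var R σ inp tmp out _ D)).congr
    (by simp) (by simp)

theorem Evaluable.const (vars : List (Γ → ℕ)) (c : ℕ) : Evaluable vars fun _ => c := by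
  induction c with
  | zero => exact Evaluable.zero vars
  | succ c ih => exact ih.succ

/-- Primitive recursion. -/
def primRec (b : Γ → ℕ) (s : (Γ × ℕ) × ℕ → ℕ) (γ : Γ) : ℕ → ℕ
  | 0 => b γ
  | i + 1 => s ((γ, i), primRec b s γ i)

/-- The only control structure for expressions; all arithmetic below is derived from it. The bound
`m` on the intermediate values is essential, because primitive recursion by itself leaves polynomial
time. Registers: `D` holds the current value, `D + 1` the index, `D + 2` the number of rounds left,
and the step function is evaluated into `D + 3`. -/
theorem Evaluable.primRec {vars : List (Γ → ℕ)} {n b m : Γ → ℕ} {s : (Γ × ℕ) × ℕ → ℕ}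
    (hn : Evaluable vars n) (hb : Evaluable vars b) (hs : Evaluable (extend (extend vars)) s)
    (hm : PolyBounded vars m) (hle : ∀ γ i, i ≤ n γ → WPQ.primRec b s γ i ≤ m γ) :
    Evaluable vars fun γ => WPQ.primRec b s γ (n γ) := by
  obtain ⟨pm, hpm⟩ := hm
  refine ⟨⟨pm, fun B γ h => (hle γ _ le_rfl).trans (hpm B γ h)⟩, fun R D l hl hD => ?_⟩
  obtain ⟨⟨pn, hpn⟩, hn⟩ := hn
  obtain ⟨Pb, qb, hPb⟩ := hb.2 R D l hl hD
  obtain ⟨Pn, qn, hPn⟩ := hn R (D + 2) l hl (fun p hp => (hD p hp).trans (by omega))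
  obtain ⟨Ps, qs, hPs⟩ := hs.2 R (D + 3)
    ((D, Prod.snd) :: (D + 1, fun p => p.1.2) :: l.map fun p => (p.1, fun γ => p.2 γ.1.1))
    (by simp [extend, ← hl])
    (by
      simp only [List.mem_cons, List.mem_map]
      rintro p (rfl | rfl | ⟨p, hp, rfl⟩)
      · simp
      · simp
      · exact (hD p hp).trans (by omega))
  refine ⟨Prog.seq Pb (Prog.seq Pn (Prog.seq (Prog.loop (R + 3 + (D + 2))
    (Prog.seq (Prog.pop (R + 3 + (D + 2))) (Prog.seq Ps (Prog.seq
      (Prog.loop (R + 3 + D) (Prog.pop (R + 3 + D))) (Prog.seq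
      (Prog.loop (R + 3 + (D + 3)) (Prog.seq (Prog.pop (R + 3 + (D + 3)))
        (Prog.push (R + 3 + D) true))) (Prog.push (R + 3 + (D + 1)) true))))))
    (Prog.loop (R + 3 + (D + 1)) (Prog.pop (R + 3 + (D + 1)))))),
    qb + (qn + ((pn * ((1 + (qs.comp (Polynomial.X + pn + pm) + ((pm * 2 + 1) +
      ((pm * 3 + 1) + 1)))) + 1) + 1) + (pn * 2 + 1))), ?_⟩
  intro B γ σ inp tmp out x hB hx h0
  -- The work registers after `j` rounds.
  set y : ℕ → ℕ → ℕ := fun j => Function.update (Function.update (Function.update x D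
    (WPQ.primRec b s γ j)) (D + 1) j) (D + 2) (n γ - j) with hy
  have h1 := hPb B γ σ inp tmp out x hB hx h0
  have h2 := hPn B γ σ inp tmp out (Function.update x D (b γ)) hB
    (fun p hp => by rw [Function.update_of_ne (hD p hp).ne, hx p hp])
    (fun i hi => by rw [Function.update_of_ne (by omega), h0 i (by omega)])
  have e1 : Function.update (Function.update x D (b γ)) (D + 2) (n γ) = y 0 := by
    funext r
    simp only [hy, Function.update_apply, WPQ.primRec, Nat.sub_zero]
    have := h0 (D + 1) (by omega)
    split_ifs <;> subst_vars <;> omega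
  rw [e1] at h2
  have h3 := RunsIn.loop (r := R + 3 + (D + 2))
    (P := Prog.seq (Prog.pop (R + 3 + (D + 2))) (Prog.seq Ps (Prog.seq
      (Prog.loop (R + 3 + D) (Prog.pop (R + 3 + D))) (Prog.seq
      (Prog.loop (R + 3 + (D + 3)) (Prog.seq (Prog.pop (R + 3 + (D + 3)))
        (Prog.push (R + 3 + D) true))) (Prog.push (R + 3 + (D + 1)) true)))))
    (c := 1 + (qs.eval (B + pn.eval B + pm.eval B) + ((pm.eval B * 2 + 1) +
      ((pm.eval B * 3 + 1) + 1)))) (n γ) (fun j => layout R σ inp tmp out (y j))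
    (by intro j hj; simp [hy]; omega) (by simp [hy]) (by
      intro j hj
      have g1 := runsIn_pop_var R σ inp tmp out (y j) (D + 2)
      -- The step function sees two further variables, the index and the current value; this sum
      -- bounds them along with the old variables.
      have g2 := hPs (B + pn.eval B + pm.eval B) ((γ, j), WPQ.primRec b s γ j) σ inp tmp out
        (Function.update (y j) (D + 2) (y j (D + 2) - 1))
        (by
          have b1 := hpn B γ hB
          have b2 := hpm B γ hB
          have b3 := hle γ j hj.le
          simp only [extend, List.mem_cons, List.mem_map, List.map_cons, List.map_map]
          rintro v (rfl | rfl | ⟨v, hv, rfl⟩)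
          · simp; omega
          · simp; omega
          · have := hB v hv
            simp
            omega)
        (by
          simp only [List.mem_cons, List.mem_map]
          rintro p (rfl | rfl | ⟨p, hp, rfl⟩)
          · simp [hy]
          · simp [hy]
          · have := hD p hp
            simp only [hy, Function.update_apply]
            rw [if_neg (by omega), if_neg (by omega), if_neg (by omega), if_neg (by omega),
              hx p hp])
        (fun i hi => by
          simp only [hy, Function.update_apply]
          rw [if_neg (by omega), if_neg (by omega), if_neg (by omega), if_neg (by omega),
            h0 i (by omega)])
      refine (g1.seq (g2.seq ((runsIn_clear R σ inp tmp out _ D).seq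
        ((runsIn_move R σ inp tmp out _ (by omega : D + 3 ≠ D)).seq
          (runsIn_push_var R σ inp tmp out _ (D + 1)))))).congr ?_ ?_
      · have b2 := (hle γ j hj.le).trans (hpm B γ hB)
        have b3 := (hle γ (j + 1) hj).trans (hpm B γ hB)
        simp only [WPQ.primRec] at b3
        simp only [hy, Function.update_apply]
        simp
        omega
      · congr 1
        funext r
        have := h0 (D + 3) (by omega)
        simp only [hy, Function.update_apply, WPQ.primRec]
        simp only [Nat.add_eq_left, OfNat.ofNat_ne_zero, if_false, if_true, one_ne_zero,
          Nat.add_right_inj, Nat.reduceEqDiff, Nat.left_eq_add]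
        split_ifs <;> subst_vars <;> omega)
  have h4 := runsIn_clear R σ inp tmp out (y (n γ)) (D + 1)
  refine (h1.seq (h2.seq (h3.seq h4))).congr ?_ ?_
  · simp only [Polynomial.eval_add, Polynomial.eval_mul, Polynomial.eval_comp, Polynomial.eval_X,
      Polynomial.eval_one, Polynomial.eval_ofNat]
    have b1 := hpn B γ hB
    have : y (n γ) (D + 1) = n γ := by simp [hy]
    rw [this]
    gcongr
  · congr 1
    funext r
    have := h0 (D + 2) (by omega)
    have := h0 (D + 1) (by omega)
    simp only [hy, Function.update_apply]
    split_ifs <;> subst_vars <;> omega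

end Evaluable

end WPQ

namespace WPQ

/-! ### Arithmetic -/

section Arithmetic

variable {Γ : Type} {vars : List (Γ → ℕ)} {a b c : Γ → ℕ}

theorem Evaluable.congr {e e' : Γ → ℕ} (h : Evaluable vars e) (he : ∀ γ, e γ = e' γ) :
    Evaluable vars e' := (funext he : e = e') ▸ h

/-- A register assignment for the lifted variables is turned back into one for the original
variables. This is what weakening needs, since `Evaluable` quantifies over assignments. -/
theorem exists_context_of_map_snd {α β : Type} (f : α → β) (as : List α) (l : List (ℕ × β))
    (hl : l.map Prod.snd = as.map f) :
    ∃ l' : List (ℕ × α), l'.map Prod.snd = as ∧ ∀ p ∈ l', (p.1, f p.2) ∈ l := by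
  induction as generalizing l with
  | nil => exact ⟨[], rfl, by simp⟩
  | cons a as ih =>
    cases l with
    | nil => simp at hl
    | cons p l =>
      simp only [List.map_cons, List.cons.injEq] at hl
      obtain ⟨l', h1, h2⟩ := ih l hl.2
      refine ⟨(p.1, a) :: l', by simp [h1], ?_⟩
      simp only [List.mem_cons]
      rintro q (rfl | hq)
      · left
        rw [← hl.1]
      · exact Or.inr (h2 q hq)

theorem exists_context_of_extend {l : List (ℕ × (Γ × ℕ → ℕ))}
    (hl : l.map Prod.snd = extend vars) : ∃ l' : List (ℕ × (Γ → ℕ)), l'.map Prod.snd = vars ∧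
      ∀ p ∈ l', (p.1, fun q : Γ × ℕ => p.2 q.1) ∈ l := by
  cases l with
  | nil => simp [extend] at hl
  | cons p l =>
    simp only [extend, List.map_cons, List.cons.injEq] at hl
    obtain ⟨l', h1, h2⟩ := exists_context_of_map_snd _ vars l hl.2
    exact ⟨l', h1, fun p hp => List.mem_cons_of_mem _ (h2 p hp)⟩

/-- Weakening: the program stays the same, and the register of the new variable is ignored. -/
theorem Evaluable.lift {e : Γ → ℕ} (h : Evaluable vars e) :
    Evaluable (extend vars) fun p => e p.1 := by
  obtain ⟨⟨q, hq⟩, h⟩ := h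
  have key : ∀ {B : ℕ} {p : Γ × ℕ}, (∀ v ∈ extend vars, v p ≤ B) → ∀ v ∈ vars, v p.1 ≤ B :=
    fun hB v hv => hB _ (List.mem_cons_of_mem _ (List.mem_map_of_mem hv))
  refine ⟨⟨q, fun B p hB => hq B p.1 (key hB)⟩, fun R D l hl hD => ?_⟩
  obtain ⟨l', hl', hmem⟩ := exists_context_of_extend hl
  obtain ⟨P, q, hP⟩ := h R D l' hl' fun p hp => hD _ (hmem p hp)
  exact ⟨P, q, fun B p σ inp tmp out x hB hx h0 =>
    hP B p.1 σ inp tmp out x (key hB) (fun r hr => hx _ (hmem r hr)) h0⟩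

theorem Evaluable.snd : Evaluable (extend vars) Prod.snd :=
  Evaluable.var (List.mem_cons_self ..)

/-- Recursion whose step forgets the previous value and returns the index. -/
theorem Evaluable.pred (ha : Evaluable vars a) : Evaluable vars fun γ => a γ - 1 := by
  have e : ∀ (γ : Γ) i, WPQ.primRec (fun _ => 0) (fun p => p.1.2) γ i = i - 1 := by
    intro γ i
    cases i <;> rfl
  refine (Evaluable.primRec ha (Evaluable.zero vars) Evaluable.snd.lift ha.1 ?_).congr
    fun γ => e γ (a γ)
  intro γ i hi
  rw [e]
  omega

theorem Evaluable.add (ha : Evaluable vars a) (hb : Evaluable vars b) :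
    Evaluable vars fun γ => a γ + b γ := by
  have e : ∀ γ i, WPQ.primRec a (fun p => p.2 + 1) γ i = a γ + i := by
    intro γ i
    induction i with
    | zero => rfl
    | succ i ih => simp only [WPQ.primRec, ih]; omega
  refine (Evaluable.primRec hb ha Evaluable.snd.succ (ha.1.add hb.1) ?_).congr
    fun γ => e γ (b γ)
  intro γ i hi
  rw [e]
  omega

theorem Evaluable.sub (ha : Evaluable vars a) (hb : Evaluable vars b) :
    Evaluable vars fun γ => a γ - b γ := by
  have e : ∀ γ i, WPQ.primRec a (fun p => p.2 - 1) γ i = a γ - i := by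
    intro γ i
    induction i with
    | zero => rfl
    | succ i ih => simp only [WPQ.primRec, ih]; omega
  refine (Evaluable.primRec hb ha Evaluable.snd.pred ha.1 ?_).congr fun γ => e γ (b γ)
  intro γ i hi
  rw [e]
  omega

theorem Evaluable.mul (ha : Evaluable vars a) (hb : Evaluable vars b) :
    Evaluable vars fun γ => a γ * b γ := by
  have e : ∀ γ i, WPQ.primRec (fun _ => 0) (fun p => p.2 + a p.1.1) γ i = a γ * i := by
    intro γ i
    induction i with
    | zero => rfl
    | succ i ih => simp only [WPQ.primRec, ih, Nat.mul_succ]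
  refine (Evaluable.primRec hb (Evaluable.zero vars) (Evaluable.snd.add ha.lift.lift)
    (ha.1.mul hb.1) ?_).congr fun γ => e γ (b γ)
  intro γ i hi
  rw [e]
  exact Nat.mul_le_mul_left _ hi

/-- Recursion of length `c` from `a` with the constant step `b`: one round is enough to replace `a`
by `b`. -/
theorem Evaluable.ite (hc : Evaluable vars c) (ha : Evaluable vars a) (hb : Evaluable vars b) :
    Evaluable vars fun γ => if c γ = 0 then a γ else b γ := by
  have e : ∀ γ i, WPQ.primRec a (fun p => b p.1.1) γ i = if i = 0 then a γ else b γ := by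
    intro γ i
    cases i <;> simp [WPQ.primRec]
  refine (Evaluable.primRec hc ha hb.lift.lift (ha.1.add hb.1) ?_).congr fun γ => e γ (c γ)
  intro γ i hi
  rw [e]
  split_ifs <;> omega

theorem Evaluable.min (ha : Evaluable vars a) (hb : Evaluable vars b) :
    Evaluable vars fun γ => Min.min (a γ) (b γ) :=
  (ha.sub (ha.sub hb)).congr fun γ => by omega

/-- Count up to `a` and reset to 0 on reaching `b`. Equality of two numbers is tested by adding the
two truncated differences. For `b = 0` the reset never happens, in agreement with `i % 0 = i`. -/
theorem Evaluable.mod (ha : Evaluable vars a) (hb : Evaluable vars b) :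
    Evaluable vars fun γ => a γ % b γ := by
  have e : ∀ γ i, WPQ.primRec (fun _ => 0) (fun p => if (b p.1.1 - (p.2 + 1)) +
      ((p.2 + 1) - b p.1.1) = 0 then 0 else p.2 + 1) γ i = i % b γ := by
    intro γ i
    induction i with
    | zero => simp [WPQ.primRec]
    | succ i ih =>
      simp only [WPQ.primRec, ih]
      rcases Nat.eq_zero_or_pos (b γ) with h | h
      · simp [h]
      · have h1 := Nat.mod_lt i h
        rw [Nat.add_mod i 1 (b γ)]
        split_ifs with h2
        · have h3 : i % b γ + 1 = b γ := by omega
          rcases Nat.lt_or_ge 1 (b γ) with h4 | h4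
          · rw [Nat.mod_eq_of_lt h4, h3, Nat.mod_self]
          · have : b γ = 1 := by omega
            simp [this, Nat.mod_one]
        · have h4 : i % b γ + 1 < b γ := by omega
          rw [Nat.mod_eq_of_lt (by omega : 1 < b γ), Nat.mod_eq_of_lt h4]
  have hs : Evaluable (extend (extend vars)) fun p => if (b p.1.1 - (p.2 + 1)) +
      ((p.2 + 1) - b p.1.1) = 0 then 0 else p.2 + 1 :=
    Evaluable.ite ((hb.lift.lift.sub Evaluable.snd.succ).add (Evaluable.snd.succ.sub hb.lift.lift))
      (Evaluable.zero _) Evaluable.snd.succ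
  refine (Evaluable.primRec ha (Evaluable.zero vars) hs ha.1 ?_).congr fun γ => e γ (a γ)
  intro γ i hi
  rw [e]
  exact (Nat.mod_le _ _).trans hi

/-- The quotient increases exactly when the counter reaches a multiple of `b`. -/
theorem Evaluable.div (ha : Evaluable vars a) (hb : Evaluable vars b) :
    Evaluable vars fun γ => a γ / b γ := by
  have e : ∀ γ i, WPQ.primRec (fun _ => 0)
      (fun p => if (p.1.2 + 1) % b p.1.1 = 0 then p.2 + 1 else p.2) γ i = i / b γ := by
    intro γ i
    induction i with
    | zero => simp [WPQ.primRec]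
    | succ i ih =>
      simp only [WPQ.primRec, ih]
      rw [Nat.succ_div]
      simp only [Nat.dvd_iff_mod_eq_zero]
      split_ifs <;> rfl
  have hs : Evaluable (extend (extend vars)) fun p =>
      if (p.1.2 + 1) % b p.1.1 = 0 then p.2 + 1 else p.2 :=
    Evaluable.ite (Evaluable.mod Evaluable.snd.lift.succ hb.lift.lift) Evaluable.snd.succ
      Evaluable.snd
  refine (Evaluable.primRec ha (Evaluable.zero vars) hs ha.1 ?_).congr fun γ => e γ (a γ)
  intro γ i hi
  rw [e]
  exact (Nat.div_le_self _ _).trans hi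

/-- A power of two is not polynomially bounded in its exponent, but doubling with truncation at `b`
after every step is harmless. `placeValue` and `numValues` are truncated for this reason. -/
theorem Evaluable.minTwoPow (ha : Evaluable vars a) (hb : Evaluable vars b) :
    Evaluable vars fun γ => Min.min (2 ^ a γ) (b γ) := by
  have e : ∀ γ i, WPQ.primRec (fun γ => Min.min 1 (b γ))
      (fun p => Min.min (p.2 + p.2) (b p.1.1)) γ i = Min.min (2 ^ i) (b γ) := by
    intro γ i
    induction i with
    | zero => simp [WPQ.primRec]
    | succ i ih =>
      simp only [WPQ.primRec, ih, pow_succ]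
      omega
  refine (Evaluable.primRec ha ((Evaluable.const vars 1).min hb)
    ((Evaluable.snd.add Evaluable.snd).min hb.lift.lift) hb.1 ?_).congr fun γ => e γ (a γ)
  intro γ i hi
  rw [e]
  exact min_le_right _ _

end Arithmetic

end WPQ

namespace WPQ

/-! ### Reading numbers -/

/-- The string without its first number. -/
def dropNat (l : List Bool) : List Bool := (l.dropWhile id).tail

/-- The number at position `i` of a string. -/
def natAt (i : ℕ) (l : List Bool) : ℕ := firstNat (dropNat^[i] l)

theorem firstNat_le_length (l : List Bool) : firstNat l ≤ l.length :=
  List.IsPrefix.length_le (List.takeWhile_prefix id)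

theorem length_dropNat_le (l : List Bool) : (dropNat l).length ≤ l.length := by
  have := List.IsSuffix.length_le (List.dropWhile_suffix (l := l) id)
  simp only [dropNat, List.length_tail]
  omega

theorem length_dropNat_lt {l : List Bool} (h : l ≠ []) : (dropNat l).length < l.length := by
  have := List.IsSuffix.length_le (List.dropWhile_suffix (l := l) id)
  have := List.length_pos_iff.2 h
  simp only [dropNat, List.length_tail]
  omega

theorem iterate_dropNat_suffix (i : ℕ) (l : List Bool) : dropNat^[i] l <:+ l := by
  induction i with
  | zero => exact List.suffix_refl _
  | succ i ih =>
    rw [Function.iterate_succ_apply']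
    exact ((List.tail_suffix _).trans (List.dropWhile_suffix _)).trans ih

theorem length_iterate_dropNat_le (i : ℕ) (l : List Bool) :
    (dropNat^[i] l).length ≤ l.length := (iterate_dropNat_suffix i l).length_le

theorem natAt_le_length (i : ℕ) (l : List Bool) : natAt i l ≤ l.length :=
  (firstNat_le_length _).trans (length_iterate_dropNat_le i l)

theorem encodeNats_cons (a : ℕ) (l : List ℕ) :
    encodeNats (a :: l) = List.replicate a true ++ false :: encodeNats l := by
  simp [encodeNats]

theorem encodeNats_append (l l' : List ℕ) :
    encodeNats (l ++ l') = encodeNats l ++ encodeNats l' := by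
  simp [encodeNats]

@[simp] theorem firstNat_encodeNats_cons (a : ℕ) (l : List ℕ) :
    firstNat (encodeNats (a :: l)) = a := by
  rw [encodeNats_cons, firstNat]
  induction a with
  | zero => simp
  | succ a ih => simp [List.replicate_succ]

@[simp] theorem dropNat_encodeNats_cons (a : ℕ) (l : List ℕ) :
    dropNat (encodeNats (a :: l)) = encodeNats l := by
  rw [encodeNats_cons, dropNat]
  induction a with
  | zero => simp
  | succ a ih => simp [List.replicate_succ]

@[simp] theorem natAt_zero_encodeNats_cons (a : ℕ) (l : List ℕ) :
    natAt 0 (encodeNats (a :: l)) = a := firstNat_encodeNats_cons a l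

@[simp] theorem natAt_succ_encodeNats_cons (i a : ℕ) (l : List ℕ) :
    natAt (i + 1) (encodeNats (a :: l)) = natAt i (encodeNats l) := by
  rw [natAt, Function.iterate_succ_apply, dropNat_encodeNats_cons, natAt]

theorem natAt_encodeNats (i : ℕ) (l l' : List ℕ) (hi : i < l.length) :
    natAt i (encodeNats (l ++ l')) = l[i] := by
  induction l generalizing i with
  | nil => simp at hi
  | cons a l ih =>
    cases i with
    | zero => simp
    | succ i => simpa using ih i (by simpa using hi)

theorem iterate_dropNat_encodeNats (l l' : List ℕ) :
    dropNat^[l.length] (encodeNats (l ++ l')) = encodeNats l' := by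
  induction l with
  | nil => rfl
  | cons a l ih => simpa using ih

/-- Numbers written to a stack. -/
def revCode (l : List ℕ) : List Bool := (encodeNats l).reverse

@[simp] theorem revCode_nil : revCode [] = [] := rfl

theorem revCode_append (l l' : List ℕ) : revCode (l ++ l') = revCode l' ++ revCode l := by
  simp [revCode, encodeNats_append]

theorem revCode_singleton (a : ℕ) : revCode [a] = false :: List.replicate a true := by
  simp [revCode, encodeNats]

/-- A prefix is determined by the length of the remainder. This identifies the buffer, of which
`runsIn_scan` only says what it adds up to together with the remaining input. -/
theorem eq_take_of_append_eq {α : Type*} {l₁ l₂ l : List α} (h : l₁ ++ l₂ = l) :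
    l₁ = l.take (l.length - l₂.length) := by
  subst h
  simp

/-- Move the first number of the input to the buffer and count it in register `D`; register
`D + 1` is a flag. -/
def scanProg (R D : ℕ) : Prog :=
  Prog.seq (Prog.push (R + 3 + (D + 1)) true) (Prog.loop (R + 3 + (D + 1)) (Prog.branch R
    (Prog.pop (R + 3 + (D + 1)))
    (Prog.seq (Prog.pop R) (Prog.seq (Prog.push (R + 2) false) (Prog.pop (R + 3 + (D + 1)))))
    (Prog.seq (Prog.pop R) (Prog.seq (Prog.push (R + 2) true) (Prog.push (R + 3 + D) true)))))

/-- The reversed buffer followed by the remaining input is invariant, so nothing read is lost. A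
loop can only test for emptiness; hence the flag in `D + 1`, which is cleared at the first zero or
at the end of the input. -/
theorem runsIn_scan (R D : ℕ) (σ : Store) (inp tmp out : List Bool) (x : ℕ → ℕ)
    (h0 : x (D + 1) = 0) : ∃ tmp', tmp'.reverse ++ dropNat inp = tmp.reverse ++ inp ∧
      RunsIn (scanProg R D) (layout R σ inp tmp out x) (inp.length * 5 + 6)
        (layout R σ (dropNat inp) tmp' out (Function.update x D (x D + firstNat inp))) := by
  have key : ∀ (inp tmp : List Bool) (x : ℕ → ℕ), x (D + 1) = 1 →
      ∃ tmp', tmp'.reverse ++ dropNat inp = tmp.reverse ++ inp ∧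
      RunsIn (Prog.loop (R + 3 + (D + 1)) (Prog.branch R
    (Prog.pop (R + 3 + (D + 1)))
    (Prog.seq (Prog.pop R) (Prog.seq (Prog.push (R + 2) false) (Prog.pop (R + 3 + (D + 1)))))
    (Prog.seq (Prog.pop R) (Prog.seq (Prog.push (R + 2) true) (Prog.push (R + 3 + D) true)))))
        (layout R σ inp tmp out x) (inp.length * 5 + 5)
        (layout R σ (dropNat inp) tmp' out (Function.update (Function.update x D
          (x D + firstNat inp)) (D + 1) 0)) := by
    intro inp
    induction inp with
    | nil =>
      intro tmp x h1
      refine ⟨tmp, by simp [dropNat], ?_⟩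
      refine (RunsIn.loopCons (by simp [h1]) (RunsIn.branchNil (by simp)
        (runsIn_pop_var R σ [] tmp out x (D + 1)))
        (RunsIn.loopNil (by simp [h1]))).congr (by simp) ?_
      simp [h1, firstNat, dropNat]
    | cons b inp ih =>
      intro tmp x h1
      cases b with
      | false =>
        refine ⟨false :: tmp, by simp [dropNat], ?_⟩
        refine (RunsIn.loopCons (by simp [h1]) (RunsIn.branchFalse (by simp)
          ((runsIn_pop_inp ..).seq ((runsIn_push_tmp ..).seq (runsIn_pop_var R σ _ _ out x (D + 1)))))
          (RunsIn.loopNil (by simp [h1]))).congr (by simp; omega) ?_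
        simp [h1, firstNat, dropNat]
      | true =>
        obtain ⟨tmp', e1, hr⟩ := ih (true :: tmp) (Function.update x D (x D + 1)) (by
          rw [Function.update_of_ne (by omega), h1])
        refine ⟨tmp', ?_, ?_⟩
        · simpa [dropNat] using e1
        · refine (RunsIn.loopCons (by simp [h1]) (RunsIn.branchTrue (by simp)
            ((runsIn_pop_inp ..).seq ((runsIn_push_tmp ..).seq
              (runsIn_push_var R σ _ _ out x D)))) hr).congr (by simp; omega) ?_
          have e2 : firstNat (true :: inp) = firstNat inp + 1 := by simp [firstNat]
          have e3 : dropNat (true :: inp) = dropNat inp := by simp [dropNat]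
          rw [e2, e3]
          congr 1
          funext r
          simp only [Function.update_apply]
          split_ifs <;> omega
  obtain ⟨tmp', e1, hr⟩ := key inp tmp (Function.update x (D + 1) (x (D + 1) + 1)) (by simp [h0])
  refine ⟨tmp', e1, ((runsIn_push_var R σ inp tmp out x (D + 1)).seq hr).congr (by omega) ?_⟩
  congr 1
  funext r
  simp only [Function.update_apply]
  split_ifs <;> subst_vars <;> omega

theorem runsIn_restore (R : ℕ) (σ : Store) (inp tmp out : List Bool) (x : ℕ → ℕ) :
    RunsIn (moveBits (R + 2) R) (layout R σ inp tmp out x) (tmp.length * 4 + 1)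
      (layout R σ (tmp.reverse ++ inp) [] out x) :=
  (runsIn_moveBits (by omega : R + 2 ≠ R) _).congr (by simp) (by simp)

theorem runsIn_clear_tmp (R : ℕ) (σ : Store) (inp tmp out : List Bool) (x : ℕ → ℕ) :
    RunsIn (Prog.loop (R + 2) (Prog.pop (R + 2))) (layout R σ inp tmp out x)
      (tmp.length * 2 + 1) (layout R σ inp [] out x) := by
  induction tmp with
  | nil => exact RunsIn.loopNil (by simp)
  | cons b tmp ih =>
    exact (RunsIn.loopCons (by simp) (runsIn_pop_tmp ..) ih).congr (by simp; omega) rfl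

/-- A scan after which both the count and the buffer are discarded. -/
theorem exists_runsIn_dropNat (R D : ℕ) : ∃ P, ∀ (σ : Store) (inp out : List Bool) (x : ℕ → ℕ),
    x D = 0 → x (D + 1) = 0 → RunsIn P (layout R σ inp [] out x) (inp.length * 9 + 8)
      (layout R σ (dropNat inp) [] out x) := by
  refine ⟨Prog.seq (scanProg R D) (Prog.seq (Prog.loop (R + 3 + D) (Prog.pop (R + 3 + D)))
    (Prog.loop (R + 2) (Prog.pop (R + 2)))), fun σ inp out x h0 h1 => ?_⟩
  obtain ⟨tmp', e, hr⟩ := runsIn_scan R D σ inp [] out x h1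
  have hl := congrArg List.length e
  have := firstNat_le_length inp
  simp only [List.length_append, List.length_reverse, List.length_nil] at hl
  refine (hr.seq ((runsIn_clear ..).seq (runsIn_clear_tmp ..))).congr ?_ ?_
  · simp [h0]
    omega
  · congr 1
    rw [Function.update_idem, ← h0, Function.update_eq_self]

/-- Random access on a stack: scan past as many numbers as register `D + 2` says, count the next
one, and pour the buffer back. The index is used up in the process. -/
theorem exists_runsIn_natAt (R D : ℕ) : ∃ P, ∀ (σ : Store) (inp out : List Bool) (x : ℕ → ℕ),
    x D = 0 → x (D + 1) = 0 →
      RunsIn P (layout R σ inp [] out x) ((x (D + 2) + 1) * (inp.length * 20 + 20))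
        (layout R σ inp [] out (Function.update (Function.update x (D + 2) 0) D
          (natAt (x (D + 2)) inp))) := by
  refine ⟨Prog.seq (Prog.loop (R + 3 + (D + 2)) (Prog.seq (Prog.pop (R + 3 + (D + 2)))
    (Prog.seq (scanProg R D) (Prog.loop (R + 3 + D) (Prog.pop (R + 3 + D))))))
    (Prog.seq (scanProg R D) (moveBits (R + 2) R)), fun σ inp out x h0 h1 => ?_⟩
  have hL := RunsIn.loop (r := R + 3 + (D + 2))
    (P := Prog.seq (Prog.pop (R + 3 + (D + 2)))
      (Prog.seq (scanProg R D) (Prog.loop (R + 3 + D) (Prog.pop (R + 3 + D)))))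
    (c := 1 + (inp.length * 5 + 6 + (inp.length * 2 + 1))) (x (D + 2))
    -- After `j` rounds the buffer is the part of the input in front of its number `j`, reversed.
    (fun j => layout R σ (dropNat^[j] inp)
      ((inp.take (inp.length - (dropNat^[j] inp).length)).reverse) out
      (Function.update x (D + 2) (x (D + 2) - j)))
    (by intro j hj; simp; omega) (by simp) (by
      intro j hj
      have hs : ∀ i, inp.take (inp.length - (dropNat^[i] inp).length) ++ dropNat^[i] inp = inp := by
        intro i
        obtain ⟨t, ht⟩ := iterate_dropNat_suffix i inp
        rwa [← eq_take_of_append_eq ht]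
      obtain ⟨tmp', e, hr⟩ := runsIn_scan R D σ (dropNat^[j] inp)
        ((inp.take (inp.length - (dropNat^[j] inp).length)).reverse) out
        (Function.update (Function.update x (D + 2) (x (D + 2) - j)) (D + 2)
          (x (D + 2) - j - 1)) (by simpa using h1)
      rw [List.reverse_reverse, hs, ← Function.iterate_succ_apply' dropNat] at e
      have e' := eq_take_of_append_eq e
      have hp := runsIn_pop_var R σ (dropNat^[j] inp)
        ((inp.take (inp.length - (dropNat^[j] inp).length)).reverse) out
        (Function.update x (D + 2) (x (D + 2) - j)) (D + 2)
      rw [Function.update_self] at hp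
      refine (hp.seq (hr.seq (runsIn_clear ..))).congr ?_ ?_
      · have := length_iterate_dropNat_le j inp
        have := firstNat_le_length (dropNat^[j] inp)
        simp [h0]
        omega
      · rw [← e', List.reverse_reverse, Function.iterate_succ_apply']
        congr 1
        funext r
        simp only [Function.update_apply]
        split_ifs <;> subst_vars <;> omega)
  simp only [Function.iterate_zero, id, Nat.sub_zero, Function.update_eq_self, Nat.sub_self,
    List.take_zero, List.reverse_nil] at hL
  obtain ⟨tmp', e, hr⟩ := runsIn_scan R D σ (dropNat^[x (D + 2)] inp)
    ((inp.take (inp.length - (dropNat^[x (D + 2)] inp).length)).reverse) out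
    (Function.update x (D + 2) 0) (by simpa using h1)
  have hs : (inp.take (inp.length - (dropNat^[x (D + 2)] inp).length)).reverse.reverse ++
      dropNat^[x (D + 2)] inp = inp := by
    rw [List.reverse_reverse]
    obtain ⟨t, ht⟩ := iterate_dropNat_suffix (x (D + 2)) inp
    rwa [← eq_take_of_append_eq ht]
  rw [hs] at e
  have hl := congrArg List.length e
  simp only [List.length_append, List.length_reverse] at hl
  refine (hL.seq (hr.seq (runsIn_restore ..))).congr ?_ ?_
  · have := length_iterate_dropNat_le (x (D + 2)) inp
    have : x (D + 2) * (1 + (inp.length * 5 + 6 + (inp.length * 2 + 1)) + 1) ≤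
        x (D + 2) * (inp.length * 20 + 20) := Nat.mul_le_mul_left _ (by omega)
    rw [Nat.succ_mul]
    omega
  · rw [e]
    congr 1
    simp [h0, natAt]

end WPQ

namespace WPQ

/-! ### Statements that can be executed in polynomial time -/

/-- A statement: from the values of the variables and the input, the remaining input and the
numbers that are written. -/
abbrev Stm (Γ : Type) : Type := Γ → List Bool → List Bool × List ℕ

section Realizable

variable {Γ : Type} {vars : List (Γ → ℕ)}

/-- The statement `S` never lengthens the input and, whenever the variables are held in registers
below `D`, it can be executed in polynomial time, with the registers from `D` on as work space. -/
def Realizable (vars : List (Γ → ℕ)) (S : Stm Γ) : Prop :=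
  (∀ γ inp, (S γ inp).1.length ≤ inp.length) ∧
  ∀ (R D : ℕ) (l : List (ℕ × (Γ → ℕ))), l.map Prod.snd = vars →
    (∀ p ∈ l, p.1 < D) → ∃ (P : Prog) (q : Polynomial ℕ),
      ∀ (B : ℕ) (γ : Γ) (σ : Store) (inp out : List Bool) (x : ℕ → ℕ),
        (∀ v ∈ vars, v γ ≤ B) → inp.length ≤ B → (∀ p ∈ l, x p.1 = p.2 γ) →
        (∀ i, D ≤ i → x i = 0) →
        RunsIn P (layout R σ inp [] out x) (q.eval B)
          (layout R σ (S γ inp).1 [] (revCode (S γ inp).2 ++ out) x)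

/-- Statements that only write. -/
def Writable (vars : List (Γ → ℕ)) (o : Γ → List ℕ) : Prop :=
  Realizable vars fun γ inp => (inp, o γ)

/-- Execute one statement after another. -/
def seqStm (S T : Stm Γ) : Stm Γ := fun γ inp =>
  ((T γ (S γ inp).1).1, (S γ inp).2 ++ (T γ (S γ inp).1).2)

/-- Execute `S` for the values `0, …, i - 1` of its last variable. -/
def forStm (S : Stm (Γ × ℕ)) (γ : Γ) (inp : List Bool) : ℕ → List Bool × List ℕ
  | 0 => (inp, [])
  | i + 1 => ((S (γ, i) (forStm S γ inp i).1).1,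
      (forStm S γ inp i).2 ++ (S (γ, i) (forStm S γ inp i).1).2)

/-- Execute `S` until the input is empty, but at most a given number of times. -/
def whileStm (S : Stm Γ) (γ : Γ) : ℕ → List Bool → List Bool × List ℕ
  | 0, inp => (inp, [])
  | i + 1, inp => if inp = [] then (inp, []) else
      ((whileStm S γ i (S γ inp).1).1, (S γ inp).2 ++ (whileStm S γ i (S γ inp).1).2)

theorem length_forStm_le {S : Stm (Γ × ℕ)} (hS : ∀ γ inp, (S γ inp).1.length ≤ inp.length)
    (γ : Γ) (inp : List Bool) (i : ℕ) : (forStm S γ inp i).1.length ≤ inp.length := by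
  induction i with
  | zero => exact le_rfl
  | succ i ih => exact (hS _ _).trans ih

/-- When no round consumes input, the rounds are independent of each other and the output is a plain
concatenation. -/
theorem forStm_of_read_only (o : Γ × ℕ → List Bool → List ℕ) (γ : Γ) (inp : List Bool) (i : ℕ) :
    forStm (fun p inp => (inp, o p inp)) γ inp i =
      (inp, (List.range i).flatMap fun j => o (γ, j) inp) := by
  induction i with
  | zero => rfl
  | succ i ih => rw [forStm, ih, List.range_succ]; simp

theorem Realizable.skip (vars : List (Γ → ℕ)) : Realizable vars fun _ inp => (inp, []) :=
  ⟨fun _ _ => le_rfl, fun R D l hl hD => ⟨Prog.skip, 1, fun B γ σ inp out x _ _ _ _ =>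
    (RunsIn.skip _).congr (by simp) (by simp)⟩⟩

theorem Realizable.seq {S T : Stm Γ} (hS : Realizable vars S) (hT : Realizable vars T) :
    Realizable vars (seqStm S T) := by
  refine ⟨fun γ inp => (hT.1 _ _).trans (hS.1 _ _), fun R D l hl hD => ?_⟩
  obtain ⟨P, p, hP⟩ := hS.2 R D l hl hD
  obtain ⟨Q, q, hQ⟩ := hT.2 R D l hl hD
  refine ⟨Prog.seq P Q, p + q, fun B γ σ inp out x hB hi hx h0 => ?_⟩
  refine ((hP B γ σ inp out x hB hi hx h0).seq (hQ B γ σ _ _ x hB ((hS.1 _ _).trans hi) hx h0)).congr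
    (by simp) ?_
  simp only [seqStm, revCode_append, List.append_assoc]

/-- A binding construct: the number found at position `e` becomes a new variable of `S`, and the
input is left intact. This is how data from the input get into expressions. -/
theorem Realizable.natAt {e : Γ → ℕ} {S : Stm (Γ × ℕ)} (he : Evaluable vars e)
    (hS : Realizable (extend vars) S) :
    Realizable vars fun γ inp => S (γ, natAt (e γ) inp) inp := by
  refine ⟨fun γ inp => hS.1 _ _, fun R D l hl hD => ?_⟩
  obtain ⟨⟨m, hm⟩, he⟩ := he
  obtain ⟨P, p, hP⟩ := he R (D + 2) l hl (fun p hp => (hD p hp).trans (by omega))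
  obtain ⟨N, hN⟩ := exists_runsIn_natAt R D
  obtain ⟨Q, q, hQ⟩ := hS.2 R (D + 1) ((D, Prod.snd) :: l.map fun p => (p.1, fun γ => p.2 γ.1))
    (by simp [extend, ← hl]) (by
      simp only [List.mem_cons, List.mem_map]
      rintro p (rfl | ⟨p, hp, rfl⟩)
      · simp
      · exact (hD p hp).trans (by omega))
  refine ⟨Prog.seq P (Prog.seq N (Prog.seq Q (Prog.loop (R + 3 + D) (Prog.pop (R + 3 + D))))),
    p + ((m + 1) * (Polynomial.X * 20 + 20) + (q + (Polynomial.X * 2 + 1))),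
    fun B γ σ inp out x hB hi hx h0 => ?_⟩
  have hm' := hm B γ hB
  have h1 := hP B γ σ inp [] out x hB hx (fun i hi => h0 i (by omega))
  have h2 := hN σ inp out (Function.update x (D + 2) (e γ))
    (by rw [Function.update_of_ne (by omega), h0 D le_rfl])
    (by rw [Function.update_of_ne (by omega), h0 (D + 1) (by omega)])
  have e1 : Function.update (Function.update x (D + 2) (e γ)) (D + 2) 0 = x := by
    rw [Function.update_idem, ← h0 (D + 2) (by omega), Function.update_eq_self]
  rw [e1, Function.update_self] at h2
  have hv := natAt_le_length (e γ) inp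
  have h3 := hQ B (γ, WPQ.natAt (e γ) inp) σ inp out (Function.update x D (WPQ.natAt (e γ) inp))
    (by
      simp only [extend, List.mem_cons, List.mem_map]
      rintro v (rfl | ⟨v, hv, rfl⟩)
      · exact hv.trans hi
      · exact hB v hv)
    hi
    (by
      simp only [List.mem_cons, List.mem_map]
      rintro p (rfl | ⟨p, hp, rfl⟩)
      · simp
      · simp only [Function.update_of_ne (hD p hp).ne, hx p hp])
    (fun i hi => by rw [Function.update_of_ne (by omega), h0 i (by omega)])
  refine (h1.seq (h2.seq (h3.seq (runsIn_clear ..)))).congr ?_ ?_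
  · simp only [Polynomial.eval_add, Polynomial.eval_mul, Polynomial.eval_X, Polynomial.eval_one,
      Polynomial.eval_ofNat, Function.update_self]
    have := hv.trans hi
    gcongr
  · congr 1
    rw [Function.update_idem, ← h0 D le_rfl, Function.update_eq_self]

theorem Realizable.dropNat (vars : List (Γ → ℕ)) :
    Realizable vars fun _ inp => (dropNat inp, []) := by
  refine ⟨fun γ inp => length_dropNat_le inp, fun R D l hl hD => ?_⟩
  obtain ⟨P, hP⟩ := exists_runsIn_dropNat R D
  refine ⟨P, Polynomial.X * 9 + 8, fun B γ σ inp out x hB hi hx h0 => ?_⟩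
  refine (hP σ inp out x (h0 D le_rfl) (h0 (D + 1) (by omega))).congr ?_ (by simp)
  simp
  omega

theorem Realizable.ite {e : Γ → ℕ} {S T : Stm Γ} (he : Evaluable vars e)
    (hS : Realizable vars S) (hT : Realizable vars T) :
    Realizable vars fun γ inp => if e γ = 0 then S γ inp else T γ inp := by
  refine ⟨fun γ inp => ?_, fun R D l hl hD => ?_⟩
  · dsimp only
    split_ifs
    exacts [hS.1 _ _, hT.1 _ _]
  obtain ⟨⟨m, hm⟩, he⟩ := he
  obtain ⟨P, p, hP⟩ := he R D l hl hD
  obtain ⟨Q, q, hQ⟩ := hS.2 R (D + 1) l hl (fun p hp => (hD p hp).trans (by omega))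
  obtain ⟨Q', q', hQ'⟩ := hT.2 R (D + 1) l hl (fun p hp => (hD p hp).trans (by omega))
  refine ⟨Prog.seq P (Prog.seq (Prog.branch (R + 3 + D) Q Q' Q')
    (Prog.loop (R + 3 + D) (Prog.pop (R + 3 + D)))),
    p + ((q + q' + 1) + (m * 2 + 1)), fun B γ σ inp out x hB hi hx h0 => ?_⟩
  have hm' := hm B γ hB
  have h1 := hP B γ σ inp [] out x hB hx h0
  have g1 : ∀ p ∈ l, Function.update x D (e γ) p.1 = p.2 γ := fun p hp => by
    rw [Function.update_of_ne (hD p hp).ne, hx p hp]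
  have g2 : ∀ i, D + 1 ≤ i → Function.update x D (e γ) i = 0 := fun i hi => by
    rw [Function.update_of_ne (by omega), h0 i (by omega)]
  have h2 : RunsIn (Prog.branch (R + 3 + D) Q Q' Q')
      (layout R σ inp [] out (Function.update x D (e γ))) (q.eval B + q'.eval B + 1)
      (layout R σ (if e γ = 0 then S γ inp else T γ inp).1 []
        (revCode (if e γ = 0 then S γ inp else T γ inp).2 ++ out) (Function.update x D (e γ))) := by
    by_cases h : e γ = 0
    · rw [if_pos h]
      exact (RunsIn.branchNil (by simp [h]) (hQ B γ σ inp out _ hB hi g1 g2)).mono (by omega)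
    · rw [if_neg h]
      obtain ⟨n, hn⟩ := Nat.exists_eq_succ_of_ne_zero h
      exact (RunsIn.branchTrue (by simp [hn, List.replicate_succ]) (hQ' B γ σ inp out _ hB hi g1 g2)).mono (by omega)
  refine (h1.seq (h2.seq (runsIn_clear ..))).congr ?_ ?_
  · simp
    omega
  · congr 1
    rw [Function.update_idem, ← h0 D le_rfl, Function.update_eq_self]

theorem Realizable.forStm {e : Γ → ℕ} {S : Stm (Γ × ℕ)} (he : Evaluable vars e)
    (hS : Realizable (extend vars) S) :
    Realizable vars fun γ inp => WPQ.forStm S γ inp (e γ) := by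
  refine ⟨fun γ inp => length_forStm_le hS.1 γ inp _, fun R D l hl hD => ?_⟩
  obtain ⟨⟨m, hm⟩, he⟩ := he
  obtain ⟨P, p, hP⟩ := he R (D + 1) l hl (fun p hp => (hD p hp).trans (by omega))
  obtain ⟨Q, q, hQ⟩ := hS.2 R (D + 2) ((D, Prod.snd) :: l.map fun p => (p.1, fun γ => p.2 γ.1))
    (by simp [extend, ← hl]) (by
      simp only [List.mem_cons, List.mem_map]
      rintro p (rfl | ⟨p, hp, rfl⟩)
      · simp
      · exact (hD p hp).trans (by omega))
  refine ⟨Prog.seq P (Prog.seq (Prog.loop (R + 3 + (D + 1))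
    (Prog.seq (Prog.pop (R + 3 + (D + 1))) (Prog.seq Q (Prog.push (R + 3 + D) true))))
    (Prog.loop (R + 3 + D) (Prog.pop (R + 3 + D)))),
    p + ((m * ((1 + (q.comp (Polynomial.X + m) + 1)) + 1) + 1) + (m * 2 + 1)),
    fun B γ σ inp out x hB hi hx h0 => ?_⟩
  have hm' := hm B γ hB
  have h1 := hP B γ σ inp [] out x hB hx (fun i hi => h0 i (by omega))
  -- `D` holds the loop variable and `D + 1` the number of rounds left.
  set y : ℕ → ℕ → ℕ := fun j => Function.update (Function.update x D j) (D + 1) (e γ - j) with hy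
  have hL := RunsIn.loop (r := R + 3 + (D + 1))
    (P := Prog.seq (Prog.pop (R + 3 + (D + 1))) (Prog.seq Q (Prog.push (R + 3 + D) true)))
    (c := 1 + (q.eval (B + m.eval B) + 1)) (e γ)
    (fun j => layout R σ (WPQ.forStm S γ inp j).1 [] (revCode (WPQ.forStm S γ inp j).2 ++ out) (y j))
    (by intro j hj; simp [hy]; omega) (by simp [hy]) (by
      intro j hj
      have g1 := runsIn_pop_var R σ (WPQ.forStm S γ inp j).1 []
        (revCode (WPQ.forStm S γ inp j).2 ++ out) (y j) (D + 1)
      have g2 := hQ (B + m.eval B) (γ, j) σ (WPQ.forStm S γ inp j).1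
        (revCode (WPQ.forStm S γ inp j).2 ++ out)
        (Function.update (y j) (D + 1) (y j (D + 1) - 1))
        (by
          simp only [extend, List.mem_cons, List.mem_map]
          rintro v (rfl | ⟨v, hv, rfl⟩)
          · simp only
            omega
          · exact (hB v hv).trans (Nat.le_add_right _ _))
        (((length_forStm_le hS.1 γ inp j).trans hi).trans (Nat.le_add_right _ _))
        (by
          simp only [List.mem_cons, List.mem_map]
          rintro p (rfl | ⟨p, hp, rfl⟩)
          · simp [hy]
          · have := hD p hp
            simp only [hy, Function.update_apply]
            rw [if_neg (by omega), if_neg (by omega), if_neg (by omega), hx p hp])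
        (fun i hi => by
          simp only [hy, Function.update_apply]
          rw [if_neg (by omega), if_neg (by omega), if_neg (by omega), h0 i (by omega)])
      refine (g1.seq (g2.seq (runsIn_push_var ..))).congr le_rfl ?_
      simp only [WPQ.forStm, revCode_append, List.append_assoc]
      congr 1
      funext r
      simp only [hy, Function.update_apply]
      split_ifs <;> omega)
  have e1 : Function.update x (D + 1) (e γ) = y 0 := by
    funext r
    have := h0 D le_rfl
    simp only [hy, Function.update_apply]
    split_ifs <;> subst_vars <;> omega
  rw [e1] at h1
  refine (h1.seq (hL.seq (runsIn_clear ..))).congr ?_ ?_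
  · have : y (e γ) D = e γ := by simp [hy]
    rw [this]
    simp only [Polynomial.eval_add, Polynomial.eval_mul, Polynomial.eval_comp, Polynomial.eval_X,
      Polynomial.eval_one, Polynomial.eval_ofNat]
    gcongr
  · congr 1
    funext r
    have := h0 D le_rfl
    have := h0 (D + 1) (by omega)
    simp only [hy, Function.update_apply]
    split_ifs <;> subst_vars <;> omega

theorem length_whileStm_le {S : Stm Γ} (hS : ∀ γ inp, (S γ inp).1.length ≤ inp.length)
    (γ : Γ) (i : ℕ) (inp : List Bool) : (whileStm S γ i inp).1.length ≤ inp.length := by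
  induction i generalizing inp with
  | zero => exact le_rfl
  | succ i ih =>
    rw [whileStm]
    split_ifs
    · exact le_rfl
    · exact (ih _).trans (hS _ _)

/-- The program never computes the length of the input: it loops on the input register itself. As
every round shortens the input, its initial length is a sufficient number of rounds. -/
theorem Realizable.whileStm {S : Stm Γ} (hS : Realizable vars S)
    (hlt : ∀ γ inp, inp ≠ [] → (S γ inp).1.length < inp.length) :
    Realizable vars fun γ inp => WPQ.whileStm S γ inp.length inp := by
  refine ⟨fun γ inp => length_whileStm_le hS.1 γ _ _, fun R D l hl hD => ?_⟩
  obtain ⟨P, p, hP⟩ := hS.2 R D l hl hD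
  refine ⟨Prog.loop R P, Polynomial.X * (p + 1) + 1, fun B γ σ inp out x hB hi hx h0 => ?_⟩
  have key : ∀ (i : ℕ) (inp out : List Bool), inp.length ≤ i → i ≤ B →
      RunsIn (Prog.loop R P) (layout R σ inp [] out x) (i * (p.eval B + 1) + 1)
        (layout R σ (WPQ.whileStm S γ i inp).1 []
          (revCode (WPQ.whileStm S γ i inp).2 ++ out) x) := by
    intro i
    induction i with
    | zero =>
      intro inp out h _
      have : inp = [] := List.length_eq_zero_iff.1 (by omega)
      subst this
      exact (RunsIn.loopNil (by simp)).congr (by omega) (by simp [WPQ.whileStm])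
    | succ i ih =>
      intro inp out h hB'
      by_cases hn : inp = []
      · subst hn
        exact (RunsIn.loopNil (by simp)).congr (by omega) (by simp [WPQ.whileStm])
      · have hl := hlt γ inp hn
        refine (RunsIn.loopCons (by simpa using hn) (hP B γ σ inp out x hB (h.trans hB') hx h0)
          (ih _ _ (by omega) (by omega))).congr ?_ ?_
        · rw [Nat.succ_mul]
          omega
        · simp only [WPQ.whileStm, if_neg hn, revCode_append, List.append_assoc]
  refine (key inp.length inp out le_rfl hi).congr ?_ rfl
  simp only [Polynomial.eval_add, Polynomial.eval_mul, Polynomial.eval_X, Polynomial.eval_one]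
  gcongr

theorem Writable.nil (vars : List (Γ → ℕ)) : Writable vars fun _ => [] := Realizable.skip vars

theorem Writable.append {o o' : Γ → List ℕ} (h : Writable vars o) (h' : Writable vars o') :
    Writable vars fun γ => o γ ++ o' γ := Realizable.seq h h'

theorem Writable.ite {e : Γ → ℕ} {o o' : Γ → List ℕ} (he : Evaluable vars e)
    (h : Writable vars o) (h' : Writable vars o') :
    Writable vars fun γ => if e γ = 0 then o γ else o' γ := by
  have := Realizable.ite he h h'
  unfold Writable
  convert this using 3 with γ inp
  split_ifs with hc <;> simp [hc]

theorem Writable.flatMap_range {e : Γ → ℕ} {o : Γ → ℕ → List ℕ} (he : Evaluable vars e)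
    (h : Writable (extend vars) fun p => o p.1 p.2) :
    Writable vars fun γ => (List.range (e γ)).flatMap (o γ) := by
  have := Realizable.forStm he h
  unfold Writable
  convert this using 3 with γ inp
  rw [forStm_of_read_only fun p _ => o p.1 p.2]

/-- The output is a stack, so the ones are pushed before the terminating zero, and the code appears
in reverse. -/
theorem Writable.singleton {e : Γ → ℕ} (he : Evaluable vars e) : Writable vars fun γ => [e γ] := by
  refine ⟨fun γ inp => le_rfl, fun R D l hl hD => ?_⟩
  obtain ⟨⟨m, hm⟩, he⟩ := he
  obtain ⟨P, p, hP⟩ := he R D l hl hD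
  refine ⟨Prog.seq P (Prog.seq (Prog.loop (R + 3 + D) (Prog.seq (Prog.pop (R + 3 + D))
    (Prog.push (R + 1) true))) (Prog.push (R + 1) false)), p + ((m * 3 + 1) + 1),
    fun B γ σ inp out x hB hi hx h0 => ?_⟩
  have hm' := hm B γ hB
  have hL := RunsIn.loop (r := R + 3 + D)
    (P := Prog.seq (Prog.pop (R + 3 + D)) (Prog.push (R + 1) true)) (c := 2) (e γ)
    (fun j => layout R σ inp [] (List.replicate j true ++ out) (Function.update x D (e γ - j)))
    (by intro j hj; simp; omega) (by simp) (by
      intro j hj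
      refine ((runsIn_pop_var ..).seq (runsIn_push_out ..)).congr le_rfl ?_
      simp [List.replicate_succ, Nat.sub_sub])
  refine ((hP B γ σ inp [] out x hB hx h0).seq (hL.seq (runsIn_push_out ..))).congr ?_ ?_
  · simp
    omega
  · rw [Nat.sub_self, ← h0 D le_rfl, Function.update_eq_self, revCode_singleton]
    rfl

theorem Writable.cons {e : Γ → ℕ} {o : Γ → List ℕ} (he : Evaluable vars e)
    (h : Writable vars o) : Writable vars fun γ => e γ :: o γ := (Writable.singleton he).append h

end Realizable

end WPQ

namespace WPQ

/-! ### Composition of reductions with deterministic transformations -/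

/-- For monomials this is c ≤ c², true for natural coefficients; for sums the mixed terms are
nonnegative. It separates the parameter from the input size in the running time of a composition. -/
theorem eval_mul_le (q : Polynomial ℕ) (a b : ℕ) : q.eval (a * b) ≤ q.eval a * q.eval b := by
  induction q using Polynomial.induction_on' with
  | add p q hp hq =>
    simp only [Polynomial.eval_add]
    nlinarith
  | monomial n c =>
    simp only [Polynomial.eval_monomial, mul_pow]
    have := Nat.mul_le_mul_right (a ^ n * b ^ n) (Nat.le_mul_self c)
    nlinarith

theorem primrec_eval (q : Polynomial ℕ) : Primrec fun n => q.eval n := by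
  induction q using Polynomial.induction_on' with
  | add p q hp hq =>
    simp only [Polynomial.eval_add]
    exact Primrec.nat_add.comp hp hq
  | monomial n c =>
    simp only [Polynomial.eval_monomial]
    have : Primrec fun k : ℕ => k ^ n := by
      induction n with
      | zero => simpa using Primrec.const 1
      | succ n ih =>
        simp only [pow_succ]
        exact Primrec.nat_mul.comp ih Primrec.id
    exact Primrec.nat_mul.comp (Primrec.const c) this

/-- The string function computed by a statement without variables. -/
def stmMap (S : Stm Unit) (y : List Bool) : List Bool := encodeNats (S () y).2

/-- The argument is moved into place by two reversals, which cancel. The single reversal at the end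
undoes the reversed order of the output stack. -/
theorem exists_runsIn_stmMap {S : Stm Unit} (hS : Realizable [] S) (R : ℕ) (hR : 0 < R) :
    ∃ (P : Prog) (q : Polynomial ℕ), ∀ σ : Store, (∀ r, R ≤ r → σ r = []) →
      ∃ τ, RunsIn P σ (q.eval (σ 0).length) τ ∧ τ 0 = stmMap S (σ 0) := by
  obtain ⟨P, q, hP⟩ := hS.2 R 0 [] rfl (by simp)
  obtain ⟨p, hp⟩ : ∃ p : Polynomial ℕ, p = q := ⟨q, rfl⟩
  refine ⟨Prog.seq (moveBits 0 (R + 1)) (Prog.seq (moveBits (R + 1) R)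
    (Prog.seq P (moveBits (R + 1) 0))), (Polynomial.X * 4 + 1) + ((Polynomial.X * 4 + 1) +
      (q + (q * 4 + 1))), fun σ hσ => ?_⟩
  have h1 := runsIn_moveBits (by omega : 0 ≠ R + 1) σ
  have h2 := runsIn_moveBits (by omega : R + 1 ≠ R)
    (Function.update (Function.update σ 0 []) (R + 1) ((σ 0).reverse ++ σ (R + 1)))
  have h3 := hP (σ 0).length () (Function.update σ 0 []) (σ 0) [] (fun _ => 0) (by simp) le_rfl
    (by simp) (by simp)
  obtain ⟨t, ht, h3⟩ := h3
  have h4 := runsIn_moveBits (by omega : R + 1 ≠ 0)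
    (layout R (Function.update σ 0 []) (S () (σ 0)).1 [] (revCode (S () (σ 0)).2 ++ [])
      fun _ => 0)
  have e : Function.update (Function.update (Function.update (Function.update σ 0 []) (R + 1)
      ((σ 0).reverse ++ σ (R + 1))) (R + 1) []) R ((Function.update (Function.update σ 0 []) (R + 1)
      ((σ 0).reverse ++ σ (R + 1)) (R + 1)).reverse ++ Function.update (Function.update σ 0 [])
      (R + 1) ((σ 0).reverse ++ σ (R + 1)) R) =
      layout R (Function.update σ 0 []) (σ 0) [] [] fun _ => 0 := by
    have g1 := hσ R le_rfl
    have g2 := hσ (R + 1) (by omega)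
    funext r
    simp only [layout, Function.update_apply]
    by_cases c1 : r < R
    · have : r ≠ R := by omega
      have : r ≠ R + 1 := by omega
      simp [*]
    · have := hσ r (by omega)
      have : r ≠ 0 := by omega
      have : R ≠ 0 := by omega
      by_cases c2 : r = R
      · simp [*]
      · by_cases c3 : r = R + 1
        · simp [*]
        · simp [*]
  rw [e] at h2
  -- The output is no longer than the time spent on writing it, which bounds the cost of moving it.
  have hl := h3.length_le (R + 1)
  simp only [layout_out, List.append_nil, List.length_nil, zero_add] at hl
  have g2 := hσ (R + 1) (by omega)
  refine ⟨_, (h1.seq (h2.seq (RunsIn.seq ⟨t, ht, h3⟩ h4))).congr ?_ rfl, ?_⟩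
  · simp [g2]
    omega
  · have e0 : layout R (Function.update σ 0 []) (S () (σ 0)).1 [] (revCode (S () (σ 0)).2 ++ [])
        (fun _ => 0) 0 = [] := by simp [layout, hR]
    rw [Function.update_self, e0]
    simp [revCode, stmMap]

/-- Only the classical post-processing is extended. Every outcome that gave the correct intermediate
string now gives the correct result, so the success probability does not drop. -/
theorem FPQTComputable.stmMap {κ : List Bool → ℕ} {F : List Bool → List Bool}
    (hF : FPQTComputable κ F) {S : Stm Unit} (hS : Realizable [] S) :
    FPQTComputable κ fun x => WPQ.stmMap S (F x) := by
  obtain ⟨gen, post, f, p, hf, h⟩ := hF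
  -- Work space above the registers of `post` and above its two inputs is empty when `post` halts.
  obtain ⟨P, q, hP⟩ := exists_runsIn_stmMap hS (max post.bound 2) (by omega)
  refine ⟨gen, Prog.seq post P, fun k => f k + q.eval (f k + 1),
    p + q.comp (p + Polynomial.X), ?_, fun x => ?_⟩
  · exact (Primrec.nat_add.to_comp).comp hf
      ((primrec_eval q).to_comp.comp (Primrec.succ.to_comp.comp hf))
  obtain ⟨w, C, out, hC, hgen, hpost, hprob⟩ := h x
  refine ⟨w, C, fun z => WPQ.stmMap S (out z), hC, ?_, fun z => ?_, hprob.trans ?_⟩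
  · obtain ⟨t, τ, ht, hr, h0⟩ := hgen
    refine ⟨t, τ, ht.trans ?_, hr, h0⟩
    simp only [Polynomial.eval_add]
    gcongr <;> omega
  · obtain ⟨t, τ, ht, hr, h0⟩ := hpost z
    obtain ⟨ρ, ⟨u, hu, hr'⟩, hρ⟩ := hP τ fun r hr' => by
      rw [hr.eq_of_bound_le ((le_max_left _ _).trans hr')]
      have : 2 ≤ r := (le_max_right _ _).trans hr'
      exact List.getD_eq_default _ _ (by simpa using this)
    refine ⟨t + u, ρ, ?_, Run.seq hr hr', by rw [hρ, h0]⟩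
    have hl := hr.length_le 0
    simp only [inputStore, List.getD_cons_zero] at hl
    -- The length of the intermediate string, written as a factor depending on the parameter times a
    -- polynomial in the input length, so that `eval_mul_le` applies.
    have h1 : (τ 0).length ≤ (f (κ x) + 1) * (p.eval x.length + x.length) := by nlinarith
    have h2 := (hu.trans (eval_le_eval q h1)).trans (eval_mul_le q _ _)
    simp only [Polynomial.eval_add, Polynomial.eval_comp, Polynomial.eval_X]
    nlinarith
  · refine Finset.sum_le_sum_of_subset_of_nonneg (fun z hz => ?_) fun z _ _ => sq_nonneg _
    simp only [Finset.mem_filter, Finset.mem_univ, true_and] at hz ⊢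
    rw [hz]

theorem FPQTReducible.stmMap {A B B' : ParamProblem} (h : FPQTReducible A B) {S : Stm Unit}
    (hS : Realizable [] S) (hyes : ∀ y ∈ B.yes, WPQ.stmMap S y ∈ B'.yes)
    (hno : ∀ y ∈ B.no, WPQ.stmMap S y ∈ B'.no)
    (hparam : ∀ y, B'.param (WPQ.stmMap S y) ≤ B.param y) : FPQTReducible A B' := by
  obtain ⟨F, h1, h2, h3, g, hg, h4⟩ := h
  exact ⟨fun x => WPQ.stmMap S (F x), fun x hx => hyes _ (h1 x hx), fun x hx => hno _ (h2 x hx),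
    h3.stmMap hS, g, hg, fun x => (hparam _).trans (h4 x)⟩

end WPQ

namespace WPQ

/-! ### The transformation of circuits, on the level of descriptions

Here `k` and `n` belong to the given instance with `N` qubits.  Qubit `q` is bit number `q / k` of
block `q % k`, and value `v` of block `b` is represented by the qubit `b * (2 * n) + v` of the
weight-preserving circuit. -/

/-- The place value of a qubit in its block. -/
def placeValue (k n q : ℕ) : ℕ := min (2 ^ (q / k)) (2 * n)

/-- The number of values of a block in which the first `N` qubits are arbitrary and the others
are `0`. -/
def numValues (k n N : ℕ) : ℕ := min (2 ^ ((N + k - 1) / k)) (2 * n)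

/-- The qubits representing the values of a block in which the bit of `q` is `1`. -/
def onePositions (k n N q : ℕ) : List ℕ := (List.range (numValues k n N)).flatMap fun v =>
  if v / placeValue k n q % 2 = 0 then [] else [q % k * (2 * n) + v]

/-- The qubits representing the values of a block in which the bit of `q` is `0`. -/
def zeroPositions (k n N q : ℕ) : List ℕ := (List.range (numValues k n N)).flatMap fun v =>
  if v / placeValue k n q % 2 = 0 then [q % k * (2 * n) + v] else []

/-- The ancilla that indicates that the first `i` blocks are legal. -/
def legalPos (k n i : ℕ) : ℕ := k * (2 * n) + i

/-- The output qubit. -/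
def outPos (k n : ℕ) : ℕ := k * (2 * n) + k + 1

/-- The ancilla that indicates that the first `i` controls are satisfied. -/
def ladderPos (k n i : ℕ) : ℕ := k * (2 * n) + k + 2 + i

/-- Swap the qubits `s` and `d` if qubit `q` is `1`. -/
def transferCode (k n N q s d : ℕ) : List ℕ :=
  (onePositions k n N q).flatMap fun i => [1, i, s, d]

/-- Flip qubit `q` if the ancilla `c` is `1`. -/
def flipCode (k n N q c : ℕ) : List ℕ :=
  (zeroPositions k n N q).flatMap fun i => [1, c, i, i + placeValue k n q]

/-- Apply the one-qubit gate `i` to qubit `q`. -/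
def rotateCode (k n N i q : ℕ) : List ℕ :=
  (zeroPositions k n N q).flatMap fun p => [0, i, p + placeValue k n q, p]

/-- Check that all blocks are legal and represent `0` beyond the first `m` qubits. -/
def checkCode (k n m : ℕ) : List ℕ := (List.range k).flatMap fun b =>
  (List.range (numValues k n (m - b))).flatMap fun v =>
    [1, b * (2 * n) + v, legalPos k n b, legalPos k n (b + 1)]

/-- Flip qubit `t` if the token is at the ladder position `i` and all of `cs` are `1`. -/
def ladderCode (k n N : ℕ) : ℕ → List ℕ → ℕ → List ℕ
  | i, [], t => flipCode k n N t (ladderPos k n i)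
  | i, c :: cs, t => transferCode k n N c (ladderPos k n i) (ladderPos k n (i + 1)) ++
      ladderCode k n N (i + 1) cs t ++
      transferCode k n N c (ladderPos k n i) (ladderPos k n (i + 1))

/-- The nested recursion is unrolled into the way up, the flip, and the way down with the controls
in reverse order. In this form two for-statements can write it. -/
theorem ladderCode_eq (k n N : ℕ) (cs : List ℕ) (t i : ℕ) : ladderCode k n N i cs t =
    (List.range cs.length).flatMap (fun j => transferCode k n N (cs.getD j 0)
      (ladderPos k n (i + j)) (ladderPos k n (i + j + 1))) ++
    (flipCode k n N t (ladderPos k n (i + cs.length)) ++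
    (List.range cs.length).flatMap (fun j => transferCode k n N (cs.getD (cs.length - 1 - j) 0)
      (ladderPos k n (i + (cs.length - 1 - j))) (ladderPos k n (i + (cs.length - 1 - j) + 1)))) := by
  induction cs generalizing i with
  | nil => simp [ladderCode]
  | cons c cs ih =>
    rw [ladderCode, ih, List.length_cons, List.range_succ_eq_map, List.flatMap_cons,
      List.flatMap_map, ← List.range_succ_eq_map, List.range_succ, List.flatMap_append]
    simp only [List.append_assoc, List.flatMap_cons, List.flatMap_nil, List.append_nil]
    congr 1
    have e1 : ∀ j, i + 1 + j = i + (j + 1) := fun j => by omega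
    have e2 : i + 1 + cs.length = i + (cs.length + 1) := by omega
    simp only [e2, List.getD_cons_succ, Nat.succ_eq_add_one, e1]
    congr 1
    congr 1
    congr 1
    · refine List.flatMap_congr fun j hj => ?_
      have hj := List.mem_range.1 hj
      have e3 : cs.length + 1 - 1 - j = (cs.length - 1 - j) + 1 := by omega
      rw [e3, List.getD_cons_succ]
    · simp

variable {g : ℕ}

/-- The gates that replace a gate. -/
def gateCode (k n N : ℕ) : Gate g N → List ℕ
  | Gate.one i q => rotateCode k n N i q
  | Gate.cnot s t => ladderCode k n N 0 [s.val] t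
  | Gate.toffoli cs t => ladderCode k n N 0 (cs.map Fin.val) t
  | Gate.fanout s ts => (ts.map Fin.val).flatMap fun t => ladderCode k n N 0 [s.val] t

/-- The initial values of the ancillas. -/
def ancillaCode (k N : ℕ) : List ℕ := (List.range (k + N + 3)).flatMap fun i =>
  if i * ((i - (k + 2)) + (k + 2 - i)) = 0 then [1] else [0]

/-- The description of the transformed instance. -/
def instanceCode (k n m N out : ℕ) (gates : List ℕ) : List ℕ :=
  ([k, k * (2 * n), k + N + 3, outPos k n] ++ ancillaCode k N ++ checkCode k n m) ++ (gates ++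
    transferCode k n N out (legalPos k n k) (outPos k n))

/-! ### The program -/

section Program

variable {Γ : Type} {vars : List (Γ → ℕ)} {k n m N q s d c i out : Γ → ℕ}

theorem Evaluable.placeValue (hk : Evaluable vars k) (hn : Evaluable vars n)
    (hq : Evaluable vars q) : Evaluable vars fun γ => WPQ.placeValue (k γ) (n γ) (q γ) :=
  Evaluable.minTwoPow (hq.div hk) ((Evaluable.const vars 2).mul hn)

theorem Evaluable.numValues (hk : Evaluable vars k) (hn : Evaluable vars n)
    (hN : Evaluable vars N) : Evaluable vars fun γ => WPQ.numValues (k γ) (n γ) (N γ) :=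
  Evaluable.minTwoPow (((hN.add hk).sub (Evaluable.const vars 1)).div hk)
    ((Evaluable.const vars 2).mul hn)

theorem Evaluable.position (hk : Evaluable vars k) (hn : Evaluable vars n)
    (hq : Evaluable vars q) :
    Evaluable (extend vars) fun p => q p.1 % k p.1 * (2 * n p.1) + p.2 :=
  ((hq.mod hk).mul ((Evaluable.const vars 2).mul hn)).lift.add Evaluable.snd

theorem Evaluable.legalPos (hk : Evaluable vars k) (hn : Evaluable vars n)
    (hi : Evaluable vars i) : Evaluable vars fun γ => WPQ.legalPos (k γ) (n γ) (i γ) :=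
  (hk.mul ((Evaluable.const vars 2).mul hn)).add hi

theorem Evaluable.outPos (hk : Evaluable vars k) (hn : Evaluable vars n) :
    Evaluable vars fun γ => WPQ.outPos (k γ) (n γ) :=
  ((hk.mul ((Evaluable.const vars 2).mul hn)).add hk).succ

theorem Evaluable.ladderPos (hk : Evaluable vars k) (hn : Evaluable vars n)
    (hi : Evaluable vars i) : Evaluable vars fun γ => WPQ.ladderPos (k γ) (n γ) (i γ) :=
  (((hk.mul ((Evaluable.const vars 2).mul hn)).add hk).add (Evaluable.const vars 2)).add hi

theorem Writable.congr {o o' : Γ → List ℕ} (h : Writable vars o) (he : ∀ γ, o γ = o' γ) :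
    Writable vars o' := (funext he : o = o') ▸ h

theorem Writable.onePositions (hk : Evaluable vars k) (hn : Evaluable vars n)
    (hN : Evaluable vars N) (hq : Evaluable vars q) {o : Γ → ℕ → List ℕ}
    (ho : Writable (extend vars) fun p => o p.1 (q p.1 % k p.1 * (2 * n p.1) + p.2)) :
    Writable vars fun γ => (WPQ.onePositions (k γ) (n γ) (N γ) (q γ)).flatMap (o γ) := by
  refine (Writable.flatMap_range
    (o := fun γ v => if v / WPQ.placeValue (k γ) (n γ) (q γ) % 2 = 0 then [] else o γ (q γ % k γ * (2 * n γ) + v))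
    (hk.numValues hn hN) (Writable.ite
    ((Evaluable.snd.div (hk.placeValue hn hq).lift).mod (Evaluable.const _ 2))
    (Writable.nil _) ho)).congr fun γ => ?_
  rw [WPQ.onePositions, List.flatMap_assoc]
  refine List.flatMap_congr fun v _ => ?_
  split_ifs <;> simp

theorem Writable.zeroPositions (hk : Evaluable vars k) (hn : Evaluable vars n)
    (hN : Evaluable vars N) (hq : Evaluable vars q) {o : Γ → ℕ → List ℕ}
    (ho : Writable (extend vars) fun p => o p.1 (q p.1 % k p.1 * (2 * n p.1) + p.2)) :
    Writable vars fun γ => (WPQ.zeroPositions (k γ) (n γ) (N γ) (q γ)).flatMap (o γ) := by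
  refine (Writable.flatMap_range
    (o := fun γ v => if v / WPQ.placeValue (k γ) (n γ) (q γ) % 2 = 0 then o γ (q γ % k γ * (2 * n γ) + v) else [])
    (hk.numValues hn hN) (Writable.ite
    ((Evaluable.snd.div (hk.placeValue hn hq).lift).mod (Evaluable.const _ 2))
    ho (Writable.nil _))).congr fun γ => ?_
  rw [WPQ.zeroPositions, List.flatMap_assoc]
  refine List.flatMap_congr fun v _ => ?_
  split_ifs <;> simp

theorem Writable.transferCode (hk : Evaluable vars k) (hn : Evaluable vars n)
    (hN : Evaluable vars N) (hq : Evaluable vars q) (hs : Evaluable vars s)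
    (hd : Evaluable vars d) :
    Writable vars fun γ => WPQ.transferCode (k γ) (n γ) (N γ) (q γ) (s γ) (d γ) :=
  Writable.onePositions hk hn hN hq (o := fun γ i => [1, i, s γ, d γ])
    (Writable.cons (Evaluable.const _ 1) (Writable.cons (hk.position hn hq)
      (Writable.cons hs.lift (Writable.cons hd.lift (Writable.nil _)))))

theorem Writable.flipCode (hk : Evaluable vars k) (hn : Evaluable vars n)
    (hN : Evaluable vars N) (hq : Evaluable vars q) (hc : Evaluable vars c) :
    Writable vars fun γ => WPQ.flipCode (k γ) (n γ) (N γ) (q γ) (c γ) :=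
  Writable.zeroPositions hk hn hN hq
    (o := fun γ i => [1, c γ, i, i + WPQ.placeValue (k γ) (n γ) (q γ)])
    (Writable.cons (Evaluable.const _ 1) (Writable.cons hc.lift
      (Writable.cons (hk.position hn hq) (Writable.cons ((hk.position hn hq).add
        (hk.placeValue hn hq).lift) (Writable.nil _)))))

theorem Writable.rotateCode (hk : Evaluable vars k) (hn : Evaluable vars n)
    (hN : Evaluable vars N) (hi : Evaluable vars i) (hq : Evaluable vars q) :
    Writable vars fun γ => WPQ.rotateCode (k γ) (n γ) (N γ) (i γ) (q γ) :=
  Writable.zeroPositions hk hn hN hq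
    (o := fun γ p => [0, i γ, p + WPQ.placeValue (k γ) (n γ) (q γ), p])
    (Writable.cons (Evaluable.const _ 0) (Writable.cons hi.lift
      (Writable.cons ((hk.position hn hq).add (hk.placeValue hn hq).lift)
        (Writable.cons (hk.position hn hq) (Writable.nil _)))))

theorem Writable.checkCode (hk : Evaluable vars k) (hn : Evaluable vars n)
    (hm : Evaluable vars m) :
    Writable vars fun γ => WPQ.checkCode (k γ) (n γ) (m γ) := by
  have h1 : Evaluable (extend (extend vars)) fun p => p.1.2 * (2 * n p.1.1) + p.2 :=
    (Evaluable.snd.lift.mul ((Evaluable.const _ 2).mul hn.lift.lift)).add Evaluable.snd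
  have h2 : Evaluable (extend (extend vars)) fun p => WPQ.legalPos (k p.1.1) (n p.1.1) p.1.2 :=
    hk.lift.lift.legalPos hn.lift.lift Evaluable.snd.lift
  have h3 : Evaluable (extend (extend vars)) fun p =>
      WPQ.legalPos (k p.1.1) (n p.1.1) (p.1.2 + 1) :=
    hk.lift.lift.legalPos hn.lift.lift Evaluable.snd.lift.succ
  have h4 : Evaluable (extend vars) fun p => WPQ.numValues (k p.1) (n p.1) (m p.1 - p.2) :=
    hk.lift.numValues hn.lift (hm.lift.sub Evaluable.snd)
  have h5 : Writable (extend (extend vars)) fun p => [1, p.1.2 * (2 * n p.1.1) + p.2,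
      WPQ.legalPos (k p.1.1) (n p.1.1) p.1.2, WPQ.legalPos (k p.1.1) (n p.1.1) (p.1.2 + 1)] :=
    Writable.cons (Evaluable.const _ 1) (Writable.cons h1 (Writable.cons h2
      (Writable.cons h3 (Writable.nil _))))
  have h6 : Writable (extend vars) fun p =>
      (List.range (WPQ.numValues (k p.1) (n p.1) (m p.1 - p.2))).flatMap fun v =>
        [1, p.2 * (2 * n p.1) + v, WPQ.legalPos (k p.1) (n p.1) p.2,
          WPQ.legalPos (k p.1) (n p.1) (p.2 + 1)] :=
    Writable.flatMap_range h4 h5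
  exact Writable.flatMap_range hk h6

theorem Writable.ladderCode_singleton (hk : Evaluable vars k) (hn : Evaluable vars n)
    (hN : Evaluable vars N) (hs : Evaluable vars s) (hd : Evaluable vars d) :
    Writable vars fun γ => WPQ.ladderCode (k γ) (n γ) (N γ) 0 [s γ] (d γ) := by
  have h := Writable.transferCode hk hn hN hs (hk.ladderPos hn (Evaluable.const _ 0))
    (hk.ladderPos hn (Evaluable.const _ 1))
  exact (h.append (Writable.flipCode hk hn hN hd (hk.ladderPos hn (Evaluable.const _ 1)))).append h

theorem Writable.ancillaCode (hk : Evaluable vars k) (hN : Evaluable vars N) :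
    Writable vars fun γ => WPQ.ancillaCode (k γ) (N γ) :=
  Writable.flatMap_range ((hk.add hN).add (Evaluable.const _ 3))
    (Writable.ite (Evaluable.snd.mul ((Evaluable.snd.sub (hk.add (Evaluable.const _ 2)).lift).add
      ((hk.add (Evaluable.const _ 2)).lift.sub Evaluable.snd)))
      (Writable.singleton (Evaluable.const _ 1)) (Writable.singleton (Evaluable.const _ 0)))

/-- Process the last three numbers of a gate's description, where `u` and `w` are the first two of
them. -/
def ladderStm (k n N u w : Γ → ℕ) : Stm Γ :=
  seqStm (fun γ inp => forStm (fun p inp => (inp, transferCode (k p.1) (n p.1) (N p.1)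
      (natAt p.2 inp) (ladderPos (k p.1) (n p.1) p.2) (ladderPos (k p.1) (n p.1) (p.2 + 1))))
      γ inp (u γ))
    (seqStm (fun γ inp => (inp, flipCode (k γ) (n γ) (N γ) (w γ) (ladderPos (k γ) (n γ) (u γ))))
      (seqStm (fun γ inp => forStm (fun p inp => (inp, transferCode (k p.1) (n p.1) (N p.1)
        (natAt (u p.1 - 1 - p.2) inp) (ladderPos (k p.1) (n p.1) (u p.1 - 1 - p.2))
        (ladderPos (k p.1) (n p.1) (u p.1 - 1 - p.2 + 1)))) γ inp (u γ))
        (fun γ inp => forStm (fun _ inp => (dropNat inp, [])) γ inp (u γ))))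

/-- Process the list of the `u` targets of a fanout gate with source `w`. -/
def fanoutStm (k n N u w : Γ → ℕ) : Stm Γ := fun γ inp =>
  forStm (fun p inp => seqStm (fun _ inp => (dropNat inp, []))
    (fun (p : (Γ × ℕ) × ℕ) inp => (inp, ladderCode (k p.1.1) (n p.1.1) (N p.1.1) 0 [w p.1.1] p.2))
    (p, natAt 0 inp) inp) γ inp (u γ)

/-- Process a gate's description, where `t`, `u` and `w` are its first three numbers and have been
removed from the input. -/
def dispatchStm (k n N t u w : Γ → ℕ) : Stm Γ := fun γ inp =>
  if t γ = 0 then (inp, rotateCode (k γ) (n γ) (N γ) (u γ) (w γ))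
  else if t γ - 1 = 0 then (inp, ladderCode (k γ) (n γ) (N γ) 0 [u γ] (w γ))
  else if t γ - 2 = 0 then ladderStm k n N u w γ inp
  else fanoutStm k n N u w γ inp

/-- Process a gate's description. -/
def gateStm (k n N : Γ → ℕ) : Stm Γ := fun γ inp =>
  seqStm (fun _ inp => (dropNat inp, [])) (fun (p : Γ × ℕ) inp =>
    (fun (p : (Γ × ℕ) × ℕ) inp =>
      (fun (p : ((Γ × ℕ) × ℕ) × ℕ) inp =>
        seqStm (fun _ inp => (dropNat inp, [])) (seqStm (fun _ inp => (dropNat inp, []))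
          (dispatchStm (fun p => k p.1.1.1) (fun p => n p.1.1.1) (fun p => N p.1.1.1)
            (fun p => p.1.1.2) (fun p => p.1.2) (fun p => p.2))) p inp) (p, natAt 1 inp) inp)
      (p, natAt 0 inp) inp) (γ, natAt 0 inp) inp

variable {t u w : Γ → ℕ}

theorem Realizable.ladderStm (hk : Evaluable vars k) (hn : Evaluable vars n)
    (hN : Evaluable vars N) (hu : Evaluable vars u) (hw : Evaluable vars w) :
    Realizable vars (WPQ.ladderStm k n N u w) := by
  refine Realizable.seq (Realizable.forStm hu ?_) (Realizable.seq
    (Writable.flipCode hk hn hN hw (hk.ladderPos hn hu)) (Realizable.seq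
      (Realizable.forStm hu ?_) (Realizable.forStm hu (Realizable.dropNat _))))
  · have h1 : Evaluable (extend (extend vars)) fun p =>
        WPQ.ladderPos (k p.1.1) (n p.1.1) p.1.2 :=
      hk.lift.lift.ladderPos hn.lift.lift Evaluable.snd.lift
    have h2 : Evaluable (extend (extend vars)) fun p =>
        WPQ.ladderPos (k p.1.1) (n p.1.1) (p.1.2 + 1) :=
      hk.lift.lift.ladderPos hn.lift.lift Evaluable.snd.lift.succ
    exact Realizable.natAt Evaluable.snd
      (Writable.transferCode hk.lift.lift hn.lift.lift hN.lift.lift Evaluable.snd h1 h2)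
  · have he : Evaluable (extend vars) fun p => u p.1 - 1 - p.2 := hu.pred.lift.sub Evaluable.snd
    have h1 : Evaluable (extend (extend vars)) fun p =>
        WPQ.ladderPos (k p.1.1) (n p.1.1) (u p.1.1 - 1 - p.1.2) :=
      hk.lift.lift.ladderPos hn.lift.lift he.lift
    have h2 : Evaluable (extend (extend vars)) fun p =>
        WPQ.ladderPos (k p.1.1) (n p.1.1) (u p.1.1 - 1 - p.1.2 + 1) :=
      hk.lift.lift.ladderPos hn.lift.lift he.lift.succ
    exact Realizable.natAt he
      (Writable.transferCode hk.lift.lift hn.lift.lift hN.lift.lift Evaluable.snd h1 h2)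

theorem Realizable.fanoutStm (hk : Evaluable vars k) (hn : Evaluable vars n)
    (hN : Evaluable vars N) (hu : Evaluable vars u) (hw : Evaluable vars w) :
    Realizable vars (WPQ.fanoutStm k n N u w) :=
  Realizable.forStm hu (Realizable.natAt (Evaluable.const _ 0)
    (Realizable.seq (Realizable.dropNat _) (Writable.ladderCode_singleton hk.lift.lift hn.lift.lift
      hN.lift.lift hw.lift.lift Evaluable.snd)))

theorem Realizable.dispatchStm (hk : Evaluable vars k) (hn : Evaluable vars n)
    (hN : Evaluable vars N) (ht : Evaluable vars t) (hu : Evaluable vars u)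
    (hw : Evaluable vars w) : Realizable vars (WPQ.dispatchStm k n N t u w) :=
  Realizable.ite ht (Writable.rotateCode hk hn hN hu hw) (Realizable.ite ht.pred
    (Writable.ladderCode_singleton hk hn hN hu hw) (Realizable.ite
      (ht.sub (Evaluable.const _ 2)) (Realizable.ladderStm hk hn hN hu hw)
      (Realizable.fanoutStm hk hn hN hu hw)))

theorem Realizable.gateStm (hk : Evaluable vars k) (hn : Evaluable vars n)
    (hN : Evaluable vars N) : Realizable vars (WPQ.gateStm k n N) :=
  Realizable.natAt (Evaluable.const _ 0) (Realizable.seq (Realizable.dropNat _)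
    (Realizable.natAt (Evaluable.const _ 0) (Realizable.natAt (Evaluable.const _ 1)
      (Realizable.seq (Realizable.dropNat _) (Realizable.seq (Realizable.dropNat _)
        (Realizable.dispatchStm hk.lift.lift.lift hn.lift.lift.lift hN.lift.lift.lift
          Evaluable.snd.lift.lift Evaluable.snd.lift Evaluable.snd))))))

/-- The first number is removed before anything else, and what follows never lengthens the input.
The input need not be a well-formed description. -/
theorem length_gateStm_lt (hk : Evaluable vars k) (hn : Evaluable vars n)
    (hN : Evaluable vars N) (γ : Γ) (inp : List Bool) (hi : inp ≠ []) :
    (gateStm k n N γ inp).1.length < inp.length := by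
  refine lt_of_le_of_lt ?_ (length_dropNat_lt hi)
  refine (Realizable.natAt (e := fun p : Γ × ℕ => 0) (Evaluable.const _ 0) (Realizable.natAt
    (Evaluable.const _ 1) (Realizable.seq (Realizable.dropNat _) (Realizable.seq
      (Realizable.dropNat _) (Realizable.dispatchStm hk.lift.lift.lift hn.lift.lift.lift
        hN.lift.lift.lift Evaluable.snd.lift.lift Evaluable.snd.lift
        Evaluable.snd))))).1 (γ, natAt 0 inp) (dropNat inp)

/-- Process an instance with the parameters `k` and `n`, `m` witness qubits, and `N` qubits. -/
def bodyStm (k n m N out : Γ → ℕ) : Stm Γ :=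
  seqStm (fun γ inp => (inp, [k γ, k γ * (2 * n γ), k γ + N γ + 3, outPos (k γ) (n γ)] ++
      ancillaCode (k γ) (N γ) ++ checkCode (k γ) (n γ) (m γ)))
    (seqStm (fun γ inp => whileStm (gateStm k n N) γ inp.length inp)
      (fun γ inp => (inp, transferCode (k γ) (n γ) (N γ) (out γ) (legalPos (k γ) (n γ) (k γ))
        (outPos (k γ) (n γ)))))

theorem Realizable.bodyStm (hk : Evaluable vars k) (hn : Evaluable vars n)
    (hm : Evaluable vars m) (hN : Evaluable vars N) (hout : Evaluable vars out) :
    Realizable vars (WPQ.bodyStm k n m N out) := by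
  refine Realizable.seq (Writable.append (Writable.append (Writable.cons hk (Writable.cons
    (hk.mul ((Evaluable.const _ 2).mul hn)) (Writable.cons ((hk.add hN).add (Evaluable.const _ 3))
      (Writable.cons (hk.outPos hn) (Writable.nil _))))) (Writable.ancillaCode hk hN))
      (Writable.checkCode hk hn hm)) (Realizable.seq (Realizable.whileStm
        (Realizable.gateStm hk hn hN) fun γ inp => length_gateStm_lt hk hn hN γ inp)
        (Writable.transferCode hk hn hN hout (hk.legalPos hn hk) (hk.outPos hn)))

/-- Process an instance. -/
def mainStm : Stm Unit := fun γ inp =>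
  (fun (γ : Unit × ℕ) inp => (fun (γ : (Unit × ℕ) × ℕ) inp => (fun (γ : ((Unit × ℕ) × ℕ) × ℕ) inp =>
    (fun (γ : (((Unit × ℕ) × ℕ) × ℕ) × ℕ) inp => (fun (γ : ((((Unit × ℕ) × ℕ) × ℕ) × ℕ) × ℕ) inp =>
      seqStm (fun γ inp => forStm (fun _ inp => (dropNat inp, [])) γ inp 5)
        (bodyStm (fun γ => γ.1.1.1.1.2) (fun γ => γ.1.1.1.2) (fun γ => γ.1.1.2)
          (fun γ => γ.1.1.2 + γ.1.2) (fun γ => γ.2)) γ inp)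
      (γ, natAt 4 inp) inp) (γ, natAt 3 inp) inp) (γ, natAt 2 inp) inp) (γ, natAt 1 inp) inp)
    (γ, natAt 0 inp) inp

theorem realizable_mainStm : Realizable [] mainStm :=
  Realizable.natAt (Evaluable.const _ 0) (Realizable.natAt (Evaluable.const _ 1)
    (Realizable.natAt (Evaluable.const _ 2) (Realizable.natAt (Evaluable.const _ 3)
      (Realizable.natAt (Evaluable.const _ 4) (Realizable.seq
        (Realizable.forStm (Evaluable.const _ 5) (Realizable.dropNat _))
        (Realizable.bodyStm Evaluable.snd.lift.lift.lift.lift Evaluable.snd.lift.lift.lift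
          Evaluable.snd.lift.lift (Evaluable.snd.lift.lift.add Evaluable.snd.lift)
          Evaluable.snd))))))

end Program

end WPQ

namespace WPQ

/-! ### Correctness of the program -/

section ProgramCorrectness

variable {Γ : Type} {k n m N u w t out : Γ → ℕ} {g : ℕ}

theorem forStm_dropNat (γ : Γ) (inp : List Bool) (i : ℕ) :
    forStm (fun (_ : Γ × ℕ) inp => (dropNat inp, [])) γ inp i = (dropNat^[i] inp, []) := by
  induction i with
  | zero => rfl
  | succ i ih => rw [forStm, ih, Function.iterate_succ_apply']; rfl

/-- Both passes over the controls use random access; the controls are removed from the input only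
afterwards. -/
theorem ladderStm_encodeNats (γ : Γ) (cs l : List ℕ) (hu : u γ = cs.length) :
    ladderStm k n N u w γ (encodeNats (cs ++ l)) =
      (encodeNats l, ladderCode (k γ) (n γ) (N γ) 0 cs (w γ)) := by
  have h1 := forStm_of_read_only (fun (p : Γ × ℕ) inp => transferCode (k p.1) (n p.1) (N p.1)
      (natAt p.2 inp) (ladderPos (k p.1) (n p.1) p.2) (ladderPos (k p.1) (n p.1) (p.2 + 1))) γ
      (encodeNats (cs ++ l)) (u γ)
  have h2 := forStm_of_read_only (fun (p : Γ × ℕ) inp => transferCode (k p.1) (n p.1) (N p.1)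
        (natAt (u p.1 - 1 - p.2) inp) (ladderPos (k p.1) (n p.1) (u p.1 - 1 - p.2))
        (ladderPos (k p.1) (n p.1) (u p.1 - 1 - p.2 + 1))) γ (encodeNats (cs ++ l)) (u γ)
  simp only [ladderStm, seqStm, h1, h2, forStm_dropNat, List.append_nil]
  rw [hu, iterate_dropNat_encodeNats, ladderCode_eq]
  simp only [zero_add]
  congr 2
  · refine List.flatMap_congr fun j hj => ?_
    have hj := List.mem_range.1 hj
    rw [natAt_encodeNats j cs l hj, List.getD_eq_getElem _ _ hj]
  · congr 1
    refine List.flatMap_congr fun j hj => ?_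
    have hj := List.mem_range.1 hj
    have hj' : cs.length - 1 - j < cs.length := by omega
    rw [natAt_encodeNats _ cs l hj', List.getD_eq_getElem _ _ hj']

theorem fanoutStm_encodeNats (γ : Γ) (ts l : List ℕ) (hu : u γ = ts.length) :
    fanoutStm k n N u w γ (encodeNats (ts ++ l)) =
      (encodeNats l, ts.flatMap fun t => ladderCode (k γ) (n γ) (N γ) 0 [w γ] t) := by
  rw [fanoutStm, hu]
  have key : ∀ i, i ≤ ts.length → forStm (fun p inp => seqStm (fun _ inp => (dropNat inp, []))
      (fun (p : (Γ × ℕ) × ℕ) inp =>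
        (inp, ladderCode (k p.1.1) (n p.1.1) (N p.1.1) 0 [w p.1.1] p.2))
      (p, natAt 0 inp) inp) γ (encodeNats (ts ++ l)) i = (encodeNats (ts.drop i ++ l),
        (ts.take i).flatMap fun t => ladderCode (k γ) (n γ) (N γ) 0 [w γ] t) := by
    intro i
    induction i with
    | zero => intro _; rfl
    | succ i ih =>
      intro hi
      rw [forStm, ih (by omega)]
      have e : ts.drop i = ts[i] :: ts.drop (i + 1) := List.drop_eq_getElem_cons (by omega)
      have e' : ts.take (i + 1) = ts.take i ++ [ts[i]] := by
        rw [List.take_succ_eq_append_getElem (by omega)]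
      simp only [e, e', seqStm, List.cons_append, dropNat_encodeNats_cons,
        natAt_zero_encodeNats_cons, List.nil_append, List.flatMap_append, List.flatMap_cons,
        List.flatMap_nil, List.append_nil]
  simpa using key ts.length le_rfl

theorem gateStm_encodeNats {K : ℕ} (γ : Γ) (hN : N γ = K) (G : Gate g K) (l : List ℕ) :
    gateStm k n N γ (encodeNats (G.code ++ l)) =
      (encodeNats l, gateCode (k γ) (n γ) K G) := by
  subst hN
  cases G with
  | one i q => simp [gateStm, seqStm, Gate.code, dispatchStm, gateCode]
  | cnot s t => simp [gateStm, seqStm, Gate.code, dispatchStm, gateCode]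
  | toffoli cs t =>
    have h := ladderStm_encodeNats (k := fun p : ((Γ × ℕ) × ℕ) × ℕ => k p.1.1.1)
      (n := fun p => n p.1.1.1) (N := fun p => N p.1.1.1) (u := fun p => p.1.2) (w := fun p => p.2)
      (((γ, 2), cs.length), t.val) (cs.map Fin.val) l (by simp)
    simp [gateStm, seqStm, Gate.code, dispatchStm, gateCode, h]
  | fanout s ts =>
    have h := fanoutStm_encodeNats (k := fun p : ((Γ × ℕ) × ℕ) × ℕ => k p.1.1.1)
      (n := fun p => n p.1.1.1) (N := fun p => N p.1.1.1) (u := fun p => p.1.2) (w := fun p => p.2)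
      (((γ, 3), ts.length), s.val) (ts.map Fin.val) l (by simp)
    simp [gateStm, seqStm, Gate.code, dispatchStm, gateCode, h]

theorem encodeNats_code_append_ne_nil {K : ℕ} (G : Gate g K) (l : List ℕ) :
    encodeNats (G.code ++ l) ≠ [] := by
  cases G <;> simp [Gate.code, encodeNats_cons]

theorem whileStm_gateStm {K : ℕ} (γ : Γ) (hN : N γ = K) (C : List (Gate g K)) (i : ℕ)
    (hi : C.length ≤ i) : whileStm (gateStm k n N) γ i (encodeNats (C.flatMap Gate.code)) =
      ([], C.flatMap (gateCode (k γ) (n γ) K)) := by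
  induction C generalizing i with
  | nil => cases i <;> simp [whileStm, encodeNats]
  | cons G C ih =>
    cases i with
    | zero => simp at hi
    | succ i =>
      rw [List.flatMap_cons, whileStm, if_neg (encodeNats_code_append_ne_nil G _),
        gateStm_encodeNats γ hN, ih i (by simpa using hi), List.flatMap_cons]

/-- Every gate contributes at least one symbol, so the length of the string is enough rounds for the
while-statement to treat all gates. -/
theorem length_le_length_encodeNats {K : ℕ} (C : List (Gate g K)) :
    C.length ≤ (encodeNats (C.flatMap Gate.code)).length := by
  induction C with
  | nil => simp
  | cons G C ih =>
    rw [List.flatMap_cons, encodeNats_append, List.length_append, List.length_cons]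
    have : 0 < (encodeNats G.code).length := by
      cases G <;> simp [Gate.code, encodeNats_cons]
    omega

theorem stmMap_mainStm (I : MiniInstance g) : stmMap mainStm I.code =
    encodeNats (instanceCode I.k I.n I.m (I.m + I.a) I.out
      (I.circuit.flatMap (gateCode I.k I.n (I.m + I.a)))) := by
  have h := whileStm_gateStm (k := fun γ : ((((Unit × ℕ) × ℕ) × ℕ) × ℕ) × ℕ => γ.1.1.1.1.2)
    (n := fun γ => γ.1.1.1.2) (N := fun γ => γ.1.1.2 + γ.1.2)
    ((((((), I.k), I.n), I.m), I.a), I.out.val) rfl I.circuit _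
    (length_le_length_encodeNats I.circuit)
  rw [stmMap, MiniInstance.code]
  congr 1
  have e1 : natAt 2 (encodeNats (I.k :: I.n :: I.m :: I.a :: I.out.val ::
    I.circuit.flatMap Gate.code)) = I.m := by simp [natAt]
  have e2 : natAt 3 (encodeNats (I.k :: I.n :: I.m :: I.a :: I.out.val ::
    I.circuit.flatMap Gate.code)) = I.a := by simp [natAt]
  have e3 : natAt 4 (encodeNats (I.k :: I.n :: I.m :: I.a :: I.out.val ::
    I.circuit.flatMap Gate.code)) = I.out := by simp [natAt]
  have e4 : natAt 1 (encodeNats (I.k :: I.n :: I.m :: I.a :: I.out.val ::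
    I.circuit.flatMap Gate.code)) = I.n := by simp [natAt]
  have e5 : dropNat^[5] (encodeNats (I.k :: I.n :: I.m :: I.a :: I.out.val ::
    I.circuit.flatMap Gate.code)) = encodeNats (I.circuit.flatMap Gate.code) := by simp
  simp only [List.cons_append, List.nil_append, mainStm, seqStm, forStm_dropNat, bodyStm, e1, e2,
    e3, e4, e5, natAt_zero_encodeNats_cons, h, instanceCode]

/-- Needed for arbitrary strings, since a reduction must control the parameter off the promise as
well. The first number written is the first number read. -/
theorem firstNat_stmMap_mainStm (y : List Bool) : firstNat (stmMap mainStm y) = firstNat y := by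
  have e : ∃ l, (mainStm () y).2 = natAt 0 y :: l := ⟨_, rfl⟩
  obtain ⟨l, hl⟩ := e
  rw [stmMap, hl, firstNat_encodeNats_cons]
  rfl

end ProgramCorrectness

end WPQ

namespace WPQ

/-! ### The weight-preserving circuit -/

/-- The circuits below are correct if every block has enough values. -/
structure Fits (k n N : ℕ) : Prop where
  pos_k : 0 < k
  two_pow_le : 2 ^ ((N + k - 1) / k) ≤ 2 * n

/-- Qubit `i` of the weight-preserving circuit. -/
def wire (k n N i : ℕ) : Fin (k * (2 * n) + (k + N + 3)) :=
  ⟨i % (k * (2 * n) + (k + N + 3)), Nat.mod_lt _ (by omega)⟩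

/-- The remainder in `wire` only makes it total; all positions in use are in range. -/
theorem val_wire {k n N i : ℕ} (h : i < k * (2 * n) + (k + N + 3)) : (wire k n N i).val = i :=
  Nat.mod_eq_of_lt h

theorem wire_ne {k n N i j : ℕ} (hi : i < k * (2 * n) + (k + N + 3))
    (hj : j < k * (2 * n) + (k + N + 3)) (h : i ≠ j) : wire k n N i ≠ wire k n N j := by
  intro e
  have := congrArg Fin.val e
  rw [val_wire hi, val_wire hj] at this
  exact h this

/-- The weight-preserving gates on the qubits of the transformed circuit. -/
abbrev BlockGate (g k n N : ℕ) : Type := WPGate g (k * (2 * n) + (k + N + 3))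

section Circuits

variable (g k n N : ℕ)

/-- Swap the qubits `s` and `d` if qubit `q` is `1`. -/
def transferGates (q s d : ℕ) : List (BlockGate g k n N) :=
  (onePositions k n N q).map fun i =>
    WPGate.fredkin (wire k n N i) (wire k n N s) (wire k n N d)

/-- Flip qubit `q` if the ancilla `c` is `1`. -/
def flipGates (q c : ℕ) : List (BlockGate g k n N) :=
  (zeroPositions k n N q).map fun i => WPGate.fredkin (wire k n N c) (wire k n N i)
    (wire k n N (i + placeValue k n q))

variable {g} in
/-- Apply the one-qubit gate `i` to qubit `q`. -/
def rotateGates (i : Fin g) (q : ℕ) : List (BlockGate g k n N) :=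
  (zeroPositions k n N q).map fun p => WPGate.hat i
    (wire k n N (p + placeValue k n q)) (wire k n N p)

/-- Check that block `b` is legal and represents `0` beyond the first `m` qubits. -/
def checkBlockGates (m b : ℕ) : List (BlockGate g k n N) :=
  (List.range (numValues k n (m - b))).map fun v =>
    WPGate.fredkin (wire k n N (b * (2 * n) + v)) (wire k n N (legalPos k n b))
      (wire k n N (legalPos k n (b + 1)))

/-- Check that the first `B` blocks are legal and represent `0` beyond the first `m` qubits. -/
def checkGates (m B : ℕ) : List (BlockGate g k n N) :=
  (List.range B).flatMap (checkBlockGates g k n N m)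

/-- Flip qubit `t` if the token is at the ladder position `i` and all of `cs` are `1`. -/
def ladderGates : ℕ → List ℕ → ℕ → List (BlockGate g k n N)
  | i, [], t => flipGates g k n N t (ladderPos k n i)
  | i, c :: cs, t => transferGates g k n N c (ladderPos k n i) (ladderPos k n (i + 1)) ++
      ladderGates (i + 1) cs t ++
      transferGates g k n N c (ladderPos k n i) (ladderPos k n (i + 1))

variable {g N} in
/-- The gates that replace a gate. -/
def blockGates : Gate g N → List (BlockGate g k n N)
  | Gate.one i q => rotateGates k n N i q
  | Gate.cnot s t => ladderGates g k n N 0 [s.val] t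
  | Gate.toffoli cs t => ladderGates g k n N 0 (cs.map Fin.val) t
  | Gate.fanout s ts => (ts.map Fin.val).flatMap fun t => ladderGates g k n N 0 [s.val] t

variable {g N} in
/-- The transformed circuit. -/
def blockCircuit (m out : ℕ) (C : List (Gate g N)) : List (BlockGate g k n N) :=
  checkGates g k n N m k ++ (C.flatMap (blockGates k n) ++
    transferGates g k n N out (legalPos k n k) (outPos k n))

end Circuits

/-- The transformed instance. -/
def MiniInstance.toWP {g : ℕ} (I : MiniInstance g) : WPInstance g where
  k := I.k
  n := I.k * (2 * I.n)
  a := I.k + (I.m + I.a) + 3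
  out := wire I.k I.n (I.m + I.a) (outPos I.k I.n)
  anc := fun i => decide (i.val = 0 ∨ i.val = I.k + 2)
  circuit := blockCircuit I.k I.n I.m I.out I.circuit

/-! ### Arithmetic of positions -/

section Positions

variable {k n N q v b i j : ℕ}

theorem Fits.le_mul (h : Fits k n N) : N ≤ k * ((N + k - 1) / k) := by
  have h1 := Nat.div_add_mod (N + k - 1) k
  have h2 := Nat.mod_lt (N + k - 1) h.pos_k
  have := h.pos_k
  omega

theorem Fits.div_lt (h : Fits k n N) (hq : q < N) : q / k < (N + k - 1) / k :=
  (Nat.div_lt_iff_lt_mul h.pos_k).2 (by rw [mul_comm]; exact hq.trans_le h.le_mul)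

theorem Fits.placeValue_eq (h : Fits k n N) (hq : q < N) : placeValue k n q = 2 ^ (q / k) :=
  min_eq_left ((Nat.pow_le_pow_right (by omega) (h.div_lt hq).le).trans h.two_pow_le)

/-- The truncation that kept the computation polynomial has no effect when blocks fit. -/
theorem Fits.numValues_eq (h : Fits k n N) {m : ℕ} (hm : m ≤ N) :
    numValues k n m = 2 ^ ((m + k - 1) / k) := by
  refine min_eq_left ((Nat.pow_le_pow_right (by omega) ?_).trans h.two_pow_le)
  exact Nat.div_le_div_right (by omega)

theorem div_two_pow_mod_two : v / 2 ^ j % 2 = 0 ↔ v.testBit j = false := by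
  rw [Nat.testBit_eq_decide_div_mod_eq]
  simp

/-- Adding `2 ^ j` to a number whose bit `j` is 0 causes no carry. -/
theorem testBit_add_two_pow (hv : v.testBit j = false) (i : ℕ) :
    (v + 2 ^ j).testBit i = if i = j then true else v.testBit i := by
  rcases lt_trichotomy i j with h | h | h
  · rw [if_neg h.ne, add_comm, Nat.testBit_two_pow_add_gt h]
  · rw [if_pos h, h, add_comm, Nat.testBit_two_pow_add_eq, hv]
    rfl
  · rw [if_neg h.ne']
    obtain ⟨i, rfl⟩ := Nat.exists_eq_add_of_lt h
    have h1 : v % 2 ^ (j + 1) < 2 ^ j := by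
      have := div_two_pow_mod_two.2 hv
      rw [pow_succ, Nat.mod_mul, this]
      simpa using Nat.mod_lt v (Nat.two_pow_pos j)
    have h2 : (v + 2 ^ j) / 2 ^ (j + 1) = v / 2 ^ (j + 1) := by
      have e := Nat.div_add_mod v (2 ^ (j + 1))
      have e2 : 2 ^ (j + 1) = 2 * 2 ^ j := by rw [pow_succ]; ring
      rw [Nat.div_eq_iff (by positivity)]
      rw [mul_comm] at e
      constructor
      · omega
      · have : 0 < 2 ^ j := by positivity
        omega
    have e3 : j + i + 1 = i + (j + 1) := by omega
    rw [e3, ← Nat.testBit_div_two_pow, h2, Nat.testBit_div_two_pow]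

theorem add_two_pow_lt {J : ℕ} (hv : v.testBit j = false) (hlt : v < 2 ^ J) (hj : j < J) :
    v + 2 ^ j < 2 ^ J := by
  refine Nat.lt_pow_two_of_testBit _ fun i hi => ?_
  rw [testBit_add_two_pow hv, if_neg (by omega)]
  exact Nat.testBit_lt_two_pow (hlt.trans_le (Nat.pow_le_pow_right (by omega) hi))

theorem Fits.onePositions_eq (h : Fits k n N) (hq : q < N) : onePositions k n N q =
    ((List.range (2 ^ ((N + k - 1) / k))).filter fun v => v.testBit (q / k)).map
      fun v => q % k * (2 * n) + v := by
  rw [onePositions, h.numValues_eq le_rfl, h.placeValue_eq hq]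
  induction List.range (2 ^ ((N + k - 1) / k)) with
  | nil => rfl
  | cons v l ih =>
    rw [List.flatMap_cons, ih]
    by_cases hv : v.testBit (q / k) = true
    · have : ¬ v / 2 ^ (q / k) % 2 = 0 := by rw [div_two_pow_mod_two, hv]; simp
      simp [hv, this]
    · have : v / 2 ^ (q / k) % 2 = 0 := by rw [div_two_pow_mod_two]; simpa using hv
      simp [hv, this]

theorem Fits.zeroPositions_eq (h : Fits k n N) (hq : q < N) : zeroPositions k n N q =
    ((List.range (2 ^ ((N + k - 1) / k))).filter fun v => !v.testBit (q / k)).map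
      fun v => q % k * (2 * n) + v := by
  rw [zeroPositions, h.numValues_eq le_rfl, h.placeValue_eq hq]
  induction List.range (2 ^ ((N + k - 1) / k)) with
  | nil => rfl
  | cons v l ih =>
    rw [List.flatMap_cons, ih]
    by_cases hv : v.testBit (q / k) = true
    · have : ¬ v / 2 ^ (q / k) % 2 = 0 := by rw [div_two_pow_mod_two, hv]; simp
      simp [hv, this]
    · have : v / 2 ^ (q / k) % 2 = 0 := by rw [div_two_pow_mod_two]; simpa using hv
      simp [hv, this]

theorem position_lt (hb : b < k) (hv : v < 2 * n) : b * (2 * n) + v < k * (2 * n) := by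
  have : (b + 1) * (2 * n) ≤ k * (2 * n) := Nat.mul_le_mul_right _ hb
  rw [Nat.succ_mul] at this
  omega

theorem Fits.lt_of_mem_onePositions (h : Fits k n N) (hq : q < N)
    (hi : i ∈ onePositions k n N q) : i < k * (2 * n) := by
  rw [h.onePositions_eq hq] at hi
  simp only [List.mem_map, List.mem_filter, List.mem_range] at hi
  obtain ⟨v, ⟨hv, -⟩, rfl⟩ := hi
  exact position_lt (Nat.mod_lt _ h.pos_k) (hv.trans_le h.two_pow_le)

theorem Fits.lt_of_mem_zeroPositions (h : Fits k n N) (hq : q < N)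
    (hi : i ∈ zeroPositions k n N q) :
    i < k * (2 * n) ∧ i + placeValue k n q < k * (2 * n) := by
  rw [h.zeroPositions_eq hq] at hi
  simp only [List.mem_map, List.mem_filter, List.mem_range, Bool.not_eq_true'] at hi
  obtain ⟨v, ⟨hv, hv'⟩, rfl⟩ := hi
  rw [h.placeValue_eq hq, add_assoc]
  exact ⟨position_lt (Nat.mod_lt _ h.pos_k) (hv.trans_le h.two_pow_le),
    position_lt (Nat.mod_lt _ h.pos_k) ((add_two_pow_lt hv' hv (h.div_lt hq)).trans_le
      h.two_pow_le)⟩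

end Positions

/-! ### Descriptions of the circuits -/

section Codes

variable {g k n N : ℕ}

theorem Fits.transferGates_code (h : Fits k n N) {q s d : ℕ} (hq : q < N)
    (hs : s < k * (2 * n) + (k + N + 3)) (hd : d < k * (2 * n) + (k + N + 3)) :
    (transferGates g k n N q s d).flatMap WPGate.code = transferCode k n N q s d := by
  rw [transferGates, List.flatMap_map, transferCode]
  refine List.flatMap_congr fun i hi => ?_
  have := h.lt_of_mem_onePositions hq hi
  simp only [WPGate.code]
  rw [val_wire hs, val_wire hd, val_wire (by omega)]

theorem Fits.flipGates_code (h : Fits k n N) {q c : ℕ} (hq : q < N)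
    (hc : c < k * (2 * n) + (k + N + 3)) :
    (flipGates g k n N q c).flatMap WPGate.code = flipCode k n N q c := by
  rw [flipGates, List.flatMap_map, flipCode]
  refine List.flatMap_congr fun i hi => ?_
  have := h.lt_of_mem_zeroPositions hq hi
  simp only [WPGate.code]
  rw [val_wire hc, val_wire (by omega), val_wire (by omega)]

theorem Fits.rotateGates_code (h : Fits k n N) {q : ℕ} (i : Fin g) (hq : q < N) :
    (rotateGates k n N i q).flatMap WPGate.code = rotateCode k n N i q := by
  rw [rotateGates, List.flatMap_map, rotateCode]
  refine List.flatMap_congr fun i hi => ?_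
  have := h.lt_of_mem_zeroPositions hq hi
  simp only [WPGate.code]
  rw [val_wire (by omega), val_wire (by omega)]

theorem checkGates_code (m : ℕ) :
    (checkGates g k n N m k).flatMap WPGate.code = checkCode k n m := by
  rw [checkGates, List.flatMap_assoc, checkCode]
  refine List.flatMap_congr fun b hb => ?_
  rw [checkBlockGates, List.flatMap_map]
  refine List.flatMap_congr fun v hv => ?_
  have hb := List.mem_range.1 hb
  have := position_lt hb ((List.mem_range.1 hv).trans_le (min_le_right _ _))
  simp only [WPGate.code, legalPos]
  rw [val_wire (by omega), val_wire (by omega), val_wire (by omega)]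

theorem Fits.ladderGates_code (h : Fits k n N) {t i : ℕ} {cs : List ℕ} (hcs : ∀ c ∈ cs, c < N)
    (ht : t < N) (hi : i + cs.length ≤ N) :
    (ladderGates g k n N i cs t).flatMap WPGate.code = ladderCode k n N i cs t := by
  induction cs generalizing i with
  | nil =>
    rw [ladderGates, ladderCode, h.flipGates_code ht]
    simp only [List.length_nil] at hi
    simp only [ladderPos]
    omega
  | cons c cs ih =>
    simp only [List.length_cons] at hi
    rw [ladderGates, ladderCode, List.flatMap_append, List.flatMap_append,
      ih (fun c hc => hcs c (List.mem_cons_of_mem _ hc)) (by omega),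
      h.transferGates_code (hcs c (List.mem_cons_self ..))]
    all_goals simp only [ladderPos]; omega

/-- The controls and the target are distinct qubits. Hence the N + 1 rungs of the ladder suffice for
every generalised Toffoli gate. -/
theorem Gate.WF.length_lt {cs : List (Fin N)} {t : Fin N}
    (hG : (Gate.toffoli cs t : Gate g N).WF) : cs.length < N := by
  have := List.Nodup.length_le_card hG
  simp [Gate.wires, Gate.controls, Gate.targets] at this
  omega

theorem Fits.blockGates_code (h : Fits k n N) (G : Gate g N) (hG : G.WF) :
    (blockGates k n G).flatMap WPGate.code = gateCode k n N G := by
  cases G with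
  | one i q => exact h.rotateGates_code i q.2
  | cnot s t =>
    refine h.ladderGates_code (by simp) t.2 ?_
    have := s.2
    simp
    omega
  | toffoli cs t =>
    have := hG.length_lt
    exact h.ladderGates_code (by simp) t.2 (by simp; omega)
  | fanout s ts =>
    rw [blockGates, gateCode, List.flatMap_assoc]
    refine List.flatMap_congr fun t ht => ?_
    obtain ⟨t, -, rfl⟩ := List.mem_map.1 ht
    have := s.2
    exact h.ladderGates_code (by simp) t.2 (by simp; omega)

theorem MiniInstance.toWP_code (I : MiniInstance g) (h : Fits I.k I.n (I.m + I.a))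
    (hwf : ∀ G ∈ I.circuit, G.WF) : I.toWP.code = encodeNats (instanceCode I.k I.n I.m (I.m + I.a)
      I.out (I.circuit.flatMap (gateCode I.k I.n (I.m + I.a)))) := by
  have e1 : (List.ofFn I.toWP.anc).map Bool.toNat = ancillaCode I.k (I.m + I.a) := by
    have : ancillaCode I.k (I.m + I.a) = (List.range (I.k + (I.m + I.a) + 3)).map
        fun i => (decide (i = 0 ∨ i = I.k + 2)).toNat := by
      rw [ancillaCode, List.map_eq_flatMap]
      refine List.flatMap_congr fun i _ => ?_
      -- The product in `ancillaCode` vanishes exactly at these two indices, its second factor being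
      -- the distance from `i` to `k + 2`. They are the starting positions of the legality token and
      -- of the ladder token.
      by_cases hi : i = 0 ∨ i = I.k + 2
      · have : i * (i - (I.k + 2) + (I.k + 2 - i)) = 0 := by
          rcases hi with rfl | rfl <;> simp
        simp only [this, hi]
        rfl
      · have : ¬ i * (i - (I.k + 2) + (I.k + 2 - i)) = 0 := by
          rw [Nat.mul_eq_zero]
          omega
        simp only [this, hi]
        rfl
    rw [this]
    apply List.ext_getElem
    · simp [MiniInstance.toWP]
    · intro i h1 h2
      simp only [List.getElem_map, List.getElem_ofFn, List.getElem_range, MiniInstance.toWP]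
  have e2 : I.toWP.circuit.flatMap WPGate.code = checkCode I.k I.n I.m ++
      (I.circuit.flatMap (gateCode I.k I.n (I.m + I.a)) ++
        transferCode I.k I.n (I.m + I.a) I.out (legalPos I.k I.n I.k) (outPos I.k I.n)) := by
    simp only [MiniInstance.toWP, blockCircuit, List.flatMap_append, checkGates_code]
    rw [h.transferGates_code I.out.2 (by simp only [legalPos]; omega)
      (by simp only [outPos]; omega), List.flatMap_assoc]
    congr 2
    exact List.flatMap_congr fun G hG => h.blockGates_code G (hwf G hG)
  rw [WPInstance.code, e1, e2, instanceCode]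
  have e3 : I.toWP.out.val = outPos I.k I.n := val_wire (by simp only [outPos]; omega)
  rw [e3]
  simp only [MiniInstance.toWP, List.append_assoc]

end Codes

end WPQ

namespace WPQ

/-! ### Weight-preserving circuits -/

section Operators

variable {g N : ℕ} (U : Fin g → Matrix Bool Bool ℂ) (δ : ℝ)

theorem wpCircuitOp_append (C D : List (WPGate g N)) :
    wpCircuitOp U δ (C ++ D) = wpCircuitOp U δ D * wpCircuitOp U δ C := by
  induction C with
  | nil => simp [wpCircuitOp]
  | cons G C ih => rw [List.cons_append, wpCircuitOp, ih, wpCircuitOp, Matrix.mul_assoc]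

theorem basisMap_mulVec_single (φ : Bits N → Bits N) (x : Bits N) :
    (basisMap φ).mulVec (Pi.single x 1) = Pi.single (φ x) 1 := by
  funext y
  simp [basisMap, Pi.single_apply]

/-- A non-zero entry of a product of matrices comes from a path of non-zero entries. So a reflexive
and transitive relation respected by every gate is respected by the circuit. Both the preservation
of weight and the rejection of illegal witnesses are obtained in this way. -/
theorem wpCircuitOp_ne_zero {P : Bits N → Bits N → Prop} (hrefl : ∀ x, P x x)
    (htrans : ∀ x y z, P x y → P y z → P x z) {C : List (WPGate g N)}
    (hC : ∀ G ∈ C, ∀ x y, G.op U δ x y ≠ 0 → P x y) {x y : Bits N}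
    (h : wpCircuitOp U δ C x y ≠ 0) : P x y := by
  induction C generalizing x y with
  | nil =>
    rw [wpCircuitOp, Matrix.one_apply] at h
    split_ifs at h with e
    · exact e ▸ hrefl x
    · exact absurd rfl h
  | cons G C ih =>
    rw [wpCircuitOp, Matrix.mul_apply] at h
    obtain ⟨z, -, hz⟩ := Finset.exists_ne_zero_of_sum_ne_zero h
    exact htrans x z y (ih (fun G hG => hC G (List.mem_cons_of_mem _ hG)) (left_ne_zero_of_mul hz))
      (hC G (List.mem_cons_self ..) z y (right_ne_zero_of_mul hz))

theorem weight_comp_swap (x : Bits N) (p q : Fin N) : weight (x ∘ Equiv.swap p q) = weight x := by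
  refine Finset.card_bij (fun i _ => Equiv.swap p q i) ?_ ?_ ?_
  · intro i hi
    simpa using hi
  · intro i _ j _ h
    exact (Equiv.swap p q).injective h
  · intro i hi
    exact ⟨Equiv.swap p q i, by simpa using hi, by simp⟩

theorem WPGate.weight_eq_of_op_ne_zero (G : WPGate g N) (hG : G.WF) {x y : Bits N}
    (h : G.op U δ x y ≠ 0) : weight x = weight y := by
  cases G with
  | hat i p q =>
    have hpq : p ≠ q := by simpa [WPGate.WF, WPGate.wires] using hG
    simp only [WPGate.op, hatOp] at h
    split_ifs at h with e
    · simp only [hatMatrix] at h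
      split_ifs at h with h1 h2
      -- Both restrictions to the pair are 01 or 10, so the two states agree on it or differ by the
      -- swap.
      · by_cases h3 : x p = y p
        · congr 1
          funext j
          rcases eq_or_ne j p with rfl | hp
          · exact h3
          · rcases eq_or_ne j q with rfl | hq
            · revert h1 h3
              cases x p <;> cases y p <;> cases x j <;> cases y j <;> simp
            · exact e j hp hq
        · have : x = y ∘ Equiv.swap p q := by
            funext j
            rcases eq_or_ne j p with rfl | hp
            · rw [Function.comp_apply, Equiv.swap_apply_left]
              revert h1 h3
              cases x j <;> cases y j <;> cases x q <;> cases y q <;> simp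
            · rcases eq_or_ne j q with rfl | hq
              · rw [Function.comp_apply, Equiv.swap_apply_right]
                revert h1 h3
                cases x p <;> cases y p <;> cases x j <;> cases y j <;> simp
              · rw [Function.comp_apply, Equiv.swap_apply_of_ne_of_ne hp hq, e j hp hq]
          rw [this, weight_comp_swap]
      · congr 1
        funext j
        simp only [Prod.mk.injEq] at h2
        rcases eq_or_ne j p with rfl | hp
        · exact h2.1
        · rcases eq_or_ne j q with rfl | hq
          · exact h2.2
          · exact e j hp hq
      · exact absurd rfl h
    · exact absurd rfl h
  | fredkin s p q =>
    simp only [WPGate.op, basisMap] at h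
    split_ifs at h with h1 h2 h3
    · rw [h2, weight_comp_swap]
    · exact absurd rfl h
    · rw [h3]
    · exact absurd rfl h
  | phase q =>
    simp only [WPGate.op, oneQubit, phaseMatrix] at h
    split_ifs at h with h1
    · congr 1
      funext j
      rcases eq_or_ne j q with rfl | hj
      · by_contra h2
        exact h (Matrix.diagonal_apply_ne _ h2)
      · exact h1 j hj
    · exact absurd rfl h

theorem weightPreserving_wpCircuitOp {C : List (WPGate g N)} (hC : ∀ G ∈ C, G.WF) :
    WeightPreserving (wpCircuitOp U δ C) := by
  intro k x hx y hy
  rw [Matrix.mulVec_single_one, Matrix.col_apply]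
  by_contra h
  refine hy ?_
  rw [← hx]
  exact wpCircuitOp_ne_zero U δ (P := fun x y => weight x = weight y) (fun _ => rfl)
    (fun _ _ _ => Eq.trans) (fun G hG x y h => G.weight_eq_of_op_ne_zero U δ (hC G hG) h) h

theorem WPGate.apply_eq_of_op_ne_zero (G : WPGate g N) {x y : Bits N}
    (h : G.op U δ x y ≠ 0) {j : Fin N} (hj : j ∉ G.wires) : x j = y j := by
  cases G with
  | hat i p q =>
    simp only [WPGate.wires, List.mem_cons, List.not_mem_nil, or_false, not_or] at hj
    simp only [WPGate.op, hatOp] at h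
    split_ifs at h with e
    · exact e j hj.1 hj.2
    · exact absurd rfl h
  | fredkin s p q =>
    simp only [WPGate.wires, List.mem_cons, List.not_mem_nil, or_false, not_or] at hj
    simp only [WPGate.op, basisMap] at h
    split_ifs at h with h1 h2 h3
    · rw [h2, Function.comp_apply, Equiv.swap_apply_of_ne_of_ne hj.2.1 hj.2.2]
    · exact absurd rfl h
    · rw [h3]
    · exact absurd rfl h
  | phase q =>
    simp only [WPGate.wires, List.mem_cons, List.not_mem_nil, or_false] at hj
    simp only [WPGate.op, oneQubit] at h
    split_ifs at h with h1
    · exact h1 j hj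
    · exact absurd rfl h

theorem wpCircuitOp_mulVec_of_fixed {C : List (WPGate g N)} {ψ : QVec N}
    (h : ∀ G ∈ C, (G.op U δ).mulVec ψ = ψ) : (wpCircuitOp U δ C).mulVec ψ = ψ := by
  induction C with
  | nil => simp [wpCircuitOp]
  | cons G C ih =>
    rw [wpCircuitOp, ← Matrix.mulVec_mulVec, h G (List.mem_cons_self ..),
      ih fun G hG => h G (List.mem_cons_of_mem _ hG)]

/-- For a family of gates of which only one acts: the gates before it fix the old vector, and the
gates after it fix the new one. -/
theorem wpCircuitOp_map_mulVec {α : Type*} (F : α → WPGate g N) {l : List α} (hl : l.Nodup)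
    {a : α} (ha : a ∈ l) {ψ φ : QVec N} (hψ : ∀ b ∈ l, b ≠ a → ((F b).op U δ).mulVec ψ = ψ)
    (hφ : ∀ b ∈ l, b ≠ a → ((F b).op U δ).mulVec φ = φ) (h : ((F a).op U δ).mulVec ψ = φ) :
    (wpCircuitOp U δ (l.map F)).mulVec ψ = φ := by
  induction l with
  | nil => simp at ha
  | cons b l ih =>
    rw [List.nodup_cons] at hl
    rw [List.map_cons, wpCircuitOp, ← Matrix.mulVec_mulVec]
    rcases eq_or_ne b a with rfl | hb
    · rw [h]
      refine wpCircuitOp_mulVec_of_fixed U δ fun G hG => ?_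
      obtain ⟨c, hc, rfl⟩ := List.mem_map.1 hG
      exact hφ c (List.mem_cons_of_mem _ hc) fun e => hl.1 (e ▸ hc)
    · rw [hψ b (List.mem_cons_self ..) hb]
      exact ih hl.2 ((List.mem_cons.1 ha).resolve_left hb.symm)
        (fun c hc => hψ c (List.mem_cons_of_mem _ hc))
        (fun c hc => hφ c (List.mem_cons_of_mem _ hc))

theorem fredkin_mulVec_single (s p q : Fin N) (z : Bits N) :
    ((WPGate.fredkin s p q : WPGate g N).op U δ).mulVec (Pi.single z 1) =
      Pi.single (if z s then z ∘ Equiv.swap p q else z) 1 :=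
  basisMap_mulVec_single _ z

theorem comp_swap_comp_swap (z : Bits N) (p q : Fin N) :
    (z ∘ Equiv.swap p q) ∘ Equiv.swap p q = z := by
  funext j
  simp

/-- Fredkin gates with the same targets swap them if the number of controls that are `1` is
odd. -/
theorem wpCircuitOp_map_fredkin {p q : Fin N} {l : List (Fin N)} (hl : ∀ s ∈ l, s ≠ p ∧ s ≠ q)
    (z : Bits N) :
    (wpCircuitOp U δ (l.map fun s => (WPGate.fredkin s p q : WPGate g N))).mulVec
      (Pi.single z 1) = Pi.single (if Odd (l.countP z) then z ∘ Equiv.swap p q else z) 1 := by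
  induction l generalizing z with
  | nil =>
    rw [List.map_nil, wpCircuitOp, Matrix.one_mulVec]
    simp
  | cons s l ih =>
    rw [List.map_cons, wpCircuitOp, ← Matrix.mulVec_mulVec, fredkin_mulVec_single,
      ih fun t ht => hl t (List.mem_cons_of_mem _ ht)]
    congr 1
    cases hz : z s with
    | false => rw [List.countP_cons_of_neg (by simp [hz])]; simp
    | true =>
      rw [List.countP_cons_of_pos hz]
      simp only [Nat.odd_add_one]
      have e : l.countP (z ∘ Equiv.swap p q) = l.countP z := by
        refine List.countP_congr fun t ht => ?_
        have := hl t (List.mem_cons_of_mem _ ht)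
        rw [Function.comp_apply, Equiv.swap_apply_of_ne_of_ne this.1 this.2]
      simp only [if_true, e]
      split_ifs <;> simp [comp_swap_comp_swap]

end Operators

end WPQ

namespace WPQ

/-! ### Representing basis states -/

section States

variable {k n N : ℕ}

/-- Bit `q` of `x`, which is `0` beyond the length of `x`. -/
def bitAt (x : Bits N) (q : ℕ) : Bool := if h : q < N then x ⟨q, h⟩ else false

/-- The value of block `b`. -/
def blockValue (k : ℕ) (x : Bits N) (b : ℕ) : ℕ :=
  Nat.ofBits fun j : Fin ((N + k - 1) / k) => bitAt x (b + k * j)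

/-- The representation of a basis state: in every block, exactly one qubit is `1`. -/
def oneHot (k n : ℕ) (x : Bits N) : Bits (k * (2 * n)) := fun i =>
  decide (i.val % (2 * n) = blockValue k x (i.val / (2 * n)))

/-- The basis state `y` of the witness qubits, with the ancillas `L` and `T` in state `1`. -/
def withTokens (k n N : ℕ) (y : Bits (k * (2 * n))) (L T : ℕ) :
    Bits (k * (2 * n) + (k + N + 3)) := fun i =>
  if h : i.val < k * (2 * n) then y ⟨i.val, h⟩ else decide (i.val = L ∨ i.val = T)

theorem bitAt_val (x : Bits N) (q : Fin N) : bitAt x q = x q := by simp [bitAt]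

theorem bitAt_update (x : Bits N) (q : Fin N) (β : Bool) (i : ℕ) :
    bitAt (Function.update x q β) i = if i = q then β else bitAt x i := by
  simp only [bitAt, Function.update_apply, Fin.ext_iff]
  by_cases h : i < N
  · simp [h]
  · have : i ≠ q := fun e => h (e ▸ q.2)
    simp [h, this]

theorem blockValue_lt (k : ℕ) (x : Bits N) (b : ℕ) :
    blockValue k x b < 2 ^ ((N + k - 1) / k) := Nat.ofBits_lt_two_pow _

/-- Valid for all `j`: past the last bit of a block the position exceeds N, where `bitAt` is `false`
by default. -/
theorem Fits.testBit_blockValue (h : Fits k n N) (x : Bits N) (b j : ℕ) :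
    (blockValue k x b).testBit j = bitAt x (b + k * j) := by
  rcases Nat.lt_or_ge j ((N + k - 1) / k) with hj | hj
  · rw [blockValue, Nat.testBit_ofBits_lt _ _ hj]
  · rw [blockValue, Nat.testBit_ofBits_ge _ _ hj, bitAt, dif_neg]
    have := Nat.mul_le_mul_left k hj
    have := h.le_mul
    omega

theorem Fits.blockValue_update_of_ne (h : Fits k n N) (x : Bits N) (q : Fin N) (β : Bool) {b : ℕ}
    (hb : b < k) (hne : b ≠ q % k) : blockValue k (Function.update x q β) b = blockValue k x b := by
  refine Nat.eq_of_testBit_eq fun j => ?_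
  rw [h.testBit_blockValue, h.testBit_blockValue, bitAt_update, if_neg]
  intro e
  apply hne
  rw [← e, Nat.add_mul_mod_self_left, Nat.mod_eq_of_lt hb]

theorem Fits.testBit_blockValue_update (h : Fits k n N) (x : Bits N) (q : Fin N) (β : Bool) :
    (blockValue k (Function.update x q β) (q % k)).testBit (q / k) = β := by
  rw [h.testBit_blockValue, bitAt_update, if_pos (Nat.mod_add_div _ _)]

theorem Fits.blockValue_update_true (h : Fits k n N) (x : Bits N) (q : Fin N) :
    blockValue k (Function.update x q true) (q % k) =
      blockValue k (Function.update x q false) (q % k) + 2 ^ (q.val / k) := by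
  refine Nat.eq_of_testBit_eq fun j => ?_
  rw [testBit_add_two_pow (h.testBit_blockValue_update x q false)]
  split_ifs with hj
  · rw [hj, h.testBit_blockValue_update]
  · have : q % k + k * j ≠ q := by
      intro e
      apply hj
      have := Nat.mod_add_div q.val k
      exact Nat.eq_of_mul_eq_mul_left h.pos_k (by omega)
    rw [h.testBit_blockValue, h.testBit_blockValue, bitAt_update, bitAt_update, if_neg this,
      if_neg this]

theorem oneHot_apply (x : Bits N) {b v : ℕ} (hv : v < 2 * n) (hlt : b * (2 * n) + v < k * (2 * n)) :
    oneHot k n x ⟨b * (2 * n) + v, hlt⟩ = decide (v = blockValue k x b) := by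
  have h1 : (b * (2 * n) + v) % (2 * n) = v := by
    rw [Nat.mul_add_mod_self_right, Nat.mod_eq_of_lt hv]
  have h2 : (b * (2 * n) + v) / (2 * n) = b := by
    rw [mul_comm, Nat.mul_add_div (by omega), Nat.div_eq_of_lt hv, add_zero]
  simp only [oneHot, h1, h2]

theorem withTokens_wire {y : Bits (k * (2 * n))} {L T i : ℕ} (hi : i < k * (2 * n)) :
    withTokens k n N y L T (wire k n N i) = y ⟨i, hi⟩ := by
  simp only [withTokens, val_wire (by omega : i < k * (2 * n) + (k + N + 3)), hi, dif_pos]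

theorem withTokens_wire_of_le {y : Bits (k * (2 * n))} {L T i : ℕ} (hi : k * (2 * n) ≤ i)
    (hi' : i < k * (2 * n) + (k + N + 3)) :
    withTokens k n N y L T (wire k n N i) = decide (i = L ∨ i = T) := by
  simp only [withTokens, val_wire hi', dif_neg (not_lt.2 hi)]

theorem val_swap_wire {s d : ℕ} (hs : s < k * (2 * n) + (k + N + 3))
    (hd : d < k * (2 * n) + (k + N + 3)) (i : Fin (k * (2 * n) + (k + N + 3))) :
    (Equiv.swap (wire k n N s) (wire k n N d) i).val = Equiv.swap s d i.val := by
  have e1 : i = wire k n N s ↔ i.val = s := by rw [Fin.ext_iff, val_wire hs]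
  have e2 : i = wire k n N d ↔ i.val = d := by rw [Fin.ext_iff, val_wire hd]
  rw [Equiv.swap_apply_def, Equiv.swap_apply_def]
  simp only [e1, e2]
  split_ifs
  exacts [val_wire hd, val_wire hs, rfl]

theorem withTokens_comp_swap (y : Bits (k * (2 * n))) (L T : ℕ) {s d : ℕ}
    (hs : k * (2 * n) ≤ s) (hs' : s < k * (2 * n) + (k + N + 3))
    (hd : k * (2 * n) ≤ d) (hd' : d < k * (2 * n) + (k + N + 3)) :
    withTokens k n N y L T ∘ Equiv.swap (wire k n N s) (wire k n N d) =
      withTokens k n N y (Equiv.swap s d L) (Equiv.swap s d T) := by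
  funext i
  simp only [Function.comp_apply, withTokens, val_swap_wire hs' hd', Equiv.swap_apply_eq_iff]
  by_cases hi : i.val < k * (2 * n)
  · have : Equiv.swap s d i.val = i.val :=
      Equiv.swap_apply_of_ne_of_ne (by omega) (by omega)
    simp only [this, hi, dif_pos]
  · have : ¬ Equiv.swap s d i.val < k * (2 * n) := by
      rw [Equiv.swap_apply_def]
      split_ifs <;> omega
    simp only [this, hi, dif_neg, not_false_iff]

theorem comp_swap_of_eq {M : ℕ} {z : Bits M} {p q : Fin M} (h : z p = z q) :
    z ∘ Equiv.swap p q = z := by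
  funext i
  rw [Function.comp_apply, Equiv.swap_apply_def]
  split_ifs with h1 h2
  · rw [h1, h]
  · rw [h2, h]
  · rfl

end States

/-! ### Simulation of single gates -/

section Simulation

variable {g k n N : ℕ} (U : Fin g → Matrix Bool Bool ℂ) (δ : ℝ)

/-- Block q % k contains a single 1, located at its value, and this position is in the list exactly
when the bit of `q` in that value is 1. The number of active Fredkin controls is therefore 0 or 1,
so its parity is the bit. -/
theorem Fits.countP_onePositions (h : Fits k n N) (x : Bits N) (L T : ℕ) (q : Fin N) :
    ((onePositions k n N q).map (wire k n N)).countP (withTokens k n N (oneHot k n x) L T) =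
      if x q then 1 else 0 := by
  have hq : blockValue k x (q % k) < 2 ^ ((N + k - 1) / k) := blockValue_lt _ _ _
  have hbit : (blockValue k x (q % k)).testBit (q / k) = x q := by
    rw [h.testBit_blockValue, Nat.mod_add_div, bitAt_val]
  rw [h.onePositions_eq q.2, List.map_map, List.countP_map, List.countP_filter]
  have e : ∀ v ∈ List.range (2 ^ ((N + k - 1) / k)),
      ((withTokens k n N (oneHot k n x) L T ∘ wire k n N ∘ fun v => q.val % k * (2 * n) + v) v &&
        v.testBit (q / k)) = true ↔ (v == blockValue k x (q % k) && x q) = true := by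
    intro v hv
    have hv := (List.mem_range.1 hv).trans_le h.two_pow_le
    have hp := position_lt (Nat.mod_lt q h.pos_k) hv
    rw [Function.comp_apply, Function.comp_apply, withTokens_wire hp, oneHot_apply x hv hp]
    simp only [Bool.and_eq_true, decide_eq_true_eq, beq_iff_eq]
    constructor
    · rintro ⟨rfl, h2⟩
      exact ⟨rfl, by rw [← hbit, h2]⟩
    · rintro ⟨rfl, h2⟩
      exact ⟨rfl, by rw [hbit, h2]⟩
  rw [List.countP_congr e]
  cases x q with
  | false => simp
  | true =>
    simp only [Bool.and_true, if_true]
    exact List.count_eq_one_of_mem List.nodup_range (List.mem_range.2 hq)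

theorem Fits.transferGates_mulVec (h : Fits k n N) (x : Bits N) (L T : ℕ) (q : Fin N) {s d : ℕ}
    (hs : k * (2 * n) ≤ s) (hs' : s < k * (2 * n) + (k + N + 3))
    (hd : k * (2 * n) ≤ d) (hd' : d < k * (2 * n) + (k + N + 3)) :
    (wpCircuitOp U δ (transferGates g k n N q s d)).mulVec
      (Pi.single (withTokens k n N (oneHot k n x) L T) 1) =
      Pi.single (if x q then withTokens k n N (oneHot k n x) (Equiv.swap s d L) (Equiv.swap s d T)
        else withTokens k n N (oneHot k n x) L T) 1 := by
  have e : transferGates g k n N q s d = ((onePositions k n N q).map (wire k n N)).map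
      fun i => WPGate.fredkin i (wire k n N s) (wire k n N d) := by
    rw [transferGates, List.map_map]
    rfl
  rw [e, wpCircuitOp_map_fredkin, h.countP_onePositions, withTokens_comp_swap _ _ _ hs hs' hd hd']
  · cases x q <;> simp
  · intro c hc
    obtain ⟨i, hi, rfl⟩ := List.mem_map.1 hc
    have := h.lt_of_mem_onePositions q.2 hi
    exact ⟨wire_ne (by omega) hs' (by omega), wire_ne (by omega) hd' (by omega)⟩

/-- The qubit that represents the value of the block of `q` with the bit of `q` set to `0`. -/
def zeroPosition (k n : ℕ) (x : Bits N) (q : Fin N) : ℕ :=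
  q % k * (2 * n) + blockValue k (Function.update x q false) (q % k)

theorem Fits.zeroPosition_mem (h : Fits k n N) (x : Bits N) (q : Fin N) :
    zeroPosition k n x q ∈ zeroPositions k n N q := by
  rw [h.zeroPositions_eq q.2]
  refine List.mem_map.2 ⟨_, List.mem_filter.2 ⟨List.mem_range.2 (blockValue_lt k
    (Function.update x q false) (q % k)), ?_⟩, rfl⟩
  rw [h.testBit_blockValue_update]
  rfl

theorem Fits.nodup_zeroPositions (h : Fits k n N) (q : Fin N) :
    (zeroPositions k n N q).Nodup := by
  rw [h.zeroPositions_eq q.2]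
  exact (List.nodup_range.filter _).map fun a b hab => by simpa using hab

/-- The pairs (p, p + 2^j) partition the values of the block. The 1 of the block lies in the pair at
`zeroPosition`, in the second place if the bit is 1; all other pairs are in state 00 and their gates
do nothing. -/
theorem Fits.withTokens_zeroPositions (h : Fits k n N) (x : Bits N) (q : Fin N) (β : Bool)
    (L T : ℕ) {p : ℕ} (hp : p ∈ zeroPositions k n N q) :
    withTokens k n N (oneHot k n (Function.update x q β)) L T (wire k n N p) =
      (decide (p = zeroPosition k n x q) && !β) ∧
    withTokens k n N (oneHot k n (Function.update x q β)) L T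
      (wire k n N (p + placeValue k n q)) = (decide (p = zeroPosition k n x q) && β) := by
  have hlt := h.lt_of_mem_zeroPositions q.2 hp
  rw [withTokens_wire hlt.1, withTokens_wire hlt.2]
  rw [h.zeroPositions_eq q.2] at hp
  simp only [List.mem_map, List.mem_filter, List.mem_range, Bool.not_eq_true'] at hp
  obtain ⟨v, ⟨hv, hv'⟩, rfl⟩ := hp
  have hv2 := add_two_pow_lt hv' hv (h.div_lt q.2)
  have e2 := h.placeValue_eq q.2
  simp only [e2, add_assoc] at hlt ⊢
  rw [oneHot_apply _ (hv.trans_le h.two_pow_le), oneHot_apply _ (hv2.trans_le h.two_pow_le)]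
  have e1 : q % k * (2 * n) + v = zeroPosition k n x q ↔
      v = blockValue k (Function.update x q false) (q % k) := by
    rw [zeroPosition, Nat.add_left_cancel_iff]
  simp only [e1]
  have b1 := h.testBit_blockValue_update x q false
  have b2 := h.testBit_blockValue_update x q true
  have b3 := testBit_add_two_pow hv' (q / k)
  rw [if_pos rfl] at b3
  cases β with
  | false =>
    refine ⟨by simp, ?_⟩
    simp only [Bool.and_false, decide_eq_false_iff_not]
    intro e
    rw [e, b1] at b3
    simp at b3
  | true =>
    refine ⟨?_, ?_⟩
    · simp only [Bool.not_true, Bool.and_false, decide_eq_false_iff_not]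
      intro e
      rw [e, b2] at hv'
      simp at hv'
    · simp only [h.blockValue_update_true, Nat.add_right_cancel_iff, Bool.and_true]

theorem Fits.withTokens_update_of_ne (h : Fits k n N) (x : Bits N) (q : Fin N) (β β' : Bool)
    (L T : ℕ) {j : Fin (k * (2 * n) + (k + N + 3))}
    (h0 : j ≠ wire k n N (zeroPosition k n x q))
    (h1 : j ≠ wire k n N (zeroPosition k n x q + placeValue k n q)) :
    withTokens k n N (oneHot k n (Function.update x q β)) L T j =
      withTokens k n N (oneHot k n (Function.update x q β')) L T j := by
  have hlt := h.lt_of_mem_zeroPositions q.2 (h.zeroPosition_mem x q)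
  simp only [withTokens]
  split_ifs with hj
  · simp only [oneHot]
    have hb : j.val / (2 * n) < k := Nat.div_lt_of_lt_mul (hj.trans_eq (mul_comm _ _))
    have hdm := Nat.div_add_mod j.val (2 * n)
    by_cases hbq : j.val / (2 * n) = q % k
    · have key : ∀ β, j.val % (2 * n) ≠ blockValue k (Function.update x q β) (q % k) := by
        intro β e
        rw [e, hbq, mul_comm] at hdm
        cases β with
        | false => exact h0 (Fin.ext (by rw [val_wire (by omega)]; exact hdm.symm))
        | true =>
          apply h1
          apply Fin.ext
          rw [val_wire (by omega), zeroPosition, h.placeValue_eq q.2]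
          have := h.blockValue_update_true x q
          omega
      rw [hbq, decide_eq_false (key β), decide_eq_false (key β')]
    · rw [h.blockValue_update_of_ne x q β hb hbq, h.blockValue_update_of_ne x q β' hb hbq]
  · rfl

theorem Fits.wire_zeroPosition_ne (h : Fits k n N) (x : Bits N) (q : Fin N) :
    wire k n N (zeroPosition k n x q + placeValue k n q) ≠ wire k n N (zeroPosition k n x q) := by
  have hlt := h.lt_of_mem_zeroPositions q.2 (h.zeroPosition_mem x q)
  refine wire_ne (by omega) (by omega) ?_
  rw [h.placeValue_eq q.2]
  have := Nat.two_pow_pos (q.val / k)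
  omega

/-- If the control is set, all pairs are swapped, but this is visible only on the pair with the 1,
where it toggles the bit. -/
theorem Fits.flipGates_mulVec (h : Fits k n N) (x : Bits N) (L T : ℕ) (q : Fin N) {c : ℕ}
    (hc : k * (2 * n) ≤ c) (hc' : c < k * (2 * n) + (k + N + 3)) :
    (wpCircuitOp U δ (flipGates g k n N q c)).mulVec
      (Pi.single (withTokens k n N (oneHot k n x) L T) 1) =
      Pi.single (withTokens k n N
        (oneHot k n (if c = L ∨ c = T then Function.update x q (!x q) else x)) L T) 1 := by
  by_cases hcl : c = L ∨ c = T
  · rw [if_pos hcl]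
    have hctrl : ∀ y, withTokens k n N y L T (wire k n N c) = true := fun y => by
      rw [withTokens_wire_of_le hc hc', decide_eq_true hcl]
    have hx : x = Function.update x q (x q) := (Function.update_eq_self q x).symm
    have fixed : ∀ β, ∀ p ∈ zeroPositions k n N q, p ≠ zeroPosition k n x q →
        ((WPGate.fredkin (wire k n N c) (wire k n N p) (wire k n N (p + placeValue k n q)) :
          BlockGate g k n N).op U δ).mulVec
          (Pi.single (withTokens k n N (oneHot k n (Function.update x q β)) L T) 1) =
          Pi.single (withTokens k n N (oneHot k n (Function.update x q β)) L T) 1 := by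
      intro β p hp hne
      have h1 := h.withTokens_zeroPositions x q β L T hp
      rw [fredkin_mulVec_single, if_pos (hctrl _), comp_swap_of_eq]
      rw [h1.1, h1.2]
      simp [hne]
    refine wpCircuitOp_map_mulVec U δ _ (h.nodup_zeroPositions q) (h.zeroPosition_mem x q) ?_
      (fixed _) ?_
    · intro p hp hne
      have := fixed (x q) p hp hne
      rwa [← hx] at this
    · rw [fredkin_mulVec_single, if_pos (hctrl _)]
      congr 1
      funext j
      have h1 := fun β => h.withTokens_zeroPositions x q β L T (h.zeroPosition_mem x q)
      simp only [decide_true, Bool.true_and] at h1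
      have h2 := h1 (x q)
      rw [← hx] at h2
      rw [Function.comp_apply, Equiv.swap_apply_def]
      split_ifs with c1 c2
      · rw [c1, h2.2, (h1 _).1, Bool.not_not]
      · rw [c2, h2.1, (h1 _).2]
      · conv_lhs => rw [hx]
        exact h.withTokens_update_of_ne x q _ _ L T c1 c2
  · rw [if_neg hcl]
    refine wpCircuitOp_mulVec_of_fixed U δ fun G hG => ?_
    obtain ⟨p, hp, rfl⟩ := List.mem_map.1 hG
    rw [fredkin_mulVec_single, withTokens_wire_of_le hc hc', if_neg (by simpa using hcl)]

/-- On the active pair, 10 and 01 stand for bit 1 and bit 0. The first wire of the gate is the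
position for bit 1, so it carries the bit itself, and the middle block of 1 ⊕ V ⊕ 1 acts as V
without relabelling. -/
theorem Fits.hat_mulVec (h : Fits k n N) (x : Bits N) (L T : ℕ) (i : Fin g) (q : Fin N)
    (β : Bool) :
    ((WPGate.hat i (wire k n N (zeroPosition k n x q + placeValue k n q))
      (wire k n N (zeroPosition k n x q)) : BlockGate g k n N).op U δ).mulVec
      (Pi.single (withTokens k n N (oneHot k n (Function.update x q β)) L T) 1) =
    ∑ β', U i β' β • Pi.single (withTokens k n N (oneHot k n (Function.update x q β')) L T) 1 := by
  have h1 := fun β => h.withTokens_zeroPositions x q β L T (h.zeroPosition_mem x q)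
  simp only [decide_true, Bool.true_and] at h1
  have hne := h.wire_zeroPosition_ne x q
  have h2 := fun β β' j h0 h1 => h.withTokens_update_of_ne x q β β' L T (j := j) h0 h1
  generalize wire k n N (zeroPosition k n x q + placeValue k n q) = p₁ at *
  generalize wire k n N (zeroPosition k n x q) = p₀ at *
  generalize hS : (fun β => withTokens k n N (oneHot k n (Function.update x q β)) L T) = S
  have hS' : ∀ β, withTokens k n N (oneHot k n (Function.update x q β)) L T = S β :=
    fun β => congrFun hS β
  simp only [hS'] at *
  funext z
  rw [Matrix.mulVec_single_one, Matrix.col_apply]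
  simp only [Fintype.sum_bool, Pi.add_apply, Pi.smul_apply, smul_eq_mul, WPGate.op, hatOp,
    hatMatrix]
  have hz : ∀ β', (z = S β') ↔ (∀ j, j ≠ p₁ → j ≠ p₀ → z j = S β j) ∧ z p₁ = β' ∧ z p₀ = !β' := by
    intro β'
    constructor
    · rintro rfl
      exact ⟨fun j hj1 hj0 => h2 _ _ j hj0 hj1, (h1 β').2, (h1 β').1⟩
    · rintro ⟨e, e1, e0⟩
      funext j
      rcases eq_or_ne j p₁ with rfl | hj1
      · rw [e1, (h1 β').2]
      · rcases eq_or_ne j p₀ with rfl | hj0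
        · rw [e0, (h1 β').1]
        · rw [e j hj1 hj0, h2 β β' j hj0 hj1]
  simp only [Pi.single_apply, hz, (h1 β).1, (h1 β).2]
  by_cases hall : ∀ j, j ≠ p₁ → j ≠ p₀ → z j = S β j
  · simp only [eq_true hall, if_true, true_and]
    cases z p₁ <;> cases z p₀ <;> cases β <;> simp
  · simp only [eq_false hall, if_false, false_and, mul_zero, add_zero]

theorem Fits.rotateGates_mulVec (h : Fits k n N) (x : Bits N) (L T : ℕ) (i : Fin g) (q : Fin N) :
    (wpCircuitOp U δ (rotateGates k n N i q)).mulVec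
      (Pi.single (withTokens k n N (oneHot k n x) L T) 1) =
    ∑ β, U i β (x q) • Pi.single (withTokens k n N (oneHot k n (Function.update x q β)) L T) 1 := by
  have hx : x = Function.update x q (x q) := (Function.update_eq_self q x).symm
  have fixed : ∀ β, ∀ p ∈ zeroPositions k n N q, p ≠ zeroPosition k n x q →
      ((WPGate.hat i (wire k n N (p + placeValue k n q)) (wire k n N p) :
        BlockGate g k n N).op U δ).mulVec
        (Pi.single (withTokens k n N (oneHot k n (Function.update x q β)) L T) 1) =
        Pi.single (withTokens k n N (oneHot k n (Function.update x q β)) L T) 1 := by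
    intro β p hp hne
    have h1 := h.withTokens_zeroPositions x q β L T hp
    simp only [hne, decide_false, Bool.false_and] at h1
    funext z
    rw [Matrix.mulVec_single_one, Matrix.col_apply]
    simp only [WPGate.op, hatOp, hatMatrix, h1.1, h1.2, Pi.single_apply]
    by_cases hall : ∀ j, j ≠ wire k n N (p + placeValue k n q) → j ≠ wire k n N p →
        z j = withTokens k n N (oneHot k n (Function.update x q β)) L T j
    · rw [if_pos hall]
      simp only [ne_eq, not_true_eq_false, and_false, if_false, Prod.mk.injEq]
      congr 1
      rw [eq_iff_iff]
      constructor
      · rintro ⟨e1, e0⟩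
        funext j
        by_cases hj1 : j = wire k n N (p + placeValue k n q)
        · rw [hj1, e1, h1.2]
        · by_cases hj0 : j = wire k n N p
          · rw [hj0, e0, h1.1]
          · exact hall j hj1 hj0
      · rintro rfl
        exact ⟨h1.2, h1.1⟩
    · rw [if_neg hall, if_neg]
      rintro rfl
      exact hall fun _ _ _ => rfl
  refine wpCircuitOp_map_mulVec U δ _ (h.nodup_zeroPositions q) (h.zeroPosition_mem x q) ?_ ?_ ?_
  · intro p hp hne
    have := fixed (x q) p hp hne
    rwa [← hx] at this
  -- After the active gate the state is a superposition of both values of the bit; the remaining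
  -- gates must fix each of the two terms.
  · intro p hp hne
    rw [Matrix.mulVec_sum]
    refine Finset.sum_congr rfl fun β _ => ?_
    rw [Matrix.mulVec_smul, fixed β p hp hne]
  · have := h.hat_mulVec U δ x L T i q (x q)
    rwa [← hx] at this

end Simulation

end WPQ

namespace WPQ

/-! ### Simulation of circuits -/

section Embedding

variable {M N : ℕ}

/-- The operator that maps the basis state `x` to the basis state `F x`. -/
def embed (F : Bits N → Bits M) : Matrix (Bits M) (Bits N) ℂ := fun y x => if y = F x then 1 else 0

theorem embed_mulVec_single (F : Bits N → Bits M) (x : Bits N) :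
    (embed F).mulVec (Pi.single x 1) = Pi.single (F x) 1 := by
  funext y
  simp [embed, Pi.single_apply]

/-- By linearity, identities between circuits and encodings need only be checked on basis states. -/
theorem mulVec_mulVec_ext {M' : Type*} [Fintype M'] {A : Matrix (Bits M) M' ℂ}
    {B : Matrix M' (Bits N) ℂ} {D : Matrix (Bits M) (Bits N) ℂ}
    (h : ∀ x, A.mulVec (B.mulVec (Pi.single x 1)) = D.mulVec (Pi.single x 1)) (φ : QVec N) :
    A.mulVec (B.mulVec φ) = D.mulVec φ := by
  have e : A * B = D := by
    ext y x
    have := congrFun (h x) y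
    rw [Matrix.mulVec_mulVec] at this
    simpa [Matrix.mulVec_single_one] using this
  rw [Matrix.mulVec_mulVec, e]

theorem oneQubit_mulVec_single (V : Matrix Bool Bool ℂ) (q : Fin N) (x : Bits N) :
    (oneQubit V q).mulVec (Pi.single x 1) =
      ∑ β, V β (x q) • Pi.single (Function.update x q β) (1 : ℂ) := by
  funext z
  rw [Matrix.mulVec_single_one, Matrix.col_apply]
  have hz : ∀ β, z = Function.update x q β ↔ (∀ j, j ≠ q → z j = x j) ∧ z q = β := by
    intro β
    rw [Function.eq_update_iff, and_comm]
  simp only [oneQubit, Fintype.sum_bool, Pi.add_apply, Pi.smul_apply, smul_eq_mul, Pi.single_apply,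
    hz]
  by_cases hall : ∀ j, j ≠ q → z j = x j
  · simp only [eq_true hall, if_true, true_and]
    cases z q <;> simp
  · simp only [eq_false hall, if_false, false_and, mul_zero, add_zero]

theorem embed_mulVec_apply {F : Bits N → Bits M} (hF : Function.Injective F) (φ : QVec N)
    (x : Bits N) : (embed F).mulVec φ (F x) = φ x := by
  simp only [Matrix.mulVec, dotProduct, embed, hF.eq_iff]
  simp

theorem embed_mulVec_of_notMem {F : Bits N → Bits M} (φ : QVec N) {y : Bits M}
    (hy : y ∉ Set.range F) : (embed F).mulVec φ y = 0 := by
  simp only [Matrix.mulVec, dotProduct, embed]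
  refine Finset.sum_eq_zero fun x _ => ?_
  rw [if_neg, zero_mul]
  rintro rfl
  exact hy ⟨x, rfl⟩

theorem isState_embed {F : Bits N → Bits M} (hF : Function.Injective F) {φ : QVec N}
    (hφ : IsState φ) : IsState ((embed F).mulVec φ) := by
  rw [IsState, ← hφ]
  refine (Finset.sum_of_injOn F hF.injOn (fun _ _ => Finset.mem_coe.2 (Finset.mem_univ _)) ?_ ?_).symm
  · intro y _ hy
    rw [embed_mulVec_of_notMem φ fun h => hy (by simpa using h)]
    simp
  · intro x _
    rw [embed_mulVec_apply hF]

theorem probOne_embed {F : Bits N → Bits M} (hF : Function.Injective F) {p : Fin M} {q : Fin N}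
    (hp : ∀ x, F x p = x q) (φ : QVec N) : probOne ((embed F).mulVec φ) p = probOne φ q := by
  refine (Finset.sum_of_injOn F hF.injOn ?_ ?_ ?_).symm
  · intro x hx
    simpa [hp] using hx
  · intro z hz hz'
    rw [embed_mulVec_of_notMem φ]
    · simp
    · rintro ⟨x, rfl⟩
      exact hz' ⟨x, by simpa [hp] using hz, rfl⟩
  · intro x _
    rw [embed_mulVec_apply hF]

end Embedding

section Simulation

variable {g k n N : ℕ} (U : Fin g → Matrix Bool Bool ℂ) (δ : ℝ)

/-- The induction needs a token at any rung `τ ≤ i`: once a control fails, the token stays behind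
and no later gate affects it or uses it. The way down undoes the way up because the target is not a
control, so the controls still have their old values. The bound on `L` keeps the other token off the
ladder. -/
theorem Fits.ladderGates_mulVec (h : Fits k n N) {L : ℕ} (hL : L < k * (2 * n) + k + 2)
    {t : Fin N} {cs : List (Fin N)} (hcs : t ∉ cs) (x : Bits N) {i τ : ℕ} (hτ : τ ≤ i)
    (hi : i + cs.length ≤ N) :
    (wpCircuitOp U δ (ladderGates g k n N i (cs.map Fin.val) t)).mulVec
      (Pi.single (withTokens k n N (oneHot k n x) L (ladderPos k n τ)) 1) =
      Pi.single (withTokens k n N (oneHot k n (if τ = i ∧ cs.all x = true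
        then Function.update x t (!x t) else x)) L (ladderPos k n τ)) 1 := by
  induction cs generalizing i τ with
  | nil =>
    simp only [List.length_nil] at hi
    rw [List.map_nil, ladderGates, h.flipGates_mulVec U δ x L _ t (by simp only [ladderPos]; omega)
      (by simp only [ladderPos]; omega)]
    have e : (ladderPos k n i = L ∨ ladderPos k n i = ladderPos k n τ) ↔
        (τ = i ∧ ([] : List (Fin N)).all x = true) := by
      simp only [ladderPos, List.all_nil, and_true]
      omega
    simp only [e]
  | cons c cs ih =>
    simp only [List.length_cons] at hi
    rw [List.mem_cons, not_or] at hcs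
    have hs : k * (2 * n) ≤ ladderPos k n i := by simp only [ladderPos]; omega
    have hs' : ladderPos k n i < k * (2 * n) + (k + N + 3) := by simp only [ladderPos]; omega
    have hd : k * (2 * n) ≤ ladderPos k n (i + 1) := by simp only [ladderPos]; omega
    have hd' : ladderPos k n (i + 1) < k * (2 * n) + (k + N + 3) := by simp only [ladderPos]; omega
    have eL : Equiv.swap (ladderPos k n i) (ladderPos k n (i + 1)) L = L :=
      Equiv.swap_apply_of_ne_of_ne (by simp only [ladderPos]; omega) (by simp only [ladderPos]; omega)
    have htr := fun y T => h.transferGates_mulVec (g := g) U δ y L T c hs hs' hd hd'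
    simp only [eL] at htr
    rw [List.map_cons, ladderGates, wpCircuitOp_append, wpCircuitOp_append,
      ← Matrix.mulVec_mulVec, ← Matrix.mulVec_mulVec, htr, List.all_cons]
    rcases Nat.lt_or_ge τ i with hlt | hge
    · have eτ : Equiv.swap (ladderPos k n i) (ladderPos k n (i + 1)) (ladderPos k n τ) =
          ladderPos k n τ :=
        Equiv.swap_apply_of_ne_of_ne (by simp only [ladderPos]; omega)
          (by simp only [ladderPos]; omega)
      rw [eτ, ite_self, ih hcs.2 (by omega) (by omega), if_neg (by omega), htr, eτ, ite_self,
        if_neg (by omega)]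
    · obtain rfl : τ = i := by omega
      cases hc : x c with
      | false =>
        rw [if_neg (by simp), ih hcs.2 (by omega) (by omega), if_neg (by omega), htr, hc]
        simp
      | true =>
        rw [if_pos rfl, Equiv.swap_apply_left, ih hcs.2 le_rfl (by omega), htr,
          Equiv.swap_apply_right]
        have hx' : (if τ + 1 = τ + 1 ∧ cs.all x = true then Function.update x t (!x t) else x) c =
            true := by
          split_ifs
          · rw [Function.update_of_ne (Ne.symm hcs.1), hc]
          · exact hc
        rw [if_pos hx']
        simp

/-- The representation of a basis state after a successful check. -/
def encode (k n : ℕ) (x : Bits N) : Bits (k * (2 * n) + (k + N + 3)) :=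
  withTokens k n N (oneHot k n x) (legalPos k n k) (ladderPos k n 0)

theorem update_xor_eq_ite (x : Bits N) (t : Fin N) (b : Bool) :
    Function.update x t (xor (x t) b) = if b = true then Function.update x t (!x t) else x := by
  cases b <;> simp

theorem Fits.ladderGates_encode (h : Fits k n N) {t : Fin N} {cs : List (Fin N)} (hcs : t ∉ cs)
    (hi : cs.length ≤ N) (x : Bits N) :
    (wpCircuitOp U δ (ladderGates g k n N 0 (cs.map Fin.val) t)).mulVec
      (Pi.single (encode k n x) 1) =
      Pi.single (encode k n (Function.update x t (xor (x t) (cs.all x)))) 1 := by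
  rw [encode, h.ladderGates_mulVec U δ (by simp only [legalPos]; omega) hcs x le_rfl (by omega),
    update_xor_eq_ite]
  simp only [true_and]
  rfl

/-- The source is not a target, so it keeps its value and the fanout is a succession of CNOTs. -/
theorem Fits.fanout_encode (h : Fits k n N) {s : Fin N} {ts : List (Fin N)} (hs : s ∉ ts)
    (hts : ts.Nodup) (x : Bits N) :
    (wpCircuitOp U δ ((ts.map Fin.val).flatMap fun t => ladderGates g k n N 0 [s.val] t)).mulVec
      (Pi.single (encode k n x) 1) =
      Pi.single (encode k n fun j => xor (x j) (decide (j ∈ ts) && x s)) 1 := by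
  induction ts generalizing x with
  | nil => simp only [List.map_nil, List.flatMap_nil, wpCircuitOp, Matrix.one_mulVec,
      List.not_mem_nil, decide_false, Bool.false_and, Bool.xor_false]
  | cons t ts ih =>
    rw [List.mem_cons, not_or] at hs
    rw [List.nodup_cons] at hts
    have hN := s.2
    have h1 := h.ladderGates_encode (g := g) U δ (cs := [s]) (t := t)
      (by simpa using Ne.symm hs.1) (by simp; omega) x
    rw [List.map_cons, List.map_nil] at h1
    rw [List.map_cons, List.flatMap_cons, wpCircuitOp_append, ← Matrix.mulVec_mulVec, h1,
      ih hs.2 hts.2]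
    congr 2
    funext j
    rw [Function.update_of_ne hs.1]
    rcases eq_or_ne j t with rfl | hj
    · simp [hts.1]
    · simp [hj]

/-- The new gates intertwine with the old gate through the encoding; iterating this gives the
simulation of the whole circuit, also on superpositions. -/
theorem Fits.blockGates_embed (h : Fits k n N) (G : Gate g N) (hG : G.WF) (φ : QVec N) :
    (wpCircuitOp U δ (blockGates k n G)).mulVec ((embed (encode k n)).mulVec φ) =
      (embed (encode k n)).mulVec ((G.op U).mulVec φ) := by
  rw [Matrix.mulVec_mulVec (M := embed (encode k n))]
  refine mulVec_mulVec_ext (fun x => ?_) φ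
  rw [← Matrix.mulVec_mulVec, embed_mulVec_single]
  cases G with
  | one i q =>
    rw [Gate.op, oneQubit_mulVec_single, Matrix.mulVec_sum, blockGates, encode,
      h.rotateGates_mulVec]
    refine Finset.sum_congr rfl fun β _ => ?_
    rw [Matrix.mulVec_smul, embed_mulVec_single]
    rfl
  | cnot s t =>
    have hst : s ≠ t := by
      simpa [Gate.WF, Gate.wires, Gate.controls, Gate.targets] using hG
    have hN := s.2
    have h1 := h.ladderGates_encode (g := g) U δ (cs := [s]) (t := t)
      (by simpa using Ne.symm hst) (by simp; omega) x
    rw [List.map_cons, List.map_nil] at h1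
    rw [blockGates, h1, Gate.op, basisMap_mulVec_single, embed_mulVec_single]
    simp
  | toffoli cs t =>
    have hlen := hG.length_lt
    have hnd : t ∉ cs := by
      simp only [Gate.WF, Gate.wires, Gate.controls, Gate.targets, List.nodup_append] at hG
      exact fun ht => hG.2.2 t ht t (by simp) rfl
    rw [blockGates, h.ladderGates_encode U δ hnd hlen.le, Gate.op, basisMap_mulVec_single,
      embed_mulVec_single]
  | fanout s ts =>
    simp only [Gate.WF, Gate.wires, Gate.controls, Gate.targets, List.singleton_append,
      List.nodup_cons] at hG
    rw [blockGates, h.fanout_encode U δ hG.1 hG.2, Gate.op, basisMap_mulVec_single,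
      embed_mulVec_single]

theorem Fits.blockGates_circuit_embed (h : Fits k n N) {C : List (Gate g N)}
    (hC : ∀ G ∈ C, G.WF) (φ : QVec N) :
    (wpCircuitOp U δ (C.flatMap (blockGates k n))).mulVec ((embed (encode k n)).mulVec φ) =
      (embed (encode k n)).mulVec ((circuitOp U C).mulVec φ) := by
  induction C generalizing φ with
  | nil => simp only [List.flatMap_nil, wpCircuitOp, circuitOp, Matrix.one_mulVec]
  | cons G C ih =>
    rw [List.flatMap_cons, wpCircuitOp_append, ← Matrix.mulVec_mulVec,
      h.blockGates_embed U δ G (hC G (List.mem_cons_self ..)),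
      ih fun G hG => hC G (List.mem_cons_of_mem _ hG), circuitOp, ← Matrix.mulVec_mulVec φ]

/-- The representation of a basis state at the end. -/
def finalState (k n : ℕ) (out : Fin N) (x : Bits N) : Bits (k * (2 * n) + (k + N + 3)) :=
  withTokens k n N (oneHot k n x) (if x out then outPos k n else legalPos k n k) (ladderPos k n 0)

theorem Fits.transferGates_embed (h : Fits k n N) (out : Fin N) (φ : QVec N) :
    (wpCircuitOp U δ (transferGates g k n N out (legalPos k n k) (outPos k n))).mulVec
      ((embed (encode k n)).mulVec φ) = (embed (finalState k n out)).mulVec φ := by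
  refine mulVec_mulVec_ext (fun x => ?_) φ
  rw [embed_mulVec_single, embed_mulVec_single, encode,
    h.transferGates_mulVec U δ x _ _ out (by simp only [legalPos]; omega)
      (by simp only [legalPos]; omega) (by simp only [outPos]; omega) (by simp only [outPos]; omega),
    Equiv.swap_apply_left, Equiv.swap_apply_of_ne_of_ne (by simp only [ladderPos, legalPos]; omega)
      (by simp only [ladderPos, outPos]; omega), finalState]
  split_ifs <;> rfl

theorem Fits.oneHot_injective (h : Fits k n N) :
    Function.Injective (oneHot k n : Bits N → Bits (k * (2 * n))) := by
  intro x y hxy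
  have key : ∀ b, b < k → blockValue k x b = blockValue k y b := by
    intro b hb
    have hv := (blockValue_lt k x b).trans_le h.two_pow_le
    have hp := position_lt hb hv
    have e := congrFun hxy ⟨_, hp⟩
    rw [oneHot_apply x hv hp, oneHot_apply y hv hp] at e
    simpa using e
  funext q
  rw [← bitAt_val x, ← bitAt_val y, ← Nat.mod_add_div q.val k, ← h.testBit_blockValue,
    ← h.testBit_blockValue, key _ (Nat.mod_lt _ h.pos_k)]

theorem Fits.finalState_injective (h : Fits k n N) (out : Fin N) :
    Function.Injective (finalState k n out) := by
  intro x y hxy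
  refine h.oneHot_injective (funext fun i => ?_)
  have e := congrFun hxy (wire k n N i)
  rwa [finalState, finalState, withTokens_wire i.2, withTokens_wire i.2] at e

theorem finalState_out (out : Fin N) (x : Bits N) :
    finalState k n out x (wire k n N (outPos k n)) = x out := by
  rw [finalState, withTokens_wire_of_le (by simp only [outPos]; omega)
    (by simp only [outPos]; omega)]
  cases x out
  · simp only [outPos, legalPos, ladderPos, Bool.false_eq_true, if_false, decide_eq_false_iff_not]
    omega
  · simp

end Simulation

end WPQ

namespace WPQ

/-! ### The check of the witness -/

section Check

variable {g k n N : ℕ} (U : Fin g → Matrix Bool Bool ℂ) (δ : ℝ)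

/-- The number of qubits with value `1` among those of block `b` that represent the values of the
first `m` qubits. -/
def blockCount (k n m : ℕ) (y : Bits (k * (2 * n))) (b : ℕ) : ℕ :=
  (List.range (numValues k n (m - b))).countP fun v => bitAt y (b * (2 * n) + v)

/-- Here `y` is arbitrary, so several controls may be 1 and only their parity counts. A token that
stopped before block `b` is out of reach of these gates. -/
theorem checkBlockGates_mulVec {b : ℕ} (hb : b < k) (m : ℕ) (y : Bits (k * (2 * n))) {i : ℕ}
    (hi : i ≤ b) :
    (wpCircuitOp U δ (checkBlockGates g k n N m b)).mulVec
      (Pi.single (withTokens k n N y (legalPos k n i) (ladderPos k n 0)) 1) =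
      Pi.single (withTokens k n N y
        (legalPos k n (if i = b ∧ Odd (blockCount k n m y b) then b + 1 else i))
        (ladderPos k n 0)) 1 := by
  have hpos : ∀ v ∈ List.range (numValues k n (m - b)), b * (2 * n) + v < k * (2 * n) :=
    fun v hv => position_lt hb ((List.mem_range.1 hv).trans_le (min_le_right _ _))
  have e : checkBlockGates g k n N m b = ((List.range (numValues k n (m - b))).map
      fun v => wire k n N (b * (2 * n) + v)).map fun s =>
        WPGate.fredkin s (wire k n N (legalPos k n b)) (wire k n N (legalPos k n (b + 1))) := by
    rw [checkBlockGates, List.map_map]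
    rfl
  have e2 : ((List.range (numValues k n (m - b))).map fun v => wire k n N (b * (2 * n) + v)).countP
      (withTokens k n N y (legalPos k n i) (ladderPos k n 0)) = blockCount k n m y b := by
    rw [List.countP_map, blockCount]
    refine List.countP_congr fun v hv => ?_
    have := hpos v hv
    rw [Function.comp_apply, withTokens_wire this, bitAt, dif_pos this]
  rw [e, wpCircuitOp_map_fredkin, e2, withTokens_comp_swap]
  · have eT : Equiv.swap (legalPos k n b) (legalPos k n (b + 1)) (ladderPos k n 0) =
        ladderPos k n 0 := Equiv.swap_apply_of_ne_of_ne
      (by simp only [ladderPos, legalPos]; omega) (by simp only [ladderPos, legalPos]; omega)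
    rw [eT]
    rcases eq_or_ne i b with rfl | hne
    · rw [Equiv.swap_apply_left]
      simp only [true_and]
      split_ifs <;> rfl
    · rw [if_neg (c := i = b ∧ _) fun h => hne h.1, Equiv.swap_apply_of_ne_of_ne (by simp only [legalPos]; omega)
        (by simp only [legalPos]; omega), ite_self]
  all_goals try simp only [legalPos]; omega
  intro s hs
  obtain ⟨v, hv, rfl⟩ := List.mem_map.1 hs
  have := hpos v hv
  exact ⟨wire_ne (by omega) (by simp only [legalPos]; omega) (by simp only [legalPos]; omega),
    wire_ne (by omega) (by simp only [legalPos]; omega) (by simp only [legalPos]; omega)⟩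

theorem checkGates_mulVec {B : ℕ} (hB : B ≤ k) (m : ℕ) (y : Bits (k * (2 * n))) :
    ∃ i ≤ B, (i = B ↔ ∀ b < B, Odd (blockCount k n m y b)) ∧
      (wpCircuitOp U δ (checkGates g k n N m B)).mulVec
        (Pi.single (withTokens k n N y (legalPos k n 0) (ladderPos k n 0)) 1) =
        Pi.single (withTokens k n N y (legalPos k n i) (ladderPos k n 0)) 1 := by
  induction B with
  | zero =>
    refine ⟨0, le_rfl, by simp, ?_⟩
    simp only [checkGates, List.range_zero, List.flatMap_nil, wpCircuitOp, Matrix.one_mulVec]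
  | succ B ih =>
    obtain ⟨i, hi, hiff, he⟩ := ih (by omega)
    refine ⟨if i = B ∧ Odd (blockCount k n m y B) then B + 1 else i, ?_, ?_, ?_⟩
    rotate_left 2
    · rw [checkGates, List.range_succ, List.flatMap_append, List.flatMap_singleton,
        wpCircuitOp_append, ← Matrix.mulVec_mulVec, ← checkGates, he,
        checkBlockGates_mulVec U δ (by omega) m y hi]
    · split_ifs <;> omega
    · rw [Nat.forall_lt_succ_right, ← hiff]
      by_cases h : i = B ∧ Odd (blockCount k n m y B)
      · rw [if_pos h]
        simp [h]
      · rw [if_neg h]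
        simp only [h, iff_false]
        omega

end Check

/-! ### Legal witnesses -/

section Legal

variable {k n m N : ℕ}

theorem weight_eq_card {K : ℕ} (y : Bits K) :
    weight y = ((Finset.range K).filter fun i => bitAt y i = true).card := by
  refine Finset.card_bij (fun i _ => i.val) ?_ ?_ ?_
  · intro i hi
    simpa [bitAt] using hi
  · intro i _ j _ h
    exact Fin.ext h
  · intro i hi
    simp only [Finset.mem_filter, Finset.mem_range] at hi
    exact ⟨⟨i, hi.1⟩, by simpa [bitAt, hi.1] using hi.2, rfl⟩

theorem injOn_position {v : ℕ → ℕ} (hv : ∀ b < k, v b < 2 * n) :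
    Set.InjOn (fun b => b * (2 * n) + v b) (Finset.range k) := by
  intro b hb c hc hbc
  have hb := hv b (by simpa using hb)
  have hc := hv c (by simpa using hc)
  have h := congrArg (· / (2 * n)) hbc
  simp only at h
  rwa [mul_comm, Nat.mul_add_div (by omega), Nat.div_eq_of_lt hb, mul_comm c,
    Nat.mul_add_div (by omega), Nat.div_eq_of_lt hc, add_zero, add_zero] at h

theorem Fits.weight_oneHot (h : Fits k n N) (x : Bits N) : weight (oneHot k n x) = k := by
  have hv : ∀ b < k, blockValue k x b < 2 * n :=
    fun b _ => (blockValue_lt k x b).trans_le h.two_pow_le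
  rw [weight_eq_card]
  have : ((Finset.range (k * (2 * n))).filter fun i => bitAt (oneHot k n x) i = true) =
      (Finset.range k).image fun b => b * (2 * n) + blockValue k x b := by
    ext i
    simp only [Finset.mem_filter, Finset.mem_range, Finset.mem_image]
    constructor
    · rintro ⟨hi, h1⟩
      have hb : i / (2 * n) < k := Nat.div_lt_of_lt_mul (hi.trans_eq (mul_comm _ _))
      rw [bitAt, dif_pos hi, oneHot] at h1
      refine ⟨i / (2 * n), hb, ?_⟩
      rw [← of_decide_eq_true h1]
      exact Nat.div_add_mod' i (2 * n)
    · rintro ⟨b, hb, rfl⟩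
      have hp := position_lt hb (hv b hb)
      refine ⟨hp, ?_⟩
      rw [bitAt, dif_pos hp, oneHot_apply x (hv b hb) hp]
      simp
  rw [this, Finset.card_image_of_injOn (injOn_position hv), Finset.card_range]

/-- Extension by zeros. -/
def pad (a : ℕ) (x : Bits m) : Bits (m + a) := Fin.append x fun _ => false

theorem bitAt_pad (a : ℕ) (x : Bits m) (q : ℕ) : bitAt (pad a x) q = bitAt x q := by
  simp only [bitAt, pad]
  by_cases h1 : q < m
  · rw [dif_pos h1, dif_pos (by omega)]
    exact Fin.append_left x _ ⟨q, h1⟩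
  · rw [dif_neg h1]
    split_ifs with h2
    · have : (⟨q, h2⟩ : Fin (m + a)) = Fin.natAdd m ⟨q - m, by omega⟩ :=
        Fin.ext (by simp; omega)
      rw [this, Fin.append_right]
    · rfl

theorem pad_injective (a : ℕ) : Function.Injective (pad a : Bits m → Bits (m + a)) := by
  intro x y h
  funext q
  rw [← bitAt_val x, ← bitAt_val y, ← bitAt_pad a, h, bitAt_pad]

/-- The first `m` qubits occupy the low-order bits of each block. That the other qubits are 0 is
therefore an upper bound on the block value. -/
theorem Fits.blockValue_pad_lt {a : ℕ} (h : Fits k n (m + a)) (x : Bits m) (b : ℕ) :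
    blockValue k (pad a x) b < 2 ^ ((m - b + k - 1) / k) := by
  refine Nat.lt_pow_two_of_testBit _ fun j hj => ?_
  rw [h.testBit_blockValue, bitAt_pad, bitAt, dif_neg]
  have h1 := Nat.mul_le_mul_left k hj
  have h2 := Nat.div_add_mod (m - b + k - 1) k
  have h3 := Nat.mod_lt (m - b + k - 1) h.pos_k
  have := h.pos_k
  omega

theorem Fits.blockCount_oneHot_pad {a : ℕ} (h : Fits k n (m + a)) (x : Bits m) {b : ℕ}
    (hb : b < k) : blockCount k n m (oneHot k n (pad a x)) b = 1 := by
  rw [blockCount, h.numValues_eq (by omega)]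
  have e : ∀ v ∈ List.range (2 ^ ((m - b + k - 1) / k)),
      bitAt (oneHot k n (pad a x)) (b * (2 * n) + v) = true ↔
        (v == blockValue k (pad a x) b) = true := by
    intro v hv
    have hv : v < 2 * n := (List.mem_range.1 hv).trans_le
      ((Nat.pow_le_pow_right (by omega) (Nat.div_le_div_right (by omega))).trans h.two_pow_le)
    have hp := position_lt hb hv
    rw [bitAt, dif_pos hp, oneHot_apply _ hv hp, decide_eq_true_eq, beq_iff_eq]
  rw [List.countP_congr e]
  exact List.count_eq_one_of_mem List.nodup_range (List.mem_range.2 (h.blockValue_pad_lt x b))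

/-- A pigeonhole argument. An odd count is positive, so each of the k disjoint blocks has a 1 in an
allowed position; since the weight is k, these are all the ones. Thus a parity check is enough to
detect legality. -/
theorem Fits.exists_eq_oneHot_pad {a : ℕ} (h : Fits k n (m + a)) {y : Bits (k * (2 * n))}
    (hw : weight y = k) (hy : ∀ b < k, Odd (blockCount k n m y b)) :
    ∃ x : Bits m, oneHot k n (pad a x) = y := by
  have hex : ∀ b, ∃ v, b < k → v < 2 ^ ((m - b + k - 1) / k) ∧
      bitAt y (b * (2 * n) + v) = true := by
    intro b
    by_cases hb : b < k
    · have hpos := (hy b hb).pos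
      rw [blockCount, h.numValues_eq (by omega), List.countP_pos_iff] at hpos
      obtain ⟨v, hv, hv'⟩ := hpos
      exact ⟨v, fun _ => ⟨List.mem_range.1 hv, hv'⟩⟩
    · exact ⟨0, fun h => absurd h hb⟩
  choose v hv using hex
  have hv2 : ∀ b < k, v b < 2 * n := fun b hb => (hv b hb).1.trans_le
    ((Nat.pow_le_pow_right (by omega) (Nat.div_le_div_right (by omega))).trans h.two_pow_le)
  have hS : (Finset.range k).image (fun b => b * (2 * n) + v b) =
      (Finset.range (k * (2 * n))).filter fun i => bitAt y i = true := by
    -- The chosen positions are k distinct ones of `y`, and `y` has only k.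
    refine Finset.eq_of_subset_of_card_le ?_ ?_
    · intro i hi
      obtain ⟨b, hb, rfl⟩ := Finset.mem_image.1 hi
      have hb := Finset.mem_range.1 hb
      exact Finset.mem_filter.2 ⟨Finset.mem_range.2 (position_lt hb (hv2 b hb)), (hv b hb).2⟩
    · rw [← weight_eq_card, hw, Finset.card_image_of_injOn (injOn_position hv2), Finset.card_range]
  let x : Bits m := fun q => (v (q % k)).testBit (q / k)
  have hx : ∀ b < k, blockValue k (pad a x) b = v b := by
    intro b hb
    refine Nat.eq_of_testBit_eq fun j => ?_
    rw [h.testBit_blockValue, bitAt_pad, bitAt]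
    split_ifs with hlt
    · simp only [x]
      rw [Nat.add_mul_mod_self_left, Nat.mod_eq_of_lt hb, Nat.add_mul_div_left _ _ h.pos_k,
        Nat.div_eq_of_lt hb, zero_add]
    -- The position is beyond the first `m` qubits, so `j` is at least the number of witness bits in
    -- block `b`, and the bound on `v b` makes this bit 0.
    · symm
      refine Nat.testBit_lt_two_pow ((hv b hb).1.trans_le (Nat.pow_le_pow_right (by omega) ?_))
      have h3 : m - b + k - 1 < (j + 1) * k := by
        rw [Nat.succ_mul, mul_comm]
        have := h.pos_k
        omega
      exact Nat.lt_succ_iff.1 ((Nat.div_lt_iff_lt_mul h.pos_k).2 h3)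
  refine ⟨x, funext fun i => ?_⟩
  have hb : i.val / (2 * n) < k := Nat.div_lt_of_lt_mul (i.2.trans_eq (mul_comm _ _))
  have hi := Finset.ext_iff.1 hS i.val
  simp only [Finset.mem_image, Finset.mem_range, Finset.mem_filter, i.2, true_and, bitAt_val] at hi
  rw [Bool.eq_iff_iff, ← hi, oneHot, hx _ hb, decide_eq_true_eq]
  constructor
  · intro e
    exact ⟨_, hb, by rw [← e]; exact Nat.div_add_mod' _ _⟩
  · rintro ⟨b, hb', e⟩
    rw [← e, Nat.mul_add_mod_self_right, Nat.mod_eq_of_lt (hv2 b hb'), mul_comm b,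
      Nat.mul_add_div (by have := hv2 b hb'; omega), Nat.div_eq_of_lt (hv2 b hb'), add_zero]

end Legal

/-! ### The gates of the circuit -/

section Wires

variable {g k n N : ℕ}

theorem Fits.mem_transferGates (h : Fits k n N) {q s d : ℕ} (hq : q < N)
    {G : BlockGate g k n N} (hG : G ∈ transferGates g k n N q s d) :
    ∃ p < k * (2 * n), G = WPGate.fredkin (wire k n N p) (wire k n N s) (wire k n N d) := by
  obtain ⟨p, hp, rfl⟩ := List.mem_map.1 hG
  exact ⟨p, h.lt_of_mem_onePositions hq hp, rfl⟩

theorem placeValue_pos (hn : 0 < n) (q : ℕ) : 0 < placeValue k n q :=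
  lt_min (Nat.two_pow_pos _) (by omega)

theorem Fits.pos_n (h : Fits k n N) : 0 < n := by
  have h1 := Nat.two_pow_pos ((N + k - 1) / k)
  have h2 := h.two_pow_le
  omega

theorem wf_fredkin_wire {i j l : ℕ} (hi : i < k * (2 * n) + (k + N + 3))
    (hj : j < k * (2 * n) + (k + N + 3)) (hl : l < k * (2 * n) + (k + N + 3)) (hij : i ≠ j)
    (hil : i ≠ l) (hjl : j ≠ l) :
    (WPGate.fredkin (wire k n N i) (wire k n N j) (wire k n N l) : BlockGate g k n N).WF := by
  simp [WPGate.WF, WPGate.wires, wire_ne hi hj hij, wire_ne hi hl hil, wire_ne hj hl hjl]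

/-- The qubits that signal that the witness is legal, and acceptance, are not used. -/
def AvoidsOutput (G : BlockGate g k n N) : Prop :=
  ∀ j, k * (2 * n) ≤ j → j < ladderPos k n 0 → wire k n N j ∉ G.wires

theorem Fits.ladderGates_wires (h : Fits k n N) {t i : ℕ} {cs : List ℕ} (hcs : ∀ c ∈ cs, c < N)
    (ht : t < N) (hi : i + cs.length ≤ N) {G : BlockGate g k n N}
    (hG : G ∈ ladderGates g k n N i cs t) : G.WF ∧ AvoidsOutput G := by
  induction cs generalizing i with
  | nil =>
    simp only [List.length_nil] at hi
    obtain ⟨p, hp, rfl⟩ := List.mem_map.1 hG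
    have hp := h.lt_of_mem_zeroPositions ht hp
    have hv := placeValue_pos (k := k) h.pos_n t
    have hl : ladderPos k n i < k * (2 * n) + (k + N + 3) := by simp only [ladderPos]; omega
    constructor
    · refine wf_fredkin_wire hl (by omega) (by omega) ?_ ?_ (by omega) <;>
        simp only [ladderPos] <;> omega
    · intro j hj hj'
      simp only [ladderPos] at hj' hl
      simp only [WPGate.wires, List.mem_cons, List.not_mem_nil, or_false, not_or, ladderPos]
      exact ⟨wire_ne (by omega) (by omega) (by omega), wire_ne (by omega) (by omega) (by omega),
        wire_ne (by omega) (by omega) (by omega)⟩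
  | cons c cs ih =>
    simp only [List.length_cons] at hi
    have htr : G ∈ transferGates g k n N c (ladderPos k n i) (ladderPos k n (i + 1)) →
        G.WF ∧ AvoidsOutput G := by
      intro hG
      obtain ⟨p, hp, rfl⟩ := h.mem_transferGates (hcs c (List.mem_cons_self ..)) hG
      constructor
      · refine wf_fredkin_wire ?_ ?_ ?_ ?_ ?_ ?_ <;> (try simp only [ladderPos]) <;> omega
      · intro j hj hj'
        simp only [ladderPos] at hj'
        simp only [WPGate.wires, List.mem_cons, List.not_mem_nil, or_false, not_or, ladderPos]
        exact ⟨wire_ne (by omega) (by omega) (by omega), wire_ne (by omega) (by omega) (by omega),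
          wire_ne (by omega) (by omega) (by omega)⟩
    rw [ladderGates, List.mem_append, List.mem_append] at hG
    rcases hG with (hG | hG) | hG
    · exact htr hG
    · exact ih (fun c hc => hcs c (List.mem_cons_of_mem _ hc)) (by omega) hG
    · exact htr hG

theorem Fits.blockGates_wires (h : Fits k n N) {H : Gate g N} (hH : H.WF)
    {G : BlockGate g k n N} (hG : G ∈ blockGates k n H) : G.WF ∧ AvoidsOutput G := by
  cases H with
  | one i q =>
    obtain ⟨p, hp, rfl⟩ := List.mem_map.1 hG
    have hp := h.lt_of_mem_zeroPositions q.2 hp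
    have hv := placeValue_pos (k := k) h.pos_n q
    constructor
    · simp only [WPGate.WF, WPGate.wires, List.nodup_cons, List.mem_cons, List.not_mem_nil,
        or_false, not_false_iff, List.nodup_nil, and_true]
      exact wire_ne (by omega) (by omega) (by omega)
    · intro j hj hj'
      simp only [ladderPos] at hj'
      simp only [WPGate.wires, List.mem_cons, List.not_mem_nil, or_false, not_or]
      exact ⟨wire_ne (by omega) (by omega) (by omega), wire_ne (by omega) (by omega) (by omega)⟩
  | cnot s t =>
    have := s.2
    exact h.ladderGates_wires (by simp) t.2 (by simp; omega) hG
  | toffoli cs t =>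
    have := hH.length_lt
    exact h.ladderGates_wires (by simp) t.2 (by simp; omega) hG
  | fanout s ts =>
    obtain ⟨t, ht, hG⟩ := List.mem_flatMap.1 hG
    obtain ⟨t, -, rfl⟩ := List.mem_map.1 ht
    have := s.2
    exact h.ladderGates_wires (by simp) t.2 (by simp; omega) hG

theorem Fits.blockCircuit_wf (h : Fits k n N) (m : ℕ) (out : Fin N) {C : List (Gate g N)}
    (hC : ∀ H ∈ C, H.WF) : ∀ G ∈ blockCircuit k n m out C, G.WF := by
  intro G hG
  rw [blockCircuit, List.mem_append, List.mem_append] at hG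
  rcases hG with hG | hG | hG
  · obtain ⟨b, hb, hG⟩ := List.mem_flatMap.1 hG
    obtain ⟨v, hv, rfl⟩ := List.mem_map.1 hG
    have hb := List.mem_range.1 hb
    have hp := position_lt hb ((List.mem_range.1 hv).trans_le (min_le_right _ _))
    refine wf_fredkin_wire ?_ ?_ ?_ ?_ ?_ ?_ <;> (try simp only [legalPos]) <;> omega
  · obtain ⟨H, hH, hG⟩ := List.mem_flatMap.1 hG
    exact (h.blockGates_wires (hC H hH) hG).1
  · obtain ⟨p, hp, rfl⟩ := h.mem_transferGates out.2 hG
    refine wf_fredkin_wire ?_ ?_ ?_ ?_ ?_ ?_ <;> (try simp only [legalPos, outPos]) <;> omega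

end Wires

end WPQ

namespace WPQ

/-! ### The acceptance probability -/

section Acceptance

theorem withAncillas_eq_sum {m a : ℕ} (ψ : QVec m) (z : Bits a) :
    withAncillas ψ z = ∑ y, ψ y • Pi.single (Fin.append y z) (1 : ℂ) := by
  funext x
  have hx : Fin.append (fun i => x (Fin.castAdd a i)) (fun j => x (Fin.natAdd m j)) = x :=
    Fin.append_castAdd_natAdd
  simp only [withAncillas, Finset.sum_apply, Pi.smul_apply, smul_eq_mul, Pi.single_apply, mul_ite,
    mul_one, mul_zero]
  split_ifs with h
  · rw [Finset.sum_eq_single fun i => x (Fin.castAdd a i)]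
    · rw [if_pos]
      rw [← h, hx]
    · intro y _ hy
      rw [if_neg]
      rintro rfl
      exact hy (funext fun i => by rw [Fin.append_left])
    · intro h
      exact absurd (Finset.mem_univ _) h
  · refine (Finset.sum_eq_zero fun y _ => ?_).symm
    rw [if_neg]
    rintro rfl
    exact h (funext fun j => by rw [Fin.append_right])

theorem probOne_congr {N : ℕ} {φ ψ : QVec N} {q : Fin N} (h : ∀ x, x q = true → φ x = ψ x) :
    probOne φ q = probOne ψ q :=
  Finset.sum_congr rfl fun x hx => by rw [h x (Finset.mem_filter.1 hx).2]

theorem probOne_smul {N : ℕ} (r : ℂ) (φ : QVec N) (q : Fin N) :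
    probOne (r • φ) q = ‖r‖ ^ 2 * probOne φ q := by
  simp only [probOne, Finset.mul_sum, Pi.smul_apply, smul_eq_mul, norm_mul, mul_pow]

theorem withAncillas_smul {m a : ℕ} (r : ℂ) (ψ : QVec m) (z : Bits a) :
    withAncillas (r • ψ) z = r • withAncillas ψ z := by
  funext x
  simp only [withAncillas, Pi.smul_apply, smul_eq_mul, mul_ite, mul_zero]

theorem MiniInstance.acceptProb_smul {g : ℕ} (U : Fin g → Matrix Bool Bool ℂ)
    (I : MiniInstance g) (r : ℂ) (ψ : QVec I.m) :
    I.acceptProb U (r • ψ) = ‖r‖ ^ 2 * I.acceptProb U ψ := by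
  rw [MiniInstance.acceptProb, withAncillas_smul, Matrix.mulVec_smul, probOne_smul]
  rfl

/-- Rescaling extends soundness to vectors of norm at most 1. This is needed since restricting a
witness to its legal part can shorten it, even to 0, which is treated separately. -/
theorem MiniInstance.acceptProb_le {g : ℕ} {U : Fin g → Matrix Bool Bool ℂ}
    {I : MiniInstance g} {s : ℝ} (hs : 0 ≤ s) (h : ∀ ψ, IsState ψ → I.acceptProb U ψ ≤ s)
    {ψ : QVec I.m} (hψ : ∑ x, ‖ψ x‖ ^ 2 ≤ 1) : I.acceptProb U ψ ≤ s := by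
  set r := ∑ x, ‖ψ x‖ ^ 2 with hr
  have hr0 : 0 ≤ r := Finset.sum_nonneg fun _ _ => by positivity
  have hnorm : ‖(Real.sqrt r : ℂ)‖ ^ 2 = r := by
    rw [Complex.norm_real, Real.norm_eq_abs, sq_abs, Real.sq_sqrt hr0]
  rcases hr0.eq_or_lt with h0 | hpos
  · have hz : ψ = (0 : ℂ) • ψ := by
      funext x
      have := (Finset.sum_eq_zero_iff_of_nonneg fun _ _ => by positivity).1 (hr ▸ h0).symm x
        (Finset.mem_univ x)
      simpa using this
    rw [hz, acceptProb_smul]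
    simpa using hs
  · have hne : (Real.sqrt r : ℂ) ≠ 0 := by
      simpa using (Real.sqrt_pos.2 hpos).ne'
    have hstate : IsState ((Real.sqrt r : ℂ)⁻¹ • ψ) := by
      simp only [IsState, Pi.smul_apply, smul_eq_mul, norm_mul, mul_pow, norm_inv, inv_pow, hnorm]
      rw [← Finset.mul_sum, ← hr, inv_mul_cancel₀ hpos.ne']
    have hle := h _ hstate
    have e : ψ = (Real.sqrt r : ℂ) • ((Real.sqrt r : ℂ)⁻¹ • ψ) := by
      rw [smul_smul, mul_inv_cancel₀ hne, one_smul]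
    rw [e, acceptProb_smul, hnorm]
    calc r * _ ≤ r * s := mul_le_mul_of_nonneg_left hle hr0
      _ ≤ s := mul_le_of_le_one_left hs hψ

variable {g k n m a N : ℕ} (U : Fin g → Matrix Bool Bool ℂ) (δ : ℝ)

/-- With the token stuck before position k, the last legality ancilla and the output qubit are both
0. The simulated gates avoid these two qubits and the final transfer at most exchanges them, so they
remain 0. -/
theorem Fits.mulVec_apply_eq_zero (h : Fits k n N) {C : List (Gate g N)} (hC : ∀ H ∈ C, H.WF)
    (out : Fin N) {i : ℕ} (hi : i < k) (y : Bits (k * (2 * n)))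
    {z : Bits (k * (2 * n) + (k + N + 3))} (hz : z (wire k n N (outPos k n)) = true) :
    (wpCircuitOp U δ (C.flatMap (blockGates k n) ++
      transferGates g k n N out (legalPos k n k) (outPos k n))).mulVec
      (Pi.single (withTokens k n N y (legalPos k n i) (ladderPos k n 0)) 1) z = 0 := by
  rw [Matrix.mulVec_single_one, Matrix.col_apply]
  by_contra hne
  have key := wpCircuitOp_ne_zero U δ (P := fun x y : Bits (k * (2 * n) + (k + N + 3)) =>
    y (wire k n N (legalPos k n k)) = false ∧ y (wire k n N (outPos k n)) = false →
      x (wire k n N (legalPos k n k)) = false ∧ x (wire k n N (outPos k n)) = false)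
    (fun _ => id) (fun _ _ _ h1 h2 h3 => h1 (h2 h3)) ?_ hne ⟨?_, ?_⟩
  · rw [hz] at key
    exact absurd key.2 (by simp)
  · intro G hG x y hxy hy
    rcases List.mem_append.1 hG with hG | hG
    · obtain ⟨H, hH, hG⟩ := List.mem_flatMap.1 hG
      have hav := (h.blockGates_wires (hC H hH) hG).2
      rw [G.apply_eq_of_op_ne_zero U δ hxy (hav (legalPos k n k)
          (by simp only [legalPos]; omega) (by simp only [legalPos, ladderPos]; omega)),
        G.apply_eq_of_op_ne_zero U δ hxy (hav (outPos k n)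
          (by simp only [outPos]; omega) (by simp only [outPos, ladderPos]; omega))]
      exact hy
    · obtain ⟨p, -, rfl⟩ := h.mem_transferGates out.2 hG
      simp only [WPGate.op, basisMap, ne_eq, ite_eq_right_iff, one_ne_zero, imp_false,
        not_not] at hxy
      rw [hxy]
      split_ifs
      · rw [Function.comp_apply, Function.comp_apply, Equiv.swap_apply_left,
          Equiv.swap_apply_right]
        exact hy.symm
      · exact hy
  · rw [withTokens_wire_of_le (by simp only [legalPos]; omega) (by simp only [legalPos]; omega),
      decide_eq_false_iff_not]
    simp only [legalPos, ladderPos]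
    omega
  · rw [withTokens_wire_of_le (by simp only [outPos]; omega) (by simp only [outPos]; omega),
      decide_eq_false_iff_not]
    simp only [outPos, legalPos, ladderPos]
    omega

theorem Fits.blockCircuit_mulVec_oneHot (h : Fits k n (m + a)) {C : List (Gate g (m + a))}
    (hC : ∀ H ∈ C, H.WF) (out : Fin (m + a)) (x : Bits m) :
    (wpCircuitOp U δ (blockCircuit k n m out C)).mulVec
      (Pi.single (withTokens k n (m + a) (oneHot k n (pad a x)) (legalPos k n 0)
        (ladderPos k n 0)) 1) =
      (embed (finalState k n out)).mulVec ((circuitOp U C).mulVec (Pi.single (pad a x) 1)) := by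
  obtain ⟨i, -, hiff, he⟩ := checkGates_mulVec (g := g) (N := m + a) U δ le_rfl m
    (oneHot k n (pad a x))
  obtain rfl := hiff.2 fun b hb => by rw [h.blockCount_oneHot_pad x hb]; exact odd_one
  rw [blockCircuit, wpCircuitOp_append, wpCircuitOp_append, ← Matrix.mulVec_mulVec,
    ← Matrix.mulVec_mulVec, he, ← encode, ← embed_mulVec_single (encode i n),
    h.blockGates_circuit_embed U δ hC, h.transferGates_embed]

theorem Fits.blockCircuit_mulVec_apply_eq_zero (h : Fits k n (m + a))
    {C : List (Gate g (m + a))} (hC : ∀ H ∈ C, H.WF) (out : Fin (m + a))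
    {y : Bits (k * (2 * n))} (hw : weight y = k)
    (hy : y ∉ Set.range fun x : Bits m => oneHot k n (pad a x))
    {z : Bits (k * (2 * n) + (k + (m + a) + 3))}
    (hz : z (wire k n (m + a) (outPos k n)) = true) :
    (wpCircuitOp U δ (blockCircuit k n m out C)).mulVec
      (Pi.single (withTokens k n (m + a) y (legalPos k n 0) (ladderPos k n 0)) 1) z = 0 := by
  obtain ⟨i, hi, hiff, he⟩ := checkGates_mulVec (g := g) (N := m + a) U δ le_rfl m y
  rw [blockCircuit, wpCircuitOp_append, ← Matrix.mulVec_mulVec, he]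
  refine h.mulVec_apply_eq_zero U δ hC out (lt_of_le_of_ne hi fun e => hy ?_) y hz
  exact h.exists_eq_oneHot_pad hw (hiff.1 e)

theorem Fits.oneHot_pad_injective (h : Fits k n (m + a)) :
    Function.Injective fun x : Bits m => oneHot k n (pad a x) :=
  h.oneHot_injective.comp (pad_injective a)

theorem append_eq_withTokens (y : Bits (k * (2 * n))) :
    Fin.append y (fun i : Fin (k + N + 3) => decide (i.val = 0 ∨ i.val = k + 2)) =
      withTokens k n N y (legalPos k n 0) (ladderPos k n 0) := by
  funext i
  refine Fin.addCases (fun i => ?_) (fun i => ?_) i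
  · rw [Fin.append_left, withTokens, dif_pos (by simp)]
    rfl
  · rw [Fin.append_right, withTokens, dif_neg (by simp)]
    simp only [Fin.val_natAdd, legalPos, ladderPos]
    congr 1
    rw [eq_iff_iff]
    omega

/-- Acceptance only looks at amplitudes with output 1, and there the illegal basis states contribute
0. The legal ones evolve as in the original circuit and end in distinct states `finalState`, whose
output qubit is the original output bit. -/
theorem Fits.probOne_blockCircuit (h : Fits k n (m + a)) {C : List (Gate g (m + a))}
    (hC : ∀ H ∈ C, H.WF) (out : Fin (m + a)) {ψ : QVec (k * (2 * n))} (hψ : HasWeight k ψ) :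
    probOne ((wpCircuitOp U δ (blockCircuit k n m out C)).mulVec (withAncillas ψ
      fun i : Fin (k + (m + a) + 3) => decide (i.val = 0 ∨ i.val = k + 2)))
      (wire k n (m + a) (outPos k n)) =
    probOne ((circuitOp U C).mulVec (withAncillas (fun x => ψ (oneHot k n (pad a x)))
      fun _ => false)) out := by
  -- Both sides become probabilities for the same qubit of the large system, to be compared
  -- amplitude by amplitude.
  rw [← probOne_embed (h.finalState_injective out) (finalState_out out)]
  refine probOne_congr fun z hz => ?_
  rw [withAncillas_eq_sum, withAncillas_eq_sum, Matrix.mulVec_sum, Matrix.mulVec_sum,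
    Matrix.mulVec_sum, Finset.sum_apply, Finset.sum_apply]
  refine (Finset.sum_of_injOn (fun x : Bits m => oneHot k n (pad a x))
    h.oneHot_pad_injective.injOn (fun _ _ => Finset.mem_coe.2 (Finset.mem_univ _)) ?_ ?_).symm
  · intro y _ hy
    rw [Matrix.mulVec_smul, Pi.smul_apply, smul_eq_mul, append_eq_withTokens]
    by_cases hw : weight y = k
    · rw [h.blockCircuit_mulVec_apply_eq_zero U δ hC out hw (fun h => hy (by simpa using h)) hz,
        mul_zero]
    · rw [hψ y hw, zero_mul]
  · intro x _
    rw [Matrix.mulVec_smul, Matrix.mulVec_smul, Matrix.mulVec_smul, Pi.smul_apply, Pi.smul_apply,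
      append_eq_withTokens, h.blockCircuit_mulVec_oneHot U δ hC out x]
    rfl

theorem MiniInstance.acceptProb_toWP (I : MiniInstance g) (h : Fits I.k I.n (I.m + I.a))
    (hC : ∀ H ∈ I.circuit, H.WF) {ψ : QVec (I.k * (2 * I.n))} (hψ : HasWeight I.k ψ) :
    I.toWP.acceptProb U δ ψ = I.acceptProb U fun x => ψ (oneHot I.k I.n (pad I.a x)) :=
  h.probOne_blockCircuit U δ hC I.out hψ

end Acceptance

end WPQ

namespace WPQ

/-! ### Sizes -/

section Sizes

variable {g k n N : ℕ}

theorem Fits.two_mul_le (h : Fits k n N) : 2 * n ≤ k * (2 * n) :=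
  Nat.le_mul_of_pos_left _ h.pos_k

theorem Fits.length_transferGates_le (h : Fits k n N) {q : ℕ} (hq : q < N) (s d : ℕ) :
    (transferGates g k n N q s d).length ≤ 2 * n := by
  rw [transferGates, List.length_map, h.onePositions_eq hq, List.length_map]
  refine (List.length_filter_le _ _).trans ?_
  rw [List.length_range]
  exact h.two_pow_le

theorem Fits.length_zeroPositions_le (h : Fits k n N) {q : ℕ} (hq : q < N) :
    (zeroPositions k n N q).length ≤ 2 * n := by
  rw [h.zeroPositions_eq hq, List.length_map]
  refine (List.length_filter_le _ _).trans ?_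
  rw [List.length_range]
  exact h.two_pow_le

theorem length_flatMap_le {α β : Type*} {l : List α} {F : α → List β} {c : ℕ}
    (h : ∀ x ∈ l, (F x).length ≤ c) : (l.flatMap F).length ≤ l.length * c := by
  rw [List.length_flatMap]
  simpa using List.sum_le_card_nsmul (l.map fun x => (F x).length) c (by simpa using h)

theorem Fits.length_ladderGates_le (h : Fits k n N) {t i : ℕ} {cs : List ℕ}
    (hcs : ∀ c ∈ cs, c < N) (ht : t < N) :
    (ladderGates g k n N i cs t).length ≤ (2 * cs.length + 1) * (2 * n) := by
  induction cs generalizing i with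
  | nil =>
    rw [ladderGates, flipGates, List.length_map]
    simpa using h.length_zeroPositions_le ht
  | cons c cs ih =>
    have h1 := ih (i := i + 1) fun c hc => hcs c (List.mem_cons_of_mem _ hc)
    have h2 := h.length_transferGates_le (g := g) (hcs c (List.mem_cons_self ..))
      (ladderPos k n i) (ladderPos k n (i + 1))
    rw [ladderGates, List.length_append, List.length_append, List.length_cons]
    have : (2 * (cs.length + 1) + 1) * (2 * n) = (2 * cs.length + 1) * (2 * n) + 2 * n + 2 * n := by
      ring
    omega

theorem Fits.length_blockGates_le (h : Fits k n N) {G : Gate g N} (hG : G.WF) :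
    (blockGates k n G).length ≤ 3 * N * (2 * n) := by
  cases G with
  | one i q =>
    have := q.2
    rw [blockGates, rotateGates, List.length_map]
    exact (h.length_zeroPositions_le q.2).trans (Nat.le_mul_of_pos_left _ (by omega))
  | cnot s t =>
    have := s.2
    refine (h.length_ladderGates_le (by simp) t.2).trans (Nat.mul_le_mul_right _ ?_)
    simp
    omega
  | toffoli cs t =>
    have := hG.length_lt
    refine (h.length_ladderGates_le (by simp) t.2).trans (Nat.mul_le_mul_right _ ?_)
    rw [List.length_map]
    omega
  | fanout s ts =>
    have hlen : ts.length ≤ N := by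
      simp only [Gate.WF, Gate.wires, Gate.controls, Gate.targets, List.singleton_append,
        List.nodup_cons] at hG
      simpa using hG.2.length_le_card
    rw [blockGates]
    refine (length_flatMap_le (c := 3 * (2 * n)) fun t ht => ?_).trans ?_
    · obtain ⟨t, -, rfl⟩ := List.mem_map.1 ht
      simpa using h.length_ladderGates_le (g := g) (i := 0) (cs := [s.val]) (by simp) t.2
    · rw [List.length_map, ← mul_assoc, mul_comm ts.length]
      exact Nat.mul_le_mul_right _ (Nat.mul_le_mul_left _ hlen)

theorem Fits.length_blockCircuit_le (h : Fits k n N) (m : ℕ) (out : Fin N) {C : List (Gate g N)}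
    (hC : ∀ H ∈ C, H.WF) : (blockCircuit k n m out C).length ≤
      k * (2 * n) + (C.length * (3 * N * (2 * n)) + 2 * n) := by
  rw [blockCircuit, List.length_append, List.length_append]
  refine add_le_add ?_ (add_le_add (length_flatMap_le fun G hG => h.length_blockGates_le (hC G hG))
    (h.length_transferGates_le out.2 _ _))
  refine (length_flatMap_le (c := 2 * n) fun b _ => ?_).trans_eq (by rw [List.length_range])
  rw [checkBlockGates, List.length_map, List.length_range]
  exact min_le_right _ _

end Sizes

/-! ### The reduction -/

section Reduction

variable {g t : ℕ} {I : MiniInstance g}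

/-- The output qubit witnesses that there is at least one qubit, so k log₂ n is positive. -/
theorem MiniInstance.Valid.pos (hI : I.Valid t) : 0 < I.k ∧ 2 ≤ I.n := by
  have hN : 0 < I.m + I.a := (Nat.zero_le _).trans_lt I.out.2
  have h : (0 : ℝ) < I.k * Real.logb 2 I.n := lt_of_lt_of_le (by exact_mod_cast hN) hI.2.2.2.1
  constructor
  · by_contra h0
    simp [Nat.eq_zero_of_not_pos h0] at h
  · by_contra hn
    obtain h0 | h1 : I.n = 0 ∨ I.n = 1 := by omega
    · simp [h0] at h
    · simp [h1] at h

theorem MiniInstance.Valid.le_mul (hI : I.Valid t) {M : ℕ}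
    (hM : (M : ℝ) ≤ I.k * Real.logb 2 I.n) : M ≤ I.k * I.n := by
  have hn : (0 : ℝ) < I.n := by exact_mod_cast (Nat.zero_lt_two.trans_le hI.pos.2)
  have h1 : Real.logb 2 I.n ≤ I.n := by
    rw [Real.logb_le_iff_le_rpow (by norm_num) hn, Real.rpow_natCast]
    exact_mod_cast Nat.lt_two_pow_self.le
  have h2 : (M : ℝ) ≤ I.k * I.n := hM.trans (mul_le_mul_of_nonneg_left h1 (Nat.cast_nonneg _))
  exact_mod_cast h2

/-- Write ⌈N/k⌉ = J + 1. Then kJ ≤ N ≤ k log₂ n gives 2^J ≤ n and 2^(J+1) ≤ 2n. The rounding up is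
the reason for 2n instead of n qubits per block. -/
theorem MiniInstance.Valid.fits (hI : I.Valid t) : Fits I.k I.n (I.m + I.a) := by
  obtain ⟨hk, hn⟩ := hI.pos
  refine ⟨hk, ?_⟩
  have hN : 0 < I.m + I.a := (Nat.zero_le _).trans_lt I.out.2
  obtain ⟨J, hJ⟩ : ∃ J, (I.m + I.a + I.k - 1) / I.k = J + 1 := by
    refine Nat.exists_eq_add_one.2 (Nat.div_pos ?_ hk)
    omega
  have h1 : I.k * J ≤ I.m + I.a := by
    have := Nat.div_mul_le_self (I.m + I.a + I.k - 1) I.k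
    rw [hJ, Nat.succ_mul, mul_comm] at this
    omega
  have h2 : (I.k : ℝ) * J ≤ I.k * Real.logb 2 I.n :=
    le_trans (by exact_mod_cast h1) hI.2.2.2.1
  have h3 := le_of_mul_le_mul_left h2 (by exact_mod_cast hk)
  rw [Real.le_logb_iff_rpow_le (by norm_num) (by positivity), Real.rpow_natCast] at h3
  have h4 : 2 ^ J ≤ I.n := by exact_mod_cast h3
  rw [hJ, pow_succ]
  omega

theorem MiniInstance.weight_toWP_anc_le (I : MiniInstance g) : weight I.toWP.anc ≤ 2 := by
  rw [weight_eq_card]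
  refine (Finset.card_le_card (t := {0, I.k + 2}) fun i hi => ?_).trans Finset.card_le_two
  obtain ⟨hi, h⟩ := Finset.mem_filter.1 hi
  rw [bitAt, dif_pos (Finset.mem_range.1 hi)] at h
  simpa [MiniInstance.toWP] using h

/-- A bound for the size of the transformed instances. -/
noncomputable def sizeBound : Polynomial ℕ := 3 * Polynomial.X ^ 3 + 2 * Polynomial.X + 3

theorem eval_sizeBound (x : ℕ) : sizeBound.eval x = 3 * x ^ 3 + 2 * x + 3 := by
  simp [sizeBound]

theorem MiniInstance.Valid.toWP (hI : I.Valid t) (U : Fin g → Matrix Bool Bool ℂ) (δ : ℝ) :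
    I.toWP.Valid U δ sizeBound fun _ => 2 := by
  have h := hI.fits
  have hwf := h.blockCircuit_wf I.m I.out hI.1
  have hN := hI.le_mul hI.2.2.2.1
  have hL := hI.le_mul hI.2.2.2.2
  have hn := hI.pos.2
  have hn' : I.toWP.n = I.k * (2 * I.n) := rfl
  have e : I.k * (2 * I.n) = 2 * (I.k * I.n) := by ring
  refine ⟨hwf, weightPreserving_wpCircuitOp U δ hwf, ?_, ?_, I.weight_toWP_anc_le⟩
  · have hk : I.k ≤ I.k * I.n := Nat.le_mul_of_pos_right _ (by omega)
    have ha : I.toWP.a = I.k + (I.m + I.a) + 3 := rfl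
    rw [eval_sizeBound, hn', ha]
    omega
  · refine (h.length_blockCircuit_le I.m I.out hI.1).trans ?_
    have h2 := h.two_mul_le
    rw [eval_sizeBound, hn']
    have hN' : I.m + I.a ≤ I.k * (2 * I.n) := by omega
    have hL' : I.circuit.length ≤ I.k * (2 * I.n) := by omega
    clear hwf hn' e
    generalize I.k * (2 * I.n) = x at *
    -- With x = k · 2n, the numbers of qubits and of old gates and 2n are all at most x. This gives
    -- the cubic term of `sizeBound`; the check and the final transfer account for 2x.
    have : I.circuit.length * (3 * (I.m + I.a) * (2 * I.n)) ≤ x * (3 * x * x) := by gcongr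
    nlinarith

/-- The size parameter does not decrease, so a non-increasing c and a non-decreasing s only relax
the thresholds. -/
theorem MiniInstance.Valid.n_le (hI : I.Valid t) : I.n ≤ I.toWP.n :=
  (by omega : I.n ≤ 2 * I.n).trans hI.fits.two_mul_le

theorem stmMap_mainStm_code (hI : I.Valid t) : I.toWP.code = stmMap mainStm I.code := by
  rw [I.toWP_code hI.fits hI.1, stmMap_mainStm]

theorem stmMap_mainStm_mem_yes (U : Fin g → Matrix Bool Bool ℂ) (δ : ℝ) {c s : ℕ → unitInterval}
    (hc : Antitone c) {y : List Bool} (hy : y ∈ (MiniQCSAT U t c s).yes) :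
    stmMap mainStm y ∈ (WPQCSAT U δ sizeBound (fun _ => 2) c s).yes := by
  obtain ⟨I, rfl, hI, ψ, hψ, hacc⟩ := hy
  have h := hI.fits
  have hinj := h.oneHot_pad_injective
  have hw : HasWeight I.k ((embed fun x : Bits I.m => oneHot I.k I.n (pad I.a x)).mulVec ψ) := by
    intro y hy
    refine embed_mulVec_of_notMem ψ ?_
    rintro ⟨x, rfl⟩
    exact hy (h.weight_oneHot _)
  refine ⟨I.toWP, stmMap_mainStm_code hI, hI.toWP U δ, _, isState_embed hinj hψ, hw, ?_⟩
  rw [I.acceptProb_toWP U δ h hI.1 hw]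
  have e : (fun x => (embed fun x : Bits I.m => oneHot I.k I.n (pad I.a x)).mulVec ψ
      (oneHot I.k I.n (pad I.a x))) = ψ := funext fun x => embed_mulVec_apply hinj ψ x
  rw [e]
  exact le_trans (hc hI.n_le) hacc

theorem stmMap_mainStm_mem_no (U : Fin g → Matrix Bool Bool ℂ) (δ : ℝ) {c s : ℕ → unitInterval}
    (hs : Monotone s) {y : List Bool} (hy : y ∈ (MiniQCSAT U t c s).no) :
    stmMap mainStm y ∈ (WPQCSAT U δ sizeBound (fun _ => 2) c s).no := by
  obtain ⟨I, rfl, hI, hacc⟩ := hy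
  have h := hI.fits
  refine ⟨I.toWP, stmMap_mainStm_code hI, hI.toWP U δ, fun ψ hψ hw => ?_⟩
  rw [I.acceptProb_toWP U δ h hI.1 hw]
  refine (MiniInstance.acceptProb_le (s _).2.1 hacc ?_).trans (hs hI.n_le)
  rw [← (hψ : ∑ x, ‖ψ x‖ ^ 2 = 1)]
  -- The legal amplitudes form a subfamily of those of the unit vector `ψ`, so their squares sum to
  -- at most 1.
  rw [← Finset.sum_image (f := fun y => ‖ψ y‖ ^ 2)
    (g := fun x : Bits I.m => oneHot I.k I.n (pad I.a x)) h.oneHot_pad_injective.injOn]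
  exact Finset.sum_le_sum_of_subset_of_nonneg (Finset.subset_univ _) fun _ _ _ => by positivity

end Reduction

end WPQ

theorem mainTheorem10 :
    ∃ (p : Polynomial ℕ) (f : ℕ → ℕ), Computable f ∧
      ∀ (g : ℕ) (U : Fin g → Matrix Bool Bool ℂ) (δ : ℝ) (c s : ℕ → unitInterval),
        (∀ i, U i ∈ Matrix.unitaryGroup Bool ℂ) → Antitone c → Monotone s →
          WPQ.QMHard U 1 c s (WPQ.WPQCSAT U δ p f c s) := by
  -- The value 2 counts the ancillas that start in state 1: the legality token and the ladder token.
  refine ⟨WPQ.sizeBound, fun _ => 2, Computable.const 2, fun g U δ c s _ hc hs A hA => ?_⟩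
  refine hA.2.stmMap WPQ.realizable_mainStm (fun y hy => WPQ.stmMap_mainStm_mem_yes U δ hc hy)
    (fun y hy => WPQ.stmMap_mainStm_mem_no U δ hs hy) fun y => ?_
  exact (WPQ.firstNat_stmMap_mainStm y).le
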